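/- Let $f\in C^\infty((\mathbb R^3\setminus\{0\})\times[0,1),\mathbb R)$, $f=f(q,\varepsilon)$, be invariant under rotations of $q$ about the $z$-axis and under the reflection $z\mapsto -z$, and write $f(r,z,\varepsilon)$ for it in cylindrical coordinates. For $\omega\ne0$ and $\varepsilon\in[0,1)$ let $$H_{\omega,\varepsilon}(p_r,p_z,r,z)=\tfrac12(p_r^2+p_z^2)+\frac{\omega^2}{2r^2}-\frac1{\sqrt{r^2+z^2}}+\varepsilon f(r,z,\varepsilon)\qquad(r>0),$$ and consider the reduced Hamiltonian system $\dot p_r=-\partial_rH_{\omega,\varepsilon}$, $\dot p_z=-\partial_zH_{\omega,\varepsilon}$, $\dot r=\partial_{p_r}H_{\omega,\varepsilon}$, $\dot z=\partial_{p_z}H_{\omega,\varepsilon}$. Let $\mathcal M(h,\omega,\varepsilon)$ be the connected component of $\{r>0,\ H_{\omega,\varepsilon}=h\}$ lying over $(r,z)=(\omega^2,0)$ (it is the whole level set whenever the latter is connected and meets $\{r=\omega^2,z=0\}$, in particular for $\varepsilon=0$, $-1<2h\omega^2<0$). A periodic solution $\xi=(p_r,p_z,r,z)$ is a *brake orbit*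 if $p_r=p_z=0$ at two different times; it is *$z$-symmetric* if for some $t_0$ one has $p_r(t_0)=z(t_0)=0$ and $\xi(t_0+t)=\mathrm{diag}(-1,1,1,-1)\,\xi(t_0-t)$ for all $t\in\mathbb R$. Two orbits form a *Hopf link* in $\mathcal M$ if some homeomorphism $\mathcal M\to\mathbb S^3\subset\mathbb C^2$ takes them to the circles $\{w_2=0\}$ and $\{w_1=0\}$. Call sets $\Gamma_\varepsilon\subset\mathbb R^2$, $\varepsilon\in[0,\varepsilon_0)$, a *continuous family* if for every $\varepsilon\in[0,\varepsilon_0)$: each $x\in\Gamma_\varepsilon$ has a neighbourhood contained in $\Gamma_{\varepsilon'}$ for all $\varepsilon'\in[0,\varepsilon_0)$ near $\varepsilon$, and each $x\notin\overline{\Gamma_\varepsilon}$ has a neighbourhood disjoint from $\Gamma_{\varepsilon'}$ for all $\varepsilon'\in[0,\varepsilon_0)$ near $\varepsilon$. **Theorem.** There are $\varepsilon_0>0$ and a continuous family $\Gamma_\varepsilon\subset(\mathbb R\setminus\{0\})\times\mathbb R$, $\varepsilon\in[0,\varepsilon_0)$, with $$\Gamma_0=\{(\omega,h):\omega\neq0,\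 -1<2h\omega^2<0\},$$ such that for all $\varepsilon\in[0,\varepsilon_0)$ and $(\omega,h)\in\Gamma_\varepsilon$: 1. $\mathcal M(h,\omega,\varepsilon)$ is homeomorphic to $\mathbb S^3$ and $r>\omega^2/2$ on it; 2. up to time translation there is exactly one periodic solution $\xi_\varepsilon$ in $\mathcal M(h,\omega,\varepsilon)$ contained in the $(p_r,r)$-plane $\{p_z=z=0\}$; 3. up to time translation there is exactly one $z$-symmetric brake orbit $\xi_{bz,\varepsilon}$ in $\mathcal M(h,\omega,\varepsilon)$ that forms a Hopf link with $\xi_\varepsilon$ in $\mathcal M(h,\omega,\varepsilon)$. Moreover, the orbits $\xi_{bz,\varepsilon}$ can be parametrized so that $\xi_{bz,\varepsilon}(0)$ depends continuously on $(\varepsilon,\omega,h)$, $\varepsilon\in[0,\varepsilon_0)$, $(\omega,h)\in\Gamma_\varepsilon$; and for $\varepsilon=0$ the orbit $\xi_{bz,0}$ is the reduced circular Kepler orbit of energy $h$ and angular momentum $\omega$ about the $z$-axis, i.e. $r^2+z^2\equiv 1/(4h^2)$ along it. -/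

import Mathlib

open Set Filter Topology

/-- Smooth perturbations `f(q, ε)` on `(ℝ³ ∖ {0}) × [0, 1)` that are invariant under rotations about
the `z`-axis and under reflection in the `(x, y)`-plane. -/
structure IsSymmetricPerturbation (f : EuclideanSpace ℝ (Fin 3) → ℝ → ℝ) : Prop where
  smooth : ContDiffOn ℝ ((⊤ : ℕ∞) : WithTop ℕ∞) (fun q : EuclideanSpace ℝ (Fin 3) × ℝ => f q.1 q.2)
    ({0}ᶜ ×ˢ Ico (0 : ℝ) 1)
  rotation : ∀ x y z θ : ℝ, ∀ ε ∈ Ico (0 : ℝ) 1, !₂[x, y, z] ≠ (0 : EuclideanSpace ℝ (Fin 3)) →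
    f !₂[x * Real.cos θ - y * Real.sin θ, x * Real.sin θ + y * Real.cos θ, z] ε = f !₂[x, y, z] ε
  reflection : ∀ x y z : ℝ, ∀ ε ∈ Ico (0 : ℝ) 1, !₂[x, y, z] ≠ (0 : EuclideanSpace ℝ (Fin 3)) →
    f !₂[x, y, -z] ε = f !₂[x, y, z] ε

/-- Points `(p_r, p_z, r, z)`; the reduced phase space is the part `r > 0`. -/
abbrev Phase : Type := EuclideanSpace ℝ (Fin 4)

/-- `H_{ω,ε} = (p_r² + p_z²)/2 + ω²/(2r²) - 1/√(r² + z²) + ε f(r, z, ε)`; by rotational symmetry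
`f(r, z, ε)` is the value of `f` at the point `(r, 0, z)` of `ℝ³`. -/
noncomputable def reducedHamiltonian (f : EuclideanSpace ℝ (Fin 3) → ℝ → ℝ) (ω ε : ℝ)
    (x : Phase) : ℝ :=
  ((x 0) ^ 2 + (x 1) ^ 2) / 2 + ω ^ 2 / (2 * (x 2) ^ 2) - 1 / √((x 2) ^ 2 + (x 3) ^ 2)
    + ε * f !₂[x 2, 0, x 3] ε

/-- The Hamiltonian vector field `J ∇H_{ω,ε}`, where `J = (0, -I; I, 0)`. -/
noncomputable def hamiltonianField (f : EuclideanSpace ℝ (Fin 3) → ℝ → ℝ) (ω ε : ℝ)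
    (x : Phase) : Phase :=
  !₂[-(gradient (reducedHamiltonian f ω ε) x 2), -(gradient (reducedHamiltonian f ω ε) x 3),
    gradient (reducedHamiltonian f ω ε) x 0, gradient (reducedHamiltonian f ω ε) x 1]

/-- The full energy level `{H_{ω,ε} = h}` in the phase space `r > 0`. -/
def energyLevel (f : EuclideanSpace ℝ (Fin 3) → ℝ → ℝ) (h ω ε : ℝ) : Set Phase :=
  {x | 0 < x 2 ∧ reducedHamiltonian f ω ε x = h}

/-- The energy surface `M(h, ω, ε)`: the connected component of the energy level that lies over the
point `(r, z) = (ω², 0)`, the centre of the Hill region. It is the whole energy level as soon as the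
latter is connected (in particular for `ε = 0`, `-1 < 2hω² < 0`); a perturbation that is unbounded
near the origin or near infinity may create further components there. -/
def energySurface (f : EuclideanSpace ℝ (Fin 3) → ℝ → ℝ) (h ω ε : ℝ) : Set Phase :=
  {x | ∃ y ∈ energyLevel f h ω ε, y 2 = ω ^ 2 ∧ y 3 = 0 ∧
    x ∈ connectedComponentIn (energyLevel f h ω ε) y}

/-- Periodic solutions of the reduced Hamiltonian system, contained in `M(h, ω, ε)`. -/
structure IsPeriodicSolutionIn (f : EuclideanSpace ℝ (Fin 3) → ℝ → ℝ) (h ω ε : ℝ)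
    (ξ : ℝ → Phase) : Prop where
  mem : ∀ t, ξ t ∈ energySurface f h ω ε
  solves : ∀ t, HasDerivAt ξ (hamiltonianField f ω ε (ξ t)) t
  periodic : ∃ T > 0, Function.Periodic ξ T

/-- The orbit is contained in the `(p_r, r)`-plane. -/
def IsPlanar (ξ : ℝ → Phase) : Prop :=
  ∀ t, ξ t 1 = 0 ∧ ξ t 3 = 0

/-- All momenta vanish at two different times. -/
def IsBrake (ξ : ℝ → Phase) : Prop :=
  ∃ t₁ t₂ : ℝ, t₁ ≠ t₂ ∧ (ξ t₁ 0 = 0 ∧ ξ t₁ 1 = 0) ∧ (ξ t₂ 0 = 0 ∧ ξ t₂ 1 = 0)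

/-- `p_r(t₀) = z(t₀) = 0` and `ξ(t₀ + t) = diag(-1, 1, 1, -1) ξ(t₀ - t)` for all `t`. -/
def IsZSymmetric (ξ : ℝ → Phase) : Prop :=
  ∃ t₀ : ℝ, ξ t₀ 0 = 0 ∧ ξ t₀ 3 = 0 ∧
    ∀ t, ξ (t₀ + t) = !₂[-(ξ (t₀ - t) 0), ξ (t₀ - t) 1, ξ (t₀ - t) 2, -(ξ (t₀ - t) 3)]

/-- The unit sphere `𝕊³` of `ℂ²`. -/
abbrev ThreeSphere : Set (EuclideanSpace ℂ (Fin 2)) := Metric.sphere 0 1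

/-- `A` and `B` form a Hopf link in `M`: some homeomorphism of `M` onto `𝕊³ ⊆ ℂ²` carries them to
the two coordinate circles `{w₂ = 0}` and `{w₁ = 0}`. -/
def IsHopfLink (M A B : Set Phase) : Prop :=
  A ⊆ M ∧ B ⊆ M ∧ ∃ Φ : M ≃ₜ ThreeSphere,
    (∀ x : M, (x : Phase) ∈ A ↔ (Φ x : EuclideanSpace ℂ (Fin 2)) 1 = 0) ∧
    (∀ x : M, (x : Phase) ∈ B ↔ (Φ x : EuclideanSpace ℂ (Fin 2)) 0 = 0)

/-- A family of subsets `Γ ε` of the `(ω, h)`-plane depends continuously on `ε ∈ I`: near a point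
of `Γ ε` the neighbouring sets contain everything, and near a point outside the closure of `Γ ε`
they contain nothing. -/
structure IsContinuousFamily (I : Set ℝ) (Γ : ℝ → Set (ℝ × ℝ)) : Prop where
  inner : ∀ ε ∈ I, ∀ x ∈ Γ ε, ∀ᶠ q in 𝓝[I ×ˢ (univ : Set (ℝ × ℝ))] (ε, x), q.2 ∈ Γ q.1
  outer : ∀ ε ∈ I, ∀ x ∉ closure (Γ ε), ∀ᶠ q in 𝓝[I ×ˢ (univ : Set (ℝ × ℝ))] (ε, x), q.2 ∉ Γ q.1

/-!
The energy `h` enters through the geometry of the Hill region: for `-1 < 2hω² < 0` and small `ε`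
the effective potential `V(r, z)` has a single well at level `h`, inside a window `[ω²/2, R] ×
[-R, R]` on whose boundary `V > h`. Within the window `V` is strictly increasing in `|z|`, and on
the axis `z = 0` it is strictly increasing in the distance from a centre `rc`. Everything
topological follows from these inequalities. The energy surface is the join of the circle of
directions of `p_z + i z` and the planar orbit `{p_z = z = 0}`, hence a three-sphere
(`HillWell.exists_homeomorph_sphere`), and the polar angle of `p_z + i z` increases at a definite
rate along every solution off the plane (`HillFlow.exists_isAngle`). The planar orbit is unique
because the polar angle of `(p_r, r - rc)` increases as well (`HillFlow.exists_planar`).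

The angle turns linking into a count of turns. A closed orbit that winds once around the plane
during a period is a graph over the circle of directions, and a homeomorphism of the sphere
straightens it to a coordinate circle (`exists_homeomorph_straightening`). Conversely, the core
circle of a Hopf link winds exactly once during a suitable period: otherwise the direction of `p_z
+ i z` would have a proper root on the core, hence by homotopy lifting on the whole complement of
the planar orbit, where some loop winds once (`exists_period_winding_one`). Combined with the two
time-reversing symmetries `diag(-1, 1, 1, -1)` and `diag(-1, -1, 1, 1)`, this shows that the
`z`-symmetric brake orbits linked with the planar orbit are exactly the solutions that start at a
point `(0, p_z, r, 0)` with `p_z > 0` and satisfy `p_r = 0` when the angle has advanced by a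
quarter turn (`IsQuarterBrake`).

The quarter-turn condition is an equation for the radius `r` of the starting point, which a first
integral of the Kepler problem makes explicit. The axial component of `L × A`, with the angular
momentum `L` and the Laplace–Runge–Lenz vector `A` (`keplerIntegral`), equals `p_z r (1 + 2hr)` up
to `O(ε)` at the start, and it vanishes at the quarter time exactly if `p_r` does. As it changes
only by `O(ε)` in between, also in the Lipschitz sense with respect to the starting point, the
condition reads `1 + 2hr = O(ε)` with a left side that is strictly monotone up to `O(ε)`. It has a
unique solution, which is continuous in the parameters and equals `-1/(2h)` for `ε = 0`
(`KeplerBox.exists_brake_launch`); Lipschitz bounds on the flow suffice, no derivative of the flow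
is needed. For `ε = 0` and this radius, the energy and the angular momentum force `r² + z²` to be
constant (`KeplerBox.sq_add_sq_eq`).

These arguments work for `ε` below a bound that is uniform on compact sets of parameters.
Integrating the optimal bound over the superlevel sets of a gauge function `paramMargin` produces
a continuous bound `brakeBound`, and `Γ_ε` consists of the parameters for which `ε` lies below it.
As the gauge has no local maximum at a value strictly between `0` and its supremum, these sets
form a continuous family (`IsSymmetricPerturbation.isContinuousFamily`).
-/

open scoped NNReal

/-! ### Global flows and polar angles -/

/-- A bounded, globally Lipschitz vector field is complete. -/
theorem LipschitzWith.exists_global_solution {E : Type*} [NormedAddCommGroup E] [NormedSpace ℝ E]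
    [CompleteSpace E] {v : E → E} {K L : ℝ≥0} (hv : LipschitzWith K v) (hb : ∀ x, ‖v x‖ ≤ L)
    (x : E) : ∃ ξ : ℝ → E, ξ 0 = x ∧ ∀ t, HasDerivAt ξ (v (ξ t)) t := by
  have key : ∀ n : ℕ, ∃ α : ℝ → E, α 0 = x ∧
      ∀ t ∈ Ioo (-(n + 1 : ℝ)) (n + 1), HasDerivAt α (v (α t)) t := by
    intro n
    have h0 : (0 : ℝ) ∈ Icc (-(n + 1 : ℝ)) (n + 1) := ⟨by linarith [n.cast_nonneg (α := ℝ)],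
      by positivity⟩
    have hp : IsPicardLindelof (fun _ => v) (⟨0, h0⟩ : Icc (-(n + 1 : ℝ)) (n + 1)) x
        (L * (n + 1)) 0 L K := IsPicardLindelof.of_time_independent (fun y _ => hb y)
          (hv.lipschitzOnWith) (by simp)
    obtain ⟨α, h1, h2⟩ := hp.exists_eq_forall_mem_Icc_hasDerivWithinAt₀
    exact ⟨α, h1, fun t ht => (h2 t (Ioo_subset_Icc_self ht)).hasDerivAt (Icc_mem_nhds ht.1 ht.2)⟩
  choose α h0 hα using key
  -- the solutions on `(-(n + 1), n + 1)` agree by uniqueness and are glued together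
  have agree : ∀ n m : ℕ, ∀ t : ℝ, |t| < n + 1 → n ≤ m → α n t = α m t := by
    intro n m t ht hnm
    have hnm' : (n : ℝ) ≤ m := by exact_mod_cast hnm
    refine ODE_solution_unique_of_mem_Ioo (v := fun _ => v) (s := fun _ => univ)
      (fun _ _ => hv.lipschitzOnWith (s := univ)) (t₀ := 0) (a := -(n + 1 : ℝ)) (b := n + 1)
      ⟨by linarith [n.cast_nonneg (α := ℝ)], by positivity⟩
      (fun s hs => ⟨hα n s hs, trivial⟩)
      (fun s hs => ⟨hα m s ⟨by linarith [hs.1], by linarith [hs.2]⟩, trivial⟩)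
      (by rw [h0, h0]) (abs_lt.1 ht)
  refine ⟨fun t => α ⌈|t|⌉₊ t, by simpa using h0 0, fun t => ?_⟩
  have hceil : ∀ s : ℝ, |s| < ⌈|s|⌉₊ + 1 := fun s => (Nat.le_ceil _).trans_lt (lt_add_one _)
  set N := ⌈|t| + 1⌉₊ with hN
  have hev : (fun s => α ⌈|s|⌉₊ s) =ᶠ[𝓝 t] α N := by
    have : ∀ᶠ s in 𝓝 t, |s| < |t| + 1 :=
      continuous_abs.continuousAt.eventually_lt continuousAt_const (by linarith)
    filter_upwards [this] with s hs
    exact agree _ _ s (hceil s) (Nat.ceil_mono hs.le)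
  have h1 : HasDerivAt (α N) (v (α N t)) t := by
    refine hα N t (abs_lt.1 ?_)
    have := Nat.le_ceil (|t| + 1)
    rw [← hN] at this
    linarith
  have h2 := h1.congr_of_eventuallyEq hev
  rwa [← hev.eq_of_nhds] at h2

/-- A nowhere vanishing `C¹` curve in `ℂ` has a continuously differentiable logarithm. -/
theorem exists_log_lift {u u' : ℝ → ℂ} (hu : ∀ t, HasDerivAt u (u' t) t) (hc : Continuous u')
    (h0 : ∀ t, u t ≠ 0) :
    ∃ l : ℝ → ℂ, (∀ t, HasDerivAt l (u' t / u t) t) ∧ ∀ t, Complex.exp (l t) = u t := by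
  have hcu : Continuous u := continuous_iff_continuousAt.2 fun t => (hu t).continuousAt
  have hq : Continuous fun t => u' t / u t := hc.div hcu h0
  have hl : ∀ t, HasDerivAt (fun t => Complex.log (u 0) + ∫ s in (0 : ℝ)..t, u' s / u s)
      (u' t / u t) t := fun t => (intervalIntegral.integral_hasDerivAt_right
        (hq.intervalIntegrable _ _) (hq.stronglyMeasurableAtFilter _ _) hq.continuousAt).const_add _
  refine ⟨_, hl, fun t => ?_⟩
  set l : ℝ → ℂ := fun t => Complex.log (u 0) + ∫ s in (0 : ℝ)..t, u' s / u s with hl_def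
  -- `u · exp (-l)` has derivative zero and equals `1` at time `0`
  have hd : ∀ t, HasDerivAt (fun t => u t * Complex.exp (-(l t))) 0 t := by
    intro t
    refine ((hu t).mul ((hl t).neg.cexp)).congr_deriv ?_
    have := h0 t
    have h3 : u t * (Complex.exp (-l t) * -(u' t / u t)) = -(u' t * Complex.exp (-l t)) := by
      field_simp
    exact (congrArg (u' t * Complex.exp (-l t) + ·) h3).trans (add_neg_cancel _)
  have hconst := is_const_of_deriv_eq_zero (fun t => (hd t).differentiableAt)
    (fun t => (hd t).deriv) t 0
  have h00 : u 0 * Complex.exp (-(l 0)) = 1 := by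
    simp only [hl_def, intervalIntegral.integral_same, add_zero, Complex.exp_neg,
      Complex.exp_log (h0 0)]
    exact mul_inv_cancel₀ (h0 0)
  rw [h00, Complex.exp_neg] at hconst
  have := Complex.exp_ne_zero (l t)
  field_simp at hconst
  exact hconst.symm

/-- `θ` is a continuous determination of the argument of the curve `u` that increases at least at
rate `κ`. -/
structure IsAngle (κ : ℝ) (u : ℝ → ℂ) (θ : ℝ → ℝ) : Prop where
  cont : Continuous θ
  rate : ∀ s t, s ≤ t → κ * (t - s) ≤ θ t - θ s
  polar : ∀ t, u t = ‖u t‖ * Complex.exp (θ t * Complex.I)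

namespace IsAngle

variable {κ : ℝ} {u : ℝ → ℂ} {θ : ℝ → ℝ}

theorem strictMono (hθ : IsAngle κ u θ) (hκ : 0 < κ) : StrictMono θ := fun s t hst => by
  have := hθ.rate s t hst.le
  nlinarith [mul_pos hκ (sub_pos.2 hst)]

theorem surjective (hθ : IsAngle κ u θ) (hκ : 0 < κ) : Function.Surjective θ := by
  refine hθ.cont.surjective ?_ ?_
  · refine tendsto_atTop_mono' _ (f₁ := fun t => θ 0 + κ * t) ?_
      (tendsto_atTop_add_const_left _ _ (tendsto_id.const_mul_atTop hκ))
    filter_upwards [eventually_ge_atTop 0] with t ht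
    have := hθ.rate 0 t ht
    simp only [sub_zero] at this
    linarith
  · refine tendsto_atBot_mono' (f₂ := θ) (f₁ := fun t => θ 0 + κ * t) _ ?_
      (tendsto_atBot_add_const_left _ _ (tendsto_id.const_mul_atBot hκ))
    filter_upwards [eventually_le_atBot 0] with t ht
    have := hθ.rate t 0 ht
    linarith

theorem add_two_pi (hθ : IsAngle κ u θ) (n : ℤ) :
    IsAngle κ u (fun t => θ t + 2 * Real.pi * n) where
  cont := hθ.cont.add continuous_const
  rate s t hst := by linarith [hθ.rate s t hst]
  polar t := by
    rw [hθ.polar t]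
    have : ((θ t + 2 * Real.pi * n : ℝ) : ℂ) * Complex.I
        = θ t * Complex.I + n * (2 * Real.pi * Complex.I) := by push_cast; ring
    rw [this, Complex.exp_add, Complex.exp_int_mul_two_pi_mul_I, mul_one]
    simp [Complex.norm_exp_ofReal_mul_I]

theorem comp_add (hθ : IsAngle κ u θ) (s : ℝ) :
    IsAngle κ (fun t => u (t + s)) (fun t => θ (t + s)) where
  cont := hθ.cont.comp (continuous_add_const s)
  rate a b hab := by simpa using hθ.rate (a + s) (b + s) (by linarith)
  polar t := hθ.polar (t + s)

theorem re_eq (hθ : IsAngle κ u θ) (t : ℝ) : (u t).re = ‖u t‖ * Real.cos (θ t) := by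
  conv_lhs => rw [hθ.polar t]
  simp [Complex.exp_ofReal_mul_I_re]

theorem im_eq (hθ : IsAngle κ u θ) (t : ℝ) : (u t).im = ‖u t‖ * Real.sin (θ t) := by
  conv_lhs => rw [hθ.polar t]
  simp [Complex.exp_ofReal_mul_I_im]

end IsAngle

/-- Two continuous angle functions of the same point of the circle differ by a constant multiple
of `2π`. -/
theorem exists_int_of_exp_eq {α β : ℝ → ℝ} (hα : Continuous α) (hβ : Continuous β)
    (h : ∀ t, Complex.exp (α t * Complex.I) = Complex.exp (β t * Complex.I)) :
    ∃ n : ℤ, ∀ t, α t = β t + 2 * Real.pi * n := by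
  have h1 : ∀ t, ∃ n : ℤ, α t = β t + 2 * Real.pi * n := by
    intro t
    obtain ⟨n, hn⟩ := Complex.exp_eq_exp_iff_exists_int.1 (h t)
    refine ⟨n, ?_⟩
    have h2 := congrArg Complex.im hn
    simp at h2
    linarith
  choose n hn using h1
  have hcont : Continuous n := by
    rw [Int.isClosedEmbedding_coe_real.isInducing.continuous_iff]
    have : (Int.cast ∘ n : ℝ → ℝ) = fun t => (α t - β t) / (2 * Real.pi) := by
      ext t
      have := Real.pi_pos
      simp only [Function.comp_apply, hn t]
      field_simp
      ring
    rw [this]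
    fun_prop
  refine ⟨n 0, fun t => ?_⟩
  rw [hn t, PreconnectedSpace.constant inferInstance hcont (x := t) (y := 0)]

/-- The polar angle of a solution of `ẋ = y`, `ẏ = -F` with a restoring force, `κ x² ≤ x F`,
increases at a rate at least `κ`. -/
theorem exists_isAngle_of_restoring {κ : ℝ} (hκ1 : κ ≤ 1) {x y F : ℝ → ℝ}
    (hx : ∀ t, HasDerivAt x (y t) t) (hy : ∀ t, HasDerivAt y (-F t) t) (hF : Continuous F)
    (hr : ∀ t, κ * x t ^ 2 ≤ x t * F t) (h0 : ∀ t, (⟨y t, x t⟩ : ℂ) ≠ 0) :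
    ∃ θ : ℝ → ℝ, IsAngle κ (fun t => ⟨y t, x t⟩) θ := by
  have hyc : Continuous y := continuous_iff_continuousAt.2 fun t => (hy t).continuousAt
  have hu : ∀ t, HasDerivAt (fun t => (⟨y t, x t⟩ : ℂ)) (⟨-F t, y t⟩ : ℂ) t := by
    intro t
    have := ((hy t).ofReal_comp).add (((hx t).ofReal_comp).mul_const Complex.I)
    have e : (fun t => (⟨y t, x t⟩ : ℂ)) = (fun s => (y s : ℂ)) + fun s => x s * Complex.I :=
      funext fun s => Complex.mk_eq_add_mul_I _ _
    rw [e, Complex.mk_eq_add_mul_I]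
    exact this
  have hu'c : Continuous fun t => (⟨-F t, y t⟩ : ℂ) := by
    have : (fun t => (⟨-F t, y t⟩ : ℂ)) = fun t => ((-F t : ℝ) : ℂ) + (y t : ℝ) * Complex.I := by
      ext t; simp [Complex.mk_eq_add_mul_I]
    rw [this]
    fun_prop
  obtain ⟨l, hl, hexp⟩ := exists_log_lift hu hu'c h0
  have hθ : ∀ t, HasDerivAt (fun t => (l t).im) ((⟨-F t, y t⟩ / ⟨y t, x t⟩ : ℂ).im) t := fun t =>
    (Complex.imCLM.hasFDerivAt.comp_hasDerivAt t (hl t))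
  refine ⟨fun t => (l t).im, continuous_iff_continuousAt.2 fun t => (hθ t).continuousAt, ?_, ?_⟩
  · intro s t hst
    -- the angular velocity `(y² + x F) / (x² + y²)` is at least `κ`
    have hpos : ∀ t, κ ≤ (⟨-F t, y t⟩ / ⟨y t, x t⟩ : ℂ).im := by
      intro t
      have hn : 0 < y t * y t + x t * x t := by
        have := Complex.normSq_pos.2 (h0 t)
        simpa [Complex.normSq_mk] using this
      simp only [Complex.div_im, Complex.normSq_mk]
      rw [← sub_div, le_div_iff₀ hn]
      nlinarith [hr t, mul_nonneg (sub_nonneg.2 hκ1) (mul_self_nonneg (y t))]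
    have hm : Monotone fun t => (l t).im - κ * t := by
      refine monotone_of_deriv_nonneg (fun t => ?_) (fun t => ?_)
      · exact ((hθ t).sub ((hasDerivAt_id t).const_mul κ)).differentiableAt
      · have h1 : HasDerivAt (fun t => (l t).im - κ * t) _ t :=
          (hθ t).sub ((hasDerivAt_id t).const_mul κ)
        rw [h1.deriv]
        linarith [hpos t]
    have := hm hst
    simp only at this
    linarith
  · intro t
    conv_lhs => rw [← hexp t]
    rw [← hexp t, Complex.norm_exp, Complex.ofReal_exp, ← Complex.exp_add, Complex.re_add_im]

/-! ### The three-sphere as a join of two circles -/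

theorem mem_threeSphere_iff (x : EuclideanSpace ℂ (Fin 2)) :
    x ∈ ThreeSphere ↔ ‖x 0‖ ^ 2 + ‖x 1‖ ^ 2 = 1 := by
  rw [mem_sphere_zero_iff_norm, EuclideanSpace.norm_eq, Real.sqrt_eq_one, Fin.sum_univ_two]

/-- The point of `𝕊³` with second coordinate `w` whose first coordinate points in the direction
of `u`. For `u = 0` this is a point of `𝕊³` only if `‖w‖ = 1`. -/
noncomputable def joinPoint (u w : ℂ) : EuclideanSpace ℂ (Fin 2) :=
  !₂[(√(1 - ‖w‖ ^ 2) : ℂ) * (u / ‖u‖), w]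

@[simp] theorem joinPoint_zero (u w : ℂ) :
    joinPoint u w 0 = (√(1 - ‖w‖ ^ 2) : ℂ) * (u / ‖u‖) := rfl

@[simp] theorem joinPoint_one (u w : ℂ) : joinPoint u w 1 = w := rfl

theorem joinPoint_mem {u w : ℂ} (hw : ‖w‖ ≤ 1) (hu : u = 0 → ‖w‖ = 1) :
    joinPoint u w ∈ ThreeSphere := by
  have h1 : 0 ≤ 1 - ‖w‖ ^ 2 := by nlinarith [norm_nonneg w]
  rw [mem_threeSphere_iff, joinPoint_zero, joinPoint_one, norm_mul, mul_pow, Complex.norm_real,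
    Real.norm_eq_abs, sq_abs, Real.sq_sqrt h1]
  by_cases h : u = 0
  · simp [h, hu h]
  · have : ‖u‖ ≠ 0 := norm_ne_zero_iff.2 h
    simp [this]

theorem joinPoint_zero_eq_zero_iff {u w : ℂ} (hw : ‖w‖ ≤ 1) (hu : u = 0 → ‖w‖ = 1) :
    joinPoint u w 0 = 0 ↔ ‖w‖ = 1 := by
  have := (mem_threeSphere_iff _).1 (joinPoint_mem hw hu)
  rw [joinPoint_one] at this
  constructor
  · intro h
    rw [h, norm_zero] at this
    nlinarith [norm_nonneg w]
  · intro h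
    simp [h]

theorem joinPoint_direction {u w : ℂ} (hw : ‖w‖ < 1) (hu : u ≠ 0) :
    joinPoint u w 0 / ‖joinPoint u w 0‖ = u / ‖u‖ := by
  have h1 : 0 < √(1 - ‖w‖ ^ 2) := Real.sqrt_pos.2 (by nlinarith [norm_nonneg w])
  have h2 : (‖u‖ : ℂ) ≠ 0 := by simpa using hu
  have h3 : (√(1 - ‖w‖ ^ 2) : ℂ) ≠ 0 := by exact_mod_cast h1.ne'
  have h4 : ‖joinPoint u w 0‖ = √(1 - ‖w‖ ^ 2) := by
    rw [joinPoint_zero, norm_mul, Complex.norm_real, Real.norm_of_nonneg h1.le]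
    have : ‖u‖ ≠ 0 := norm_ne_zero_iff.2 hu
    simp [this]
  rw [h4, joinPoint_zero]
  field_simp

/-- Where the direction `u` is undefined, the first coordinate tends to zero, so that the join
coordinates are continuous there as well. -/
theorem continuous_joinPoint {X : Type*} [TopologicalSpace X] {u w : X → ℂ} (hu : Continuous u)
    (hw : Continuous w) (h : ∀ x, u x = 0 → ‖w x‖ = 1) :
    Continuous fun x => joinPoint (u x) (w x) := by
  have hs : Continuous fun x => (√(1 - ‖w x‖ ^ 2) : ℂ) := by fun_prop
  have h0 : Continuous fun x => (√(1 - ‖w x‖ ^ 2) : ℂ) * (u x / ‖u x‖) := by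
    rw [continuous_iff_continuousAt]
    intro x
    by_cases hx : u x = 0
    · have h2 : (√(1 - ‖w x‖ ^ 2) : ℂ) = 0 := by simp [h x hx]
      rw [ContinuousAt, h2, zero_mul]
      refine squeeze_zero_norm (fun y => ?_) (a := fun y => ‖(√(1 - ‖w y‖ ^ 2) : ℂ)‖) ?_
      · rw [norm_mul]
        refine mul_le_of_le_one_right (norm_nonneg _) ?_
        rw [norm_div, Complex.norm_real, norm_norm]
        exact div_self_le_one _
      · have := hs.norm.tendsto x
        rwa [h2, norm_zero] at this
    · refine hs.continuousAt.mul (hu.continuousAt.div ?_ ?_)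
      · exact (Complex.continuous_ofReal.comp hu.norm).continuousAt
      · simpa using hx
  refine (PiLp.continuous_toLp 2 _).comp (continuous_pi fun i => ?_)
  fin_cases i
  · exact h0
  · exact hw

theorem joinPoint_self {x : EuclideanSpace ℂ (Fin 2)} (hx : x ∈ ThreeSphere) :
    joinPoint (x 0) (x 1) = x := by
  rw [mem_threeSphere_iff] at hx
  have h1 : √(1 - ‖x 1‖ ^ 2) = ‖x 0‖ := by
    rw [← hx, add_sub_cancel_right, Real.sqrt_sq (norm_nonneg _)]
  ext i
  fin_cases i
  · change joinPoint (x 0) (x 1) 0 = x 0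
    rw [joinPoint_zero, h1]
    by_cases h : x 0 = 0
    · simp [h]
    · have : (‖x 0‖ : ℂ) ≠ 0 := by simpa using h
      field_simp
  · rfl

theorem norm_div_norm_of_ne_zero {z : ℂ} (hz : z ≠ 0) : ‖z / ‖z‖‖ = 1 := by
  have : ‖z‖ ≠ 0 := norm_ne_zero_iff.2 hz
  simp [this]

theorem joinPoint_congr {u u' w : ℂ} (h : u / ‖u‖ = u' / ‖u'‖) :
    joinPoint u w = joinPoint u' w := by
  unfold joinPoint
  rw [h]

/-- For `‖a‖ < 1` the map `w ↦ w + (1 - ‖w‖) a` is a bijection of the closed unit disc that fixes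
the boundary circle and carries the centre to `a`; it maps the open disc into itself. -/
theorem norm_add_one_sub_norm_mul_lt {a w : ℂ} (ha : ‖a‖ < 1) (hw : ‖w‖ < 1) :
    ‖w + (1 - ‖w‖) * a‖ < 1 := by
  have h1 : ‖((1 - ‖w‖ : ℝ) : ℂ) * a‖ < 1 - ‖w‖ := by
    rw [norm_mul, Complex.norm_real, Real.norm_of_nonneg (by linarith)]
    nlinarith
  have := norm_add_le w (((1 - ‖w‖ : ℝ) : ℂ) * a)
  push_cast at this h1
  linarith

theorem add_one_sub_norm_mul_injective {a w w' : ℂ} (ha : ‖a‖ < 1)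
    (h : w + (1 - ‖w‖) * a = w' + (1 - ‖w'‖) * a) : w = w' := by
  have h1 : w - w' = ((‖w‖ - ‖w'‖ : ℝ) : ℂ) * a := by
    push_cast
    linear_combination h
  have h2 : ‖w - w'‖ ≤ ‖w - w'‖ * ‖a‖ := by
    conv_lhs => rw [h1, norm_mul, Complex.norm_real]
    exact mul_le_mul_of_nonneg_right (abs_norm_sub_norm_le _ _) (norm_nonneg _)
  have h3 : ‖w - w'‖ = 0 := by nlinarith [norm_nonneg (w - w')]
  exact sub_eq_zero.1 (norm_eq_zero.1 h3)

theorem exists_add_one_sub_norm_mul_eq {a u : ℂ} (hu : ‖u‖ ≤ 1) :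
    ∃ w : ℂ, ‖w‖ ≤ 1 ∧ w + (1 - ‖w‖) * a = u := by
  -- `w = u - t a`, where `t ∈ [0, 1]` solves `t = 1 - ‖u - t a‖`
  have hcont : ContinuousOn (fun t : ℝ => t - 1 + ‖u - t * a‖) (Icc 0 1) := by fun_prop
  have := intermediate_value_Icc zero_le_one hcont
  obtain ⟨t, ht, h⟩ := this (show (0 : ℝ) ∈ _ by
    constructor
    · simpa using hu
    · simp)
  simp only at h
  have hn : ‖u - t * a‖ = 1 - t := by linarith
  refine ⟨u - t * a, by rw [hn]; linarith [ht.1], ?_⟩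
  rw [hn]
  push_cast
  ring

/-- A closed curve in `𝕊³ ∖ {w₁ = 0}` that is a graph over the circle of directions of `w₁` can be
straightened to the circle `{w₂ = 0}` by a homeomorphism of `𝕊³` that preserves `{w₁ = 0}`. -/
theorem exists_homeomorph_straightening {a : ℂ → ℂ} (hc : ContinuousOn a (Metric.sphere 0 1))
    (ha : ∀ σ ∈ Metric.sphere (0 : ℂ) 1, ‖a σ‖ < 1) :
    ∃ Ψ : ThreeSphere ≃ₜ ThreeSphere, ∀ m : ThreeSphere,
      ((Ψ m : EuclideanSpace ℂ (Fin 2)) 0 = 0 ↔ (m : EuclideanSpace ℂ (Fin 2)) 0 = 0) ∧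
      ((m : EuclideanSpace ℂ (Fin 2)) 0 ≠ 0 → ((m : EuclideanSpace ℂ (Fin 2)) 1 = 0 ↔
        (Ψ m : EuclideanSpace ℂ (Fin 2)) 1 = a ((Ψ m : EuclideanSpace ℂ (Fin 2)) 0 /
          ‖(Ψ m : EuclideanSpace ℂ (Fin 2)) 0‖))) := by
  set m0 : ThreeSphere → ℂ := fun m => (m : EuclideanSpace ℂ (Fin 2)) 0 with hm0
  set m1 : ThreeSphere → ℂ := fun m => (m : EuclideanSpace ℂ (Fin 2)) 1 with hm1
  have hm0c : Continuous m0 := (PiLp.continuous_apply 2 _ 0).comp continuous_subtype_val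
  have hm1c : Continuous m1 := (PiLp.continuous_apply 2 _ 1).comp continuous_subtype_val
  have hsum : ∀ m, ‖m0 m‖ ^ 2 + ‖m1 m‖ ^ 2 = 1 := fun m => (mem_threeSphere_iff _).1 m.2
  have hm1le : ∀ m, ‖m1 m‖ ≤ 1 := fun m => by nlinarith [hsum m, norm_nonneg (m1 m)]
  have hm1lt : ∀ m, m0 m ≠ 0 → ‖m1 m‖ < 1 := fun m h => by
    have := pow_pos (norm_pos_iff.2 h) 2
    nlinarith [hsum m, norm_nonneg (m1 m)]
  have hm1eq : ∀ m, m0 m = 0 → ‖m1 m‖ = 1 := fun m h => by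
    have := hsum m
    rw [h, norm_zero] at this
    nlinarith [norm_nonneg (m1 m)]
  have hσ : ∀ {z : ℂ}, z ≠ 0 → z / ‖z‖ ∈ Metric.sphere (0 : ℂ) 1 := fun hz =>
    mem_sphere_zero_iff_norm.2 (norm_div_norm_of_ne_zero hz)
  -- the new second coordinate; at `m0 m = 0` the direction is the junk value `0 / 0 = 0`, but there
  -- the factor `1 - ‖m1 m‖` vanishes
  set w : ThreeSphere → ℂ := fun m => m1 m + (1 - ‖m1 m‖) * a (m0 m / ‖m0 m‖) with hw
  have hw0 : ∀ m, m0 m = 0 → w m = m1 m := fun m h => by simp [hw, hm1eq m h]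
  have hwlt : ∀ m, m0 m ≠ 0 → ‖w m‖ < 1 := fun m h =>
    norm_add_one_sub_norm_mul_lt (ha _ (hσ h)) (hm1lt m h)
  have hweq : ∀ m, m0 m = 0 → ‖w m‖ = 1 := fun m h => by rw [hw0 m h, hm1eq m h]
  have hwle : ∀ m, ‖w m‖ ≤ 1 := fun m => by
    by_cases h : m0 m = 0
    · exact (hweq m h).le
    · exact (hwlt m h).le
  have hwc : Continuous w := by
    refine hm1c.add ?_
    rw [continuous_iff_continuousAt]
    intro m
    have h1c : Continuous fun m => ((1 : ℂ) - ‖m1 m‖) := by fun_prop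
    by_cases h : m0 m = 0
    · have h2 : ((1 : ℂ) - ‖m1 m‖) = 0 := by simp [hm1eq m h]
      rw [ContinuousAt, h2, zero_mul]
      refine squeeze_zero_norm (fun y => ?_) (a := fun y => ‖((1 : ℂ) - ‖m1 y‖)‖) ?_
      · rw [norm_mul]
        by_cases hy : m0 y = 0
        · simp [hm1eq y hy]
        · exact mul_le_of_le_one_right (norm_nonneg _) (ha _ (hσ hy)).le
      · have := h1c.norm.tendsto m
        rwa [h2, norm_zero] at this
    · refine h1c.continuousAt.mul ?_
      have hd : ContinuousOn (fun m => m0 m / ‖m0 m‖) {m | m0 m ≠ 0} :=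
        hm0c.continuousOn.div (by fun_prop) fun m hm => by simpa using hm
      exact (hc.comp hd fun m hm => hσ hm).continuousAt
        ((isOpen_ne.preimage hm0c).mem_nhds h)
  have hmem : ∀ m, joinPoint (m0 m) (w m) ∈ ThreeSphere := fun m =>
    joinPoint_mem (hwle m) (hweq m)
  set Ψ : ThreeSphere → ThreeSphere := fun m => ⟨joinPoint (m0 m) (w m), hmem m⟩ with hΨ
  have hΨc : Continuous Ψ := (continuous_joinPoint hm0c hwc hweq).subtype_mk _
  have hzero : ∀ m, m0 (Ψ m) = 0 ↔ m0 m = 0 := by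
    intro m
    change joinPoint (m0 m) (w m) 0 = 0 ↔ _
    rw [joinPoint_zero_eq_zero_iff (hwle m) (hweq m)]
    exact ⟨fun h => by_contra fun h' => (hwlt m h').ne h, hweq m⟩
  have hdir : ∀ m, m0 m ≠ 0 → m0 (Ψ m) / ‖m0 (Ψ m)‖ = m0 m / ‖m0 m‖ := fun m h =>
    joinPoint_direction (hwlt m h) h
  have hm1Ψ : ∀ m, m1 (Ψ m) = w m := fun m => rfl
  have hinj : Function.Injective Ψ := by
    intro m m' h
    have e1 : w m = w m' := by rw [← hm1Ψ, ← hm1Ψ, h]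
    by_cases h0 : m0 m = 0
    · have h0' : m0 m' = 0 := by rwa [← hzero, ← h, hzero]
      have : m1 m = m1 m' := by rw [← hw0 m h0, ← hw0 m' h0', e1]
      apply Subtype.ext
      rw [← joinPoint_self m.2, ← joinPoint_self m'.2]
      change joinPoint (m0 m) (m1 m) = joinPoint (m0 m') (m1 m')
      rw [h0, h0', this]
    · have h0' : m0 m' ≠ 0 := by rwa [Ne, ← hzero, ← h, hzero]
      have hd : m0 m / ‖m0 m‖ = m0 m' / ‖m0 m'‖ := by rw [← hdir m h0, ← hdir m' h0', h]
      have : m1 m = m1 m' := by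
        simp only [hw, hd] at e1
        exact add_one_sub_norm_mul_injective (ha _ (hσ h0')) e1
      apply Subtype.ext
      rw [← joinPoint_self m.2, ← joinPoint_self m'.2]
      change joinPoint (m0 m) (m1 m) = joinPoint (m0 m') (m1 m')
      rw [this]
      exact joinPoint_congr hd
  have hsurj : Function.Surjective Ψ := by
    intro y
    by_cases h0 : m0 y = 0
    · refine ⟨y, Subtype.ext ?_⟩
      change joinPoint (m0 y) (w y) = y
      rw [hw0 y h0]
      exact joinPoint_self y.2
    · obtain ⟨v, hv, hvu⟩ := exists_add_one_sub_norm_mul_eq (a := a (m0 y / ‖m0 y‖)) (hm1le y)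
      have hv1 : ‖v‖ < 1 := by
        refine lt_of_le_of_ne hv fun h => (hm1lt y h0).ne ?_
        rw [← hvu, h]
        simp [h]
      refine ⟨⟨joinPoint (m0 y) v, joinPoint_mem hv fun h => absurd h h0⟩, Subtype.ext ?_⟩
      have hd := joinPoint_direction hv1 h0
      change joinPoint (joinPoint (m0 y) v 0)
        (v + (1 - ‖v‖) * a (joinPoint (m0 y) v 0 / ‖joinPoint (m0 y) v 0‖)) = y
      rw [hd, hvu, joinPoint_congr hd]
      exact joinPoint_self y.2
  have : CompactSpace ThreeSphere := isCompact_iff_compactSpace.1 (isCompact_sphere _ _)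
  have hhomeo : IsHomeomorph Ψ := isHomeomorph_iff_continuous_bijective.2 ⟨hΨc, hinj, hsurj⟩
  refine ⟨hhomeo.homeomorph Ψ, fun m => ⟨hzero m, fun h0 => ?_⟩⟩
  change m1 m = 0 ↔ w m = a (m0 (Ψ m) / ‖m0 (Ψ m)‖)
  rw [hdir m h0]
  constructor
  · intro h
    simp [hw, h]
  · intro h
    refine add_one_sub_norm_mul_injective (ha _ (hσ h0)) (w' := 0) ?_
    simpa using h

/-- A closed curve in the complement of the circle `{w₁ = 0}` that is a graph over the circle of
directions of `w₁` forms a Hopf link with it. -/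
theorem isHopfLink_of_graph {M A B : Set Phase} (hA : A ⊆ M) (hB : B ⊆ M)
    (Φ : M ≃ₜ ThreeSphere) {a : ℂ → ℂ} (hc : ContinuousOn a (Metric.sphere 0 1))
    (ha : ∀ σ ∈ Metric.sphere (0 : ℂ) 1, ‖a σ‖ < 1)
    (hΦA : ∀ x : M, (x : Phase) ∈ A ↔ (Φ x : EuclideanSpace ℂ (Fin 2)) 0 ≠ 0 ∧
      (Φ x : EuclideanSpace ℂ (Fin 2)) 1 = a ((Φ x : EuclideanSpace ℂ (Fin 2)) 0 /
          ‖(Φ x : EuclideanSpace ℂ (Fin 2)) 0‖))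
    (hΦB : ∀ x : M, (x : Phase) ∈ B ↔ (Φ x : EuclideanSpace ℂ (Fin 2)) 0 = 0) :
    IsHopfLink M A B := by
  obtain ⟨Ψ, hΨ⟩ := exists_homeomorph_straightening hc ha
  refine ⟨hA, hB, Φ.trans Ψ.symm, fun x => ?_, fun x => ?_⟩
  · obtain ⟨h1, h2⟩ := hΨ (Ψ.symm (Φ x))
    rw [Ψ.apply_symm_apply] at h1 h2
    rw [hΦA, Homeomorph.trans_apply]
    constructor
    · rintro ⟨h3, h4⟩
      exact (h2 fun h => h3 (h1.2 h)).2 h4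
    · intro h3
      have h4 : ((Ψ.symm (Φ x)) : EuclideanSpace ℂ (Fin 2)) 0 ≠ 0 := fun h4 => by
        have := (mem_threeSphere_iff _).1 (Ψ.symm (Φ x)).2
        rw [h3, h4] at this
        simp at this
      exact ⟨fun h => h4 (h1.1 h), (h2 h4).1 h3⟩
  · obtain ⟨h1, -⟩ := hΨ (Ψ.symm (Φ x))
    rw [Ψ.apply_symm_apply] at h1
    rw [hΦB, Homeomorph.trans_apply, h1]

/-! ### Linking with a coordinate circle determines the winding number -/

open unitInterval in
/-- Let `v` be a nonvanishing function on `𝕊³ ∖ {w₁ = 0}` which winds once along some loop. If the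
restriction of `v` to the core circle `{w₂ = 0}` has a continuous `k`-th root, then so has `v`, as
the complement of `{w₁ = 0}` retracts onto the core; evaluating on the loop gives `k = 1`. -/
theorem eq_one_of_pow_eq_on_core {X : Type*} [TopologicalSpace X] (Φ : X ≃ₜ ThreeSphere)
    {v g : X → ℂ} {k : ℕ} (hk : 0 < k) {γ : ℝ → X}
    (hv : ContinuousOn v {x | (Φ x : EuclideanSpace ℂ (Fin 2)) 0 ≠ 0})
    (hv0 : ∀ x, (Φ x : EuclideanSpace ℂ (Fin 2)) 0 ≠ 0 → v x ≠ 0)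
    (hg : ContinuousOn g {x | (Φ x : EuclideanSpace ℂ (Fin 2)) 1 = 0})
    (hgv : ∀ x, (Φ x : EuclideanSpace ℂ (Fin 2)) 1 = 0 → g x ^ k = v x)
    (hγ : Continuous γ) (hγ0 : ∀ φ, (Φ (γ φ) : EuclideanSpace ℂ (Fin 2)) 0 ≠ 0)
    (hγv : ∀ φ : ℝ, v (γ φ) = Complex.exp (φ * Complex.I))
    (hγp : γ (2 * Real.pi) = γ 0) : k = 1 := by
  set X₀ : Type _ := {x : X // (Φ x : EuclideanSpace ℂ (Fin 2)) 0 ≠ 0} with hX₀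
  -- the deformation `(w₁, s w₂)`, normalised, of the complement of `{w₁ = 0}` onto the core
  have hlt : ∀ p : I × X₀, ‖((p.1 : ℝ) : ℂ) * (Φ p.2.1 : EuclideanSpace ℂ (Fin 2)) 1‖ < 1 := by
    intro p
    have h1 := (mem_threeSphere_iff _).1 (Φ p.2.1).2
    have h2 := pow_pos (norm_pos_iff.2 p.2.2) 2
    have h3 : ‖(Φ p.2.1 : EuclideanSpace ℂ (Fin 2)) 1‖ < 1 := by
      nlinarith [norm_nonneg ((Φ p.2.1 : EuclideanSpace ℂ (Fin 2)) 1)]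
    rw [norm_mul, Complex.norm_real, Real.norm_of_nonneg p.1.2.1]
    exact (mul_le_of_le_one_left (norm_nonneg _) p.1.2.2).trans_lt h3
  set j : I × X₀ → X := fun p => Φ.symm
    ⟨joinPoint ((Φ p.2.1 : EuclideanSpace ℂ (Fin 2)) 0)
      (((p.1 : ℝ) : ℂ) * (Φ p.2.1 : EuclideanSpace ℂ (Fin 2)) 1),
      joinPoint_mem (hlt p).le fun h => absurd h p.2.2⟩ with hj
  have hjc : Continuous j := by
    refine Φ.symm.continuous.comp (Continuous.subtype_mk ?_ _)
    have hΦc : Continuous fun p : I × X₀ => (Φ p.2.1 : EuclideanSpace ℂ (Fin 2)) :=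
      continuous_subtype_val.comp (Φ.continuous.comp (continuous_subtype_val.comp continuous_snd))
    refine continuous_joinPoint ((PiLp.continuous_apply 2 _ 0).comp hΦc) (Continuous.mul ?_
      ((PiLp.continuous_apply 2 _ 1).comp hΦc)) fun p h => absurd h p.2.2
    exact Complex.continuous_ofReal.comp (continuous_subtype_val.comp continuous_fst)
  have hj0 : ∀ p, (Φ (j p) : EuclideanSpace ℂ (Fin 2)) 0 ≠ 0 := by
    intro p
    simp only [hj, Homeomorph.apply_symm_apply]
    rw [Ne, joinPoint_zero_eq_zero_iff (hlt p).le fun h => absurd h p.2.2]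
    exact (hlt p).ne
  have hj1 : ∀ x : X₀, (Φ (j (0, x)) : EuclideanSpace ℂ (Fin 2)) 1 = 0 := by
    intro x
    simp only [hj, Homeomorph.apply_symm_apply]
    simp
  have hjid : ∀ x : X₀, j (1, x) = x := by
    intro x
    simp only [hj]
    rw [Homeomorph.symm_apply_eq]
    apply Subtype.ext
    simp only [Set.Icc.coe_one, Complex.ofReal_one, one_mul]
    exact joinPoint_self (Φ x.1).2
  have cov := isCoveringMap_npow (𝕜 := ℂ) k (by exact_mod_cast hk.ne')
  -- lift `v ∘ j` through `z ↦ z ^ k`, starting from the root `g` on the core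
  let H : C(I × X₀, {z : ℂ // z ≠ 0}) := ⟨fun p => ⟨v (j p), hv0 _ (hj0 p)⟩,
    (hv.comp_continuous hjc hj0).subtype_mk _⟩
  have hgne : ∀ x : X₀, g (j (0, x)) ≠ 0 := fun x h => by
    have := hgv _ (hj1 x)
    rw [h, zero_pow hk.ne'] at this
    exact hv0 _ (hj0 (0, x)) this.symm
  let G₀ : C(X₀, {z : ℂ // z ≠ 0}) := ⟨fun x => ⟨g (j (0, x)), hgne x⟩,
    (hg.comp_continuous (hjc.comp (by fun_prop)) hj1).subtype_mk _⟩
  have hHG : ∀ x, H (0, x) = ⟨(G₀ x : ℂ) ^ k, pow_ne_zero k (G₀ x).2⟩ := fun x =>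
    Subtype.ext (hgv _ (hj1 x)).symm
  let L := cov.liftHomotopy H G₀ hHG
  have hL : ∀ p, ((L p : {z : ℂ // z ≠ 0}) : ℂ) ^ k = v (j p) := fun p =>
    congrArg Subtype.val (congrFun (cov.liftHomotopy_lifts H G₀ hHG) p)
  -- the `k`-th root of `v` along the loop, divided by `exp (i φ / k)`, is a constant root of unity
  let q : ℝ → ℂ := fun φ => (L (1, ⟨γ φ, hγ0 φ⟩) : {z : ℂ // z ≠ 0}) *
    Complex.exp (-(φ / k * Complex.I))
  have hkC : (k : ℂ) ≠ 0 := by exact_mod_cast hk.ne'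
  have hqc : Continuous q := by
    refine Continuous.mul ?_ (by fun_prop)
    exact continuous_subtype_val.comp (L.continuous.comp
      (continuous_const.prodMk (hγ.subtype_mk _)))
  have hqk : ∀ φ, q φ ^ k = 1 := by
    intro φ
    simp only [q]
    rw [mul_pow, hL, hjid, hγv, ← Complex.exp_nat_mul, ← Complex.exp_add]
    have : (φ : ℂ) * Complex.I + k * -(φ / k * Complex.I) = 0 := by field_simp; ring
    rw [this, Complex.exp_zero]
  have hfin : {z : ℂ | z ^ k = 1}.Finite := by
    refine (Polynomial.nthRootsFinset k (1 : ℂ)).finite_toSet.subset fun z hz => ?_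
    simpa [Polynomial.mem_nthRootsFinset hk] using hz
  have hconst : q (2 * Real.pi) = q 0 := by
    have hsub : (range q).Subsingleton := by
      have hd : IsTotallyDisconnected {z : ℂ | z ^ k = 1} := hfin.countable.isTotallyDisconnected
      exact hd _ (range_subset_iff.2 hqk) (isPreconnected_range hqc)
    exact hsub (mem_range_self _) (mem_range_self _)
  simp only [q, hγp] at hconst
  have hLne : ((L (1, ⟨γ 0, hγ0 0⟩) : {z : ℂ // z ≠ 0}) : ℂ) ≠ 0 :=
    (L (1, ⟨γ 0, hγ0 0⟩) : {z : ℂ // z ≠ 0}).2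
  have hexp := mul_left_cancel₀ hLne hconst
  rw [Complex.ofReal_zero, zero_div, zero_mul, Complex.exp_eq_exp_iff_exists_int] at hexp
  obtain ⟨n, hn⟩ := hexp
  have h2 := congrArg Complex.im hn
  have hpi := Real.pi_pos
  have hkR : (k : ℝ) ≠ 0 := by exact_mod_cast hk.ne'
  have h3 : (2 * Real.pi / k : ℝ) = -(n * (2 * Real.pi)) := by
    have e : (((2 * Real.pi : ℝ) : ℂ) / (k : ℂ)) = ((2 * Real.pi / k : ℝ) : ℂ) := by push_cast; rfl
    rw [e] at h2
    simp at h2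
    linarith
  have h4 : (1 : ℝ) = -n * k := by
    field_simp at h3
    nlinarith
  have h5 : (1 : ℤ) = -n * k := by exact_mod_cast h4
  have h6 : (k : ℤ) ∣ 1 := ⟨-n, by rw [h5]; ring⟩
  have h7 : k ∣ 1 := by exact_mod_cast h6
  exact Nat.dvd_one.1 h7

/-- A function on the parameter line of a closed curve that only depends on the point of the curve
is a continuous function on the curve. -/
theorem exists_continuousOn_range {X : Type*} [TopologicalSpace X] [T2Space X] {η : ℝ → X}
    (hη : Continuous η) {T : ℝ} (hT0 : 0 < T) (hT : Function.Periodic η T) {F : ℝ → ℂ}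
    (hF : Continuous F) (hwell : ∀ s t, η s = η t → F s = F t) :
    ∃ g : X → ℂ, ContinuousOn g (range η) ∧ ∀ t, g (η t) = F t := by
  classical
  let g : X → ℂ := fun x => if h : ∃ t, η t = x then F h.choose else 0
  have hgη : ∀ t, g (η t) = F t := by
    intro t
    have h : ∃ s, η s = η t := ⟨t, rfl⟩
    simp only [g, dif_pos h]
    exact hwell _ _ h.choose_spec
  refine ⟨g, ?_, hgη⟩
  rw [continuousOn_iff_continuous_domRestrict]
  let e : Icc (0 : ℝ) T → range η := fun t => ⟨η t, mem_range_self _⟩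
  have hec : Continuous e := (hη.comp continuous_subtype_val).subtype_mk _
  have hes : Function.Surjective e := by
    rintro ⟨_, t, rfl⟩
    obtain ⟨s, hs, hst⟩ := hT.exists_mem_Ico₀ hT0 t
    exact ⟨⟨s, Ico_subset_Icc_self hs⟩, Subtype.ext hst.symm⟩
  have hq : IsQuotientMap e := hec.isClosedMap.isQuotientMap hec hes
  rw [hq.continuous_iff]
  have : (range η).domRestrict g ∘ e = fun t : Icc (0 : ℝ) T => F t := by
    ext t
    exact hgη t
  rw [this]
  exact hF.comp continuous_subtype_val

/-- If a periodic curve `η` forms the core circle of a Hopf link and `v` winds once along some loop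
in the complement of the other circle, then `v ∘ η` winds exactly once during a suitable period. -/
theorem exists_period_winding_one {X : Type*} [TopologicalSpace X] [T2Space X]
    (Φ : X ≃ₜ ThreeSphere) {v : X → ℂ} {γ η : ℝ → X} {θ : ℝ → ℝ}
    (hv : ContinuousOn v {x | (Φ x : EuclideanSpace ℂ (Fin 2)) 0 ≠ 0})
    (hv0 : ∀ x, (Φ x : EuclideanSpace ℂ (Fin 2)) 0 ≠ 0 → v x ≠ 0)
    (hγ : Continuous γ) (hγ0 : ∀ φ, (Φ (γ φ) : EuclideanSpace ℂ (Fin 2)) 0 ≠ 0)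
    (hγv : ∀ φ : ℝ, v (γ φ) = Complex.exp (φ * Complex.I)) (hγp : γ (2 * Real.pi) = γ 0)
    (hη : Continuous η) (hηΦ : ∀ x, x ∈ range η ↔ (Φ x : EuclideanSpace ℂ (Fin 2)) 1 = 0)
    (hper : ∃ T > 0, Function.Periodic η T)
    (hdet : ∀ s t, η s = η t → ∀ a, η (a + s) = η (a + t))
    (hθ : Continuous θ) (hmono : StrictMono θ)
    (hθv : ∀ t, v (η t) = Complex.exp (θ t * Complex.I)) :
    ∃ T > 0, ∀ t, η (t + T) = η t ∧ θ (t + T) = θ t + 2 * Real.pi := by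
  have hpi := Real.pi_pos
  -- every period has a winding number, which has the same sign as the period
  have hshift : ∀ T, Function.Periodic η T → ∃ n : ℤ, ∀ t, θ (t + T) = θ t + 2 * Real.pi * n := by
    intro T hT
    refine exists_int_of_exp_eq (hθ.comp (continuous_add_const T)) hθ fun t => ?_
    rw [← hθv, ← hθv, hT t]
  have hpos : ∀ T : ℝ, ∀ n : ℤ, (∀ t, θ (t + T) = θ t + 2 * Real.pi * n) → (0 < T ↔ 0 < n) := by
    intro T n h
    have h1 : 0 < T ↔ θ 0 < θ (0 + T) := by rw [hmono.lt_iff_lt]; simp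
    rw [h1, h 0]
    constructor
    · intro h2
      have : 0 < 2 * Real.pi * n := by linarith
      have := pos_of_mul_pos_right this (by positivity)
      exact_mod_cast this
    · intro h2
      have : (0 : ℝ) < n := by exact_mod_cast h2
      nlinarith [mul_pos hpi this]
  have hex : ∃ k : ℕ, 0 < k ∧ ∃ T, Function.Periodic η T ∧
      ∀ t, θ (t + T) = θ t + 2 * Real.pi * k := by
    obtain ⟨T, hT0, hT⟩ := hper
    obtain ⟨n, hn⟩ := hshift T hT
    have hn0 := (hpos T n hn).1 hT0
    lift n to ℕ using hn0.le
    exact ⟨n, by exact_mod_cast hn0, T, hT, by simpa using hn⟩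
  classical
  -- `k` is the least positive winding number of a period
  obtain ⟨hk0, T, hT, hθT⟩ := Nat.find_spec hex
  have hmin := fun m (hm : m < Nat.find hex) => Nat.find_min hex hm
  set k := Nat.find hex with hk
  have hTpos : 0 < T := (hpos T k (by simpa using hθT)).2 (by exact_mod_cast hk0)
  have hTn : ∀ (n : ℤ) t, θ (t + n * T) = θ t + 2 * Real.pi * (n * k) := by
    intro n t
    induction n using Int.induction_on with
    | zero => simp
    | succ n ih =>
      have := hθT (t + n * T)
      push_cast at ih ⊢
      rw [show t + (n + 1) * T = t + n * T + T by ring, this, ih]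
      ring
    | pred n ih =>
      have := hθT (t + (-(n : ℝ) - 1) * T)
      push_cast at ih ⊢
      rw [show t + (-(n : ℝ) - 1) * T + T = t + -n * T by ring, ih] at this
      linarith
  -- by minimality, the winding number of any other period is a multiple of `k`
  have hdvd : ∀ d, Function.Periodic η d → ∃ q : ℤ,
      ∀ t, θ (t + d) = θ t + 2 * Real.pi * (q * k) := by
    intro d hd
    obtain ⟨n, hn⟩ := hshift d hd
    have hk0' : (0 : ℤ) < k := by exact_mod_cast hk0
    refine ⟨n / k, ?_⟩
    have hr0 := Int.emod_nonneg n hk0'.ne'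
    have hrk := Int.emod_lt_of_pos n hk0'
    have hdiv := Int.emod_add_mul_ediv n k
    set r := n % k
    set q := n / (k : ℤ)
    have hper' : Function.Periodic η (d - q * T) := by
      have := hd.sub_period (hT.int_mul q)
      simpa using this
    have hr : ∀ t, θ (t + (d - q * T)) = θ t + 2 * Real.pi * r := by
      intro t
      have h1 := hTn (-q) (t + d)
      push_cast at h1
      rw [show t + (d - q * T) = t + d + -q * T by ring, h1, hn t, ← hdiv]
      push_cast
      ring
    have hrz : r = 0 := by
      by_contra hne
      have hrpos : 0 < r := lt_of_le_of_ne hr0 (Ne.symm hne)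
      obtain ⟨m, hm⟩ := Int.eq_ofNat_of_zero_le hr0
      rw [hm] at hrk hrpos hr
      exact hmin m (by exact_mod_cast hrk) ⟨by exact_mod_cast hrpos, _, hper', by simpa using hr⟩
    intro t
    rw [hn t, ← hdiv, hrz]
    push_cast
    ring
  have hkC : (k : ℂ) ≠ 0 := by exact_mod_cast hk0.ne'
  -- hence `exp (i θ / k)` is a well-defined function on the orbit
  have hwell : ∀ s t, η s = η t →
      Complex.exp (θ s / k * Complex.I) = Complex.exp (θ t / k * Complex.I) := by
    intro s t hst
    have hd : Function.Periodic η (s - t) := fun a => by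
      have := hdet s t hst (a - t)
      rw [show a - t + s = a + (s - t) by ring, show a - t + t = a by ring] at this
      exact this
    obtain ⟨q, hq⟩ := hdvd _ hd
    have h1 := hq t
    rw [show t + (s - t) = s by ring] at h1
    rw [Complex.exp_eq_exp_iff_exists_int]
    refine ⟨q, ?_⟩
    rw [h1]
    push_cast
    field_simp
  obtain ⟨g, hgc, hgη⟩ := exists_continuousOn_range hη hTpos hT
    (F := fun t => Complex.exp (θ t / k * Complex.I)) (by fun_prop) hwell
  have hset : {x | (Φ x : EuclideanSpace ℂ (Fin 2)) 1 = 0} = range η := by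
    ext x; exact (hηΦ x).symm
  have hk1 : k = 1 := by
    refine eq_one_of_pow_eq_on_core Φ hk0 hv hv0 (hset ▸ hgc) ?_ hγ hγ0 hγv hγp
    intro x hx
    obtain ⟨t, rfl⟩ := (hηΦ x).2 hx
    rw [hgη, hθv, ← Complex.exp_nat_mul]
    congr 1
    field_simp
  refine ⟨T, hTpos, fun t => ⟨hT t, ?_⟩⟩
  rw [hθT t, hk1]
  simp

/-! ### Potential wells and their energy surfaces -/

/-- The energy `(p_r² + p_z²)/2 + V(r, z)`. -/
noncomputable def wellEnergy (V : ℝ → ℝ → ℝ) (x : Phase) : ℝ :=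
  ((x 0) ^ 2 + (x 1) ^ 2) / 2 + V (x 2) (x 3)

/-- The window `[a, b] × [-c, c]` encloses a potential well of `V` at level `h`: `V > h` on the
boundary, `V` is even in `z` and has partial derivatives `Vr`, `Vz`, it is strictly increasing in
`|z|` and, on the axis `z = 0`, in `|r - rc|`, both at a quantitative rate `κ`, and `V(rc, 0) < h`.
-/
structure HillWell (V Vr Vz : ℝ → ℝ → ℝ) (h a b c rc κ : ℝ) : Prop where
  a_pos : 0 < a
  c_pos : 0 < c
  κ_pos : 0 < κ
  κ_le_one : κ ≤ 1
  rc_mem : rc ∈ Ioo a b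
  below : V rc 0 < h
  hasFDerivAt : ∀ r ∈ Icc a b, ∀ z ∈ Icc (-c) c, HasFDerivAt (fun p : ℝ × ℝ => V p.1 p.2)
    (Vr r z • ContinuousLinearMap.fst ℝ ℝ ℝ + Vz r z • ContinuousLinearMap.snd ℝ ℝ ℝ) (r, z)
  continuousOn_r : ContinuousOn (fun p : ℝ × ℝ => Vr p.1 p.2) (Icc a b ×ˢ Icc (-c) c)
  continuousOn_z : ContinuousOn (fun p : ℝ × ℝ => Vz p.1 p.2) (Icc a b ×ˢ Icc (-c) c)
  even : ∀ r ∈ Icc a b, ∀ z ∈ Icc (-c) c, V r (-z) = V r z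
  even_r : ∀ r ∈ Icc a b, ∀ z ∈ Icc (-c) c, Vr r (-z) = Vr r z
  odd_z : ∀ r ∈ Icc a b, ∀ z ∈ Icc (-c) c, Vz r (-z) = -Vz r z
  boundary : ∀ r ∈ Icc a b, ∀ z ∈ Icc (-c) c, (r = a ∨ r = b ∨ z = -c ∨ z = c) → h < V r z
  radial_le : ∀ r ∈ Icc a b, κ * (r - rc) ^ 2 ≤ (r - rc) * Vr r 0
  vertical_le : ∀ r ∈ Icc a b, ∀ z ∈ Icc (-c) c, κ * z ^ 2 ≤ z * Vz r z

/-- The part of the energy level over the window. -/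
def wellLevel (V : ℝ → ℝ → ℝ) (h a b c : ℝ) : Set Phase :=
  {x | x 2 ∈ Icc a b ∧ x 3 ∈ Icc (-c) c ∧ wellEnergy V x = h}

/-- The point `p_z + i z`, which vanishes on the plane `{p_z = z = 0}`. -/
def vertical (x : Phase) : ℂ := ⟨x 1, x 3⟩

theorem continuous_vertical : Continuous vertical := by
  have : vertical = fun x : Phase => ((x 1 : ℝ) : ℂ) + (x 3 : ℝ) * Complex.I :=
    funext fun x => Complex.mk_eq_add_mul_I _ _
  rw [this]
  fun_prop

theorem vertical_eq_zero_iff (x : Phase) : vertical x = 0 ↔ x 1 = 0 ∧ x 3 = 0 := by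
  simp [vertical, Complex.ext_iff]

/-- A coordinate on the interval `[a, b]` whose square is `(V(r, 0) - V(rc, 0)) / (h - V(rc, 0))`.
-/
noncomputable def radialCoord (V : ℝ → ℝ → ℝ) (h rc r : ℝ) : ℝ :=
  √((V (max r rc) 0 - V rc 0) / (h - V rc 0)) - √((V (min r rc) 0 - V rc 0) / (h - V rc 0))

/-- The normalised radial coordinates `(p_r, r)`: on the energy surface they range over the closed
unit disc, the boundary circle corresponding to the plane `{p_z = z = 0}`. -/
noncomputable def radialDisc (V : ℝ → ℝ → ℝ) (h rc : ℝ) (x : Phase) : ℂ :=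
  ⟨x 0 / √(2 * (h - V rc 0)), radialCoord V h rc (x 2)⟩

namespace HillWell

variable {V Vr Vz : ℝ → ℝ → ℝ} {h a b c rc κ : ℝ}

section
variable (W : HillWell V Vr Vz h a b c rc κ)
include W

theorem rc_mem_Icc : rc ∈ Icc a b := Ioo_subset_Icc_self W.rc_mem

theorem zero_mem : (0 : ℝ) ∈ Icc (-c) c := ⟨by linarith [W.c_pos], W.c_pos.le⟩

theorem depth_pos : 0 < h - V rc 0 := sub_pos.2 W.below

theorem hasDerivAt_z {r z : ℝ} (hr : r ∈ Icc a b) (hz : z ∈ Icc (-c) c) :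
    HasDerivAt (fun z => V r z) (Vz r z) z := by
  have h1 : HasDerivAt (fun z : ℝ => (r, z)) ((0 : ℝ), (1 : ℝ)) z :=
    (hasDerivAt_const z r).prodMk (hasDerivAt_id z)
  have := (W.hasFDerivAt r hr z hz).comp_hasDerivAt z h1
  simpa [Function.comp_def] using this

theorem hasDerivAt_r {r z : ℝ} (hr : r ∈ Icc a b) (hz : z ∈ Icc (-c) c) :
    HasDerivAt (fun r => V r z) (Vr r z) r := by
  have h1 : HasDerivAt (fun r : ℝ => (r, z)) ((1 : ℝ), (0 : ℝ)) r :=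
    (hasDerivAt_id r).prodMk (hasDerivAt_const r z)
  have := (W.hasFDerivAt r hr z hz).comp_hasDerivAt r h1
  simpa [Function.comp_def] using this

theorem continuousOn : ContinuousOn (fun p : ℝ × ℝ => V p.1 p.2) (Icc a b ×ˢ Icc (-c) c) :=
  fun p hp => (W.hasFDerivAt p.1 hp.1 p.2 hp.2).continuousAt.continuousWithinAt

theorem strictMonoOn_z {r : ℝ} (hr : r ∈ Icc a b) : StrictMonoOn (fun z => V r z) (Icc 0 c) := by
  have hz : ∀ z ∈ Icc 0 c, z ∈ Icc (-c) c := fun z hz => ⟨by linarith [hz.1, W.c_pos], hz.2⟩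
  refine strictMonoOn_of_deriv_pos (convex_Icc _ _)
    (fun z h1 => (W.hasDerivAt_z hr (hz z h1)).continuousAt.continuousWithinAt) fun z h1 => ?_
  rw [interior_Icc] at h1
  rw [(W.hasDerivAt_z hr (hz z (Ioo_subset_Icc_self h1))).deriv]
  have h2 := W.vertical_le r hr z (hz z (Ioo_subset_Icc_self h1))
  have h3 : 0 < κ * z ^ 2 := mul_pos W.κ_pos (pow_pos h1.1 2)
  exact pos_of_mul_pos_right (h3.trans_le h2) h1.1.le

theorem apply_abs {r z : ℝ} (hr : r ∈ Icc a b) (hz : z ∈ Icc (-c) c) : V r |z| = V r z := by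
  rcases abs_choice z with h1 | h1 <;> rw [h1]
  exact W.even r hr z hz

theorem lt_of_abs_lt {r z z' : ℝ} (hr : r ∈ Icc a b) (hz' : z' ∈ Icc (-c) c)
    (h1 : |z| < |z'|) : V r z < V r z' := by
  have h2 : |z'| ≤ c := abs_le.2 hz'
  have hz : z ∈ Icc (-c) c := abs_le.1 (h1.le.trans h2)
  rw [← W.apply_abs hr hz, ← W.apply_abs hr hz']
  exact W.strictMonoOn_z hr ⟨abs_nonneg _, abs_le.2 hz⟩ ⟨abs_nonneg _, h2⟩ h1

theorem le_of_abs_le {r z z' : ℝ} (hr : r ∈ Icc a b) (hz' : z' ∈ Icc (-c) c)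
    (h1 : |z| ≤ |z'|) : V r z ≤ V r z' := by
  have h2 : |z'| ≤ c := abs_le.2 hz'
  have hz : z ∈ Icc (-c) c := abs_le.1 (h1.trans h2)
  rw [← W.apply_abs hr hz, ← W.apply_abs hr hz']
  exact (W.strictMonoOn_z hr).monotoneOn ⟨abs_nonneg _, abs_le.2 hz⟩ ⟨abs_nonneg _, h2⟩ h1

theorem strictMonoOn_r : StrictMonoOn (fun r => V r 0) (Icc rc b) := by
  have hr : ∀ r ∈ Icc rc b, r ∈ Icc a b := fun r hr => ⟨W.rc_mem.1.le.trans hr.1, hr.2⟩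
  refine strictMonoOn_of_deriv_pos (convex_Icc _ _)
    (fun r h1 => (W.hasDerivAt_r (hr r h1) W.zero_mem).continuousAt.continuousWithinAt)
    fun r h1 => ?_
  rw [interior_Icc] at h1
  have h4 := hr r (Ioo_subset_Icc_self h1)
  rw [(W.hasDerivAt_r h4 W.zero_mem).deriv]
  have h2 := W.radial_le r h4
  have h3 : 0 < κ * (r - rc) ^ 2 := mul_pos W.κ_pos (pow_pos (sub_pos.2 h1.1) 2)
  exact pos_of_mul_pos_right (h3.trans_le h2) (sub_pos.2 h1.1).le

theorem strictAntiOn_r : StrictAntiOn (fun r => V r 0) (Icc a rc) := by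
  have hr : ∀ r ∈ Icc a rc, r ∈ Icc a b := fun r hr => ⟨hr.1, hr.2.trans W.rc_mem.2.le⟩
  refine strictAntiOn_of_deriv_neg (convex_Icc _ _)
    (fun r h1 => (W.hasDerivAt_r (hr r h1) W.zero_mem).continuousAt.continuousWithinAt)
    fun r h1 => ?_
  rw [interior_Icc] at h1
  have h4 := hr r (Ioo_subset_Icc_self h1)
  rw [(W.hasDerivAt_r h4 W.zero_mem).deriv]
  have h2 := W.radial_le r h4
  have h3 : 0 < κ * (r - rc) ^ 2 := mul_pos W.κ_pos (by nlinarith [sub_neg.2 h1.2])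
  have h5 := sub_neg.2 h1.2
  nlinarith

theorem min_le_r {r : ℝ} (hr : r ∈ Icc a b) : V rc 0 ≤ V r 0 := by
  rcases le_total r rc with h1 | h1
  · exact W.strictAntiOn_r.antitoneOn ⟨hr.1, h1⟩ ⟨W.rc_mem.1.le, le_rfl⟩ h1
  · exact W.strictMonoOn_r.monotoneOn ⟨le_rfl, W.rc_mem.2.le⟩ ⟨h1, hr.2⟩ h1

theorem min_le {r z : ℝ} (hr : r ∈ Icc a b) (hz : z ∈ Icc (-c) c) : V rc 0 ≤ V r z :=
  (W.min_le_r hr).trans (W.le_of_abs_le hr hz (by simp))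

/-- One of the two square roots in `radialCoord` vanishes, according to the side of `rc`. -/
theorem radialCoord_sq {r : ℝ} (hr : r ∈ Icc a b) :
    radialCoord V h rc r ^ 2 = (V r 0 - V rc 0) / (h - V rc 0) := by
  have h1 : 0 ≤ (V r 0 - V rc 0) / (h - V rc 0) :=
    div_nonneg (sub_nonneg.2 (W.min_le_r hr)) W.depth_pos.le
  unfold radialCoord
  rcases le_total r rc with h2 | h2
  · rw [max_eq_right h2, min_eq_left h2]
    simp [Real.sq_sqrt h1]
  · rw [max_eq_left h2, min_eq_right h2]
    simp [Real.sq_sqrt h1]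

theorem strictMonoOn_radialCoord : StrictMonoOn (radialCoord V h rc) (Icc a b) := by
  intro r hr r' hr' hlt
  have hd := W.depth_pos
  have hmax : ∀ {s}, s ∈ Icc a b → max s rc ∈ Icc rc b := fun hs =>
    ⟨le_max_right _ _, max_le hs.2 W.rc_mem.2.le⟩
  have hmin : ∀ {s}, s ∈ Icc a b → min s rc ∈ Icc a rc := fun hs =>
    ⟨le_min hs.1 W.rc_mem.1.le, min_le_right _ _⟩
  have hnn : ∀ {s}, s ∈ Icc a b → 0 ≤ (V s 0 - V rc 0) / (h - V rc 0) := fun hs =>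
    div_nonneg (sub_nonneg.2 (W.min_le_r hs)) hd.le
  have hmaxI : ∀ {s}, s ∈ Icc a b → max s rc ∈ Icc a b := fun hs =>
    ⟨le_max_of_le_left hs.1, (hmax hs).2⟩
  have hminI : ∀ {s}, s ∈ Icc a b → min s rc ∈ Icc a b := fun hs =>
    ⟨(hmin hs).1, min_le_of_left_le hs.2⟩
  unfold radialCoord
  rcases lt_or_ge rc r' with h1 | h1
  · have e1 : √((V (max r rc) 0 - V rc 0) / (h - V rc 0)) <
        √((V (max r' rc) 0 - V rc 0) / (h - V rc 0)) := by
      refine Real.sqrt_lt_sqrt (hnn (hmaxI hr)) (div_lt_div_of_pos_right (sub_lt_sub_right ?_ _) hd)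
      refine W.strictMonoOn_r (hmax hr) (hmax hr') ?_
      rw [max_eq_left h1.le]
      exact max_lt hlt h1
    have e2 : √((V (min r' rc) 0 - V rc 0) / (h - V rc 0)) ≤
        √((V (min r rc) 0 - V rc 0) / (h - V rc 0)) := by
      refine Real.sqrt_le_sqrt (div_le_div_of_nonneg_right (sub_le_sub_right ?_ _) hd.le)
      exact W.strictAntiOn_r.antitoneOn (hmin hr) (hmin hr') (min_le_min_right _ hlt.le)
    linarith
  · have e1 : √((V (max r rc) 0 - V rc 0) / (h - V rc 0)) ≤
        √((V (max r' rc) 0 - V rc 0) / (h - V rc 0)) := by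
      refine Real.sqrt_le_sqrt (div_le_div_of_nonneg_right (sub_le_sub_right ?_ _) hd.le)
      exact W.strictMonoOn_r.monotoneOn (hmax hr) (hmax hr') (max_le_max_right _ hlt.le)
    have e2 : √((V (min r' rc) 0 - V rc 0) / (h - V rc 0)) <
        √((V (min r rc) 0 - V rc 0) / (h - V rc 0)) := by
      refine Real.sqrt_lt_sqrt (hnn (hminI hr')) (div_lt_div_of_pos_right (sub_lt_sub_right ?_ _) hd)
      refine W.strictAntiOn_r (hmin hr) (hmin hr') ?_
      rw [min_eq_left h1, min_eq_left (hlt.le.trans h1)]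
      exact hlt
    linarith

theorem continuousOn_radialCoord : ContinuousOn (radialCoord V h rc) (Icc a b) := by
  have hV : ContinuousOn (fun r => V r 0) (Icc a b) := fun r hr =>
    (W.hasDerivAt_r hr W.zero_mem).continuousAt.continuousWithinAt
  have h1 : ContinuousOn (fun r => V (max r rc) 0) (Icc a b) :=
    hV.comp (by fun_prop) fun r hr => ⟨le_max_of_le_left hr.1, max_le hr.2 W.rc_mem.2.le⟩
  have h2 : ContinuousOn (fun r => V (min r rc) 0) (Icc a b) :=
    hV.comp (by fun_prop) fun r hr => ⟨le_min hr.1 W.rc_mem.1.le, min_le_of_left_le hr.2⟩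
  exact (((h1.sub continuousOn_const).div_const _).sqrt).sub
    (((h2.sub continuousOn_const).div_const _).sqrt)

theorem exists_radialCoord_eq {v : ℝ} (hv : |v| ≤ 1) : ∃ r ∈ Icc a b, radialCoord V h rc r = v := by
  have hab : a ≤ b := (W.rc_mem.1.trans W.rc_mem.2).le
  have hends : ∀ r ∈ Icc a b, (r = a ∨ r = b) → 1 < radialCoord V h rc r ^ 2 := by
    intro r hr h1
    rw [W.radialCoord_sq hr, one_lt_div W.depth_pos]
    have := W.boundary r hr 0 W.zero_mem (by tauto)
    linarith
  have hrc : radialCoord V h rc rc = 0 := by simp [radialCoord]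
  have h1 := hends a ⟨le_rfl, hab⟩ (Or.inl rfl)
  have h2 := hends b ⟨hab, le_rfl⟩ (Or.inr rfl)
  have h3 := W.strictMonoOn_radialCoord ⟨le_rfl, hab⟩ W.rc_mem_Icc W.rc_mem.1
  have h4 := W.strictMonoOn_radialCoord W.rc_mem_Icc ⟨hab, le_rfl⟩ W.rc_mem.2
  rw [hrc] at h3 h4
  have h5 := abs_le.1 hv
  exact intermediate_value_Icc hab W.continuousOn_radialCoord ⟨by nlinarith, by nlinarith⟩

theorem norm_radialDisc_sq {x : Phase} (hx : x 2 ∈ Icc a b) :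
    (h - V rc 0) * (1 - ‖radialDisc V h rc x‖ ^ 2) = h - x 0 ^ 2 / 2 - V (x 2) 0 := by
  have hd := W.depth_pos
  rw [← Complex.normSq_eq_norm_sq, radialDisc, Complex.normSq_mk, ← sq, ← sq, W.radialCoord_sq hx,
    div_pow, Real.sq_sqrt (by linarith)]
  field_simp
  ring

theorem window_of_mem {x : Phase} (hx : x ∈ wellLevel V h a b c) :
    x 2 ∈ Ioo a b ∧ x 3 ∈ Ioo (-c) c := by
  obtain ⟨hr, hz, hE⟩ := hx
  have h1 : V (x 2) (x 3) ≤ h := by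
    unfold wellEnergy at hE
    nlinarith [sq_nonneg (x 0), sq_nonneg (x 1)]
  have h2 : ¬(x 2 = a ∨ x 2 = b ∨ x 3 = -c ∨ x 3 = c) :=
    fun hh => (W.boundary _ hr _ hz hh).not_ge h1
  simp only [not_or] at h2
  exact ⟨⟨lt_of_le_of_ne hr.1 (Ne.symm h2.1), lt_of_le_of_ne hr.2 h2.2.1⟩,
    ⟨lt_of_le_of_ne hz.1 (Ne.symm h2.2.2.1), lt_of_le_of_ne hz.2 h2.2.2.2⟩⟩

theorem norm_radialDisc_le {x : Phase} (hx : x ∈ wellLevel V h a b c) :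
    ‖radialDisc V h rc x‖ ≤ 1 := by
  have h1 := W.norm_radialDisc_sq hx.1
  have h2 := W.le_of_abs_le hx.1 hx.2.1 (z := 0) (by simp)
  have h3 : 0 ≤ h - x 0 ^ 2 / 2 - V (x 2) 0 := by
    have := hx.2.2
    unfold wellEnergy at this
    nlinarith [sq_nonneg (x 1)]
  have h4 : 0 ≤ 1 - ‖radialDisc V h rc x‖ ^ 2 := by
    rw [← h1] at h3
    exact nonneg_of_mul_nonneg_right h3 W.depth_pos
  nlinarith [norm_nonneg (radialDisc V h rc x)]

/-- On the energy surface `1 - ‖radialDisc‖²` is the normalised energy left for `(p_z, z)`. -/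
theorem norm_radialDisc_eq_one_iff {x : Phase} (hx : x ∈ wellLevel V h a b c) :
    ‖radialDisc V h rc x‖ = 1 ↔ vertical x = 0 := by
  have h1 := W.norm_radialDisc_sq hx.1
  have hE := hx.2.2
  unfold wellEnergy at hE
  rw [vertical_eq_zero_iff]
  constructor
  · intro h2
    rw [h2] at h1
    have h3 := W.le_of_abs_le hx.1 hx.2.1 (z := 0) (by simp)
    have h4 : x 1 = 0 := by
      have : x 1 ^ 2 ≤ 0 := by nlinarith
      exact pow_eq_zero_iff two_ne_zero |>.1 (le_antisymm this (sq_nonneg _))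
    refine ⟨h4, ?_⟩
    by_contra h5
    have h6 := W.lt_of_abs_lt hx.1 hx.2.1 (z := 0) (by simpa using h5)
    rw [h4] at hE
    nlinarith
  · rintro ⟨h2, h3⟩
    rw [h2, h3] at hE
    have h4 : (h - V rc 0) * (1 - ‖radialDisc V h rc x‖ ^ 2) = 0 := by rw [h1]; linarith
    rcases mul_eq_zero.1 h4 with h5 | h5
    · exact absurd h5 W.depth_pos.ne'
    · nlinarith [norm_nonneg (radialDisc V h rc x)]

theorem isClosed_wellLevel : IsClosed (wellLevel V h a b c) := by
  have h1 : wellLevel V h a b c = {x : Phase | x 2 ∈ Icc a b ∧ x 3 ∈ Icc (-c) c} ∩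
      wellEnergy V ⁻¹' {h} := by
    ext x; simp [wellLevel, and_assoc]
  have h2 : IsClosed {x : Phase | x 2 ∈ Icc a b ∧ x 3 ∈ Icc (-c) c} :=
    (isClosed_Icc.preimage (by fun_prop : Continuous fun x : Phase => x 2)).inter
      (isClosed_Icc.preimage (by fun_prop : Continuous fun x : Phase => x 3))
  rw [h1]
  refine ContinuousOn.preimage_isClosed_of_isClosed ?_ h2 isClosed_singleton
  refine ContinuousOn.add (by fun_prop) ?_
  exact W.continuousOn.comp (f := fun x : Phase => (x 2, x 3)) (by fun_prop) fun x hx => ⟨hx.1, hx.2⟩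

theorem isCompact_wellLevel : IsCompact (wellLevel V h a b c) := by
  refine Metric.isCompact_of_isClosed_isBounded W.isClosed_wellLevel ?_
  have hd := W.depth_pos
  refine (Metric.isBounded_closedBall (x := (0 : Phase))
    (r := √(2 * (h - V rc 0) + (|a| + |b|) ^ 2 + c ^ 2))).subset fun x hx => ?_
  rw [mem_closedBall_zero_iff, EuclideanSpace.norm_eq, Fin.sum_univ_four]
  simp only [Real.norm_eq_abs, sq_abs]
  refine Real.sqrt_le_sqrt ?_
  have h1 := W.min_le hx.1 hx.2.1
  have h2 := hx.2.2
  unfold wellEnergy at h2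
  have h3 : x 2 ^ 2 ≤ (|a| + |b|) ^ 2 := by
    rw [sq_le_sq, abs_of_nonneg (a := |a| + |b|) (by positivity)]
    have := abs_le_max_abs_abs hx.1.1 hx.1.2
    exact this.trans (max_le (by linarith [abs_nonneg b]) (by linarith [abs_nonneg a]))
  have h4 : x 3 ^ 2 ≤ c ^ 2 := sq_le_sq.2 ((abs_le.2 hx.2.1).trans (le_abs_self c))
  linarith

/-- Along a ray in the `(p_z, z)`-plane the energy is strictly increasing. -/
theorem energy_lt_of_ray {r p z l : ℝ} (hr : r ∈ Icc a b) (hz : l * z ∈ Icc (-c) c) (hl : 1 < l)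
    (h0 : p ≠ 0 ∨ z ≠ 0) : p ^ 2 / 2 + V r z < (l * p) ^ 2 / 2 + V r (l * z) := by
  have habs : |l * z| = l * |z| := by rw [abs_mul, abs_of_pos (by linarith)]
  have h2 : 1 < l ^ 2 := by nlinarith
  by_cases hz0 : z = 0
  · have hp : p ≠ 0 := by tauto
    have : 0 < p ^ 2 := by positivity
    rw [hz0, mul_zero]
    nlinarith
  · have h1 : V r z < V r (l * z) := by
      refine W.lt_of_abs_lt hr hz ?_
      rw [habs]
      nlinarith [abs_pos.2 hz0]
    nlinarith [sq_nonneg p]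

/-- The energy surface of a well is a three-sphere. The plane `{p_z = z = 0}` corresponds to the
circle `{w₁ = 0}`, the angular coordinate of `w₁` is the polar angle of `(p_z, z)`, and `w₂` is the
normalised radial coordinate. -/
theorem exists_homeomorph_sphere : ∃ Φ : wellLevel V h a b c ≃ₜ ThreeSphere,
    ∀ x, (Φ x : EuclideanSpace ℂ (Fin 2)) = joinPoint (vertical x) (radialDisc V h rc x) := by
  have hd := W.depth_pos
  have hs : 0 < √(2 * (h - V rc 0)) := Real.sqrt_pos.2 (by linarith)
  set N := wellLevel V h a b c with hN
  have h1 : ∀ x : N, vertical x = 0 → ‖radialDisc V h rc x‖ = 1 := fun x =>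
    (W.norm_radialDisc_eq_one_iff x.2).2
  have h2 : ∀ x : N, joinPoint (vertical x) (radialDisc V h rc x) ∈ ThreeSphere := fun x =>
    joinPoint_mem (W.norm_radialDisc_le x.2) (h1 x)
  -- at points of the plane `{p_z = z = 0}` the direction of `vertical x` is undefined, but there
  -- `‖radialDisc‖ = 1`
  have hcont : Continuous fun x : N => joinPoint (vertical x) (radialDisc V h rc x) := by
    refine continuous_joinPoint (continuous_vertical.comp continuous_subtype_val) ?_ h1
    have e : (fun x : N => radialDisc V h rc x) = fun x : N =>
        (((x : Phase) 0 / √(2 * (h - V rc 0)) : ℝ) : ℂ)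
          + (radialCoord V h rc ((x : Phase) 2) : ℝ) * Complex.I :=
      funext fun x => Complex.mk_eq_add_mul_I _ _
    rw [e]
    have h3 : Continuous fun x : N => radialCoord V h rc ((x : Phase) 2) :=
      W.continuousOn_radialCoord.comp_continuous (by fun_prop) fun x => x.2.1
    fun_prop
  let F : N → ThreeSphere := fun x => ⟨_, h2 x⟩
  have hinj : Function.Injective F := by
    rintro ⟨x, hx⟩ ⟨y, hy⟩ hxy
    have e : joinPoint (vertical x) (radialDisc V h rc x) =
      joinPoint (vertical y) (radialDisc V h rc y) := congrArg Subtype.val hxy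
    have e1 : radialDisc V h rc x = radialDisc V h rc y :=
      congrArg (fun v : EuclideanSpace ℂ (Fin 2) => v 1) e
    have er : x 2 = y 2 := W.strictMonoOn_radialCoord.injOn hx.1 hy.1 (congrArg Complex.im e1)
    have ep : x 0 = y 0 := by
      have h3 := congrArg Complex.re e1
      simp only [radialDisc] at h3
      field_simp at h3
      exact h3
    have hEx := hx.2.2
    have hEy := hy.2.2
    unfold wellEnergy at hEx hEy
    have ev : vertical x = vertical y := by
      by_cases hv : vertical x = 0
      · rw [hv, eq_comm, ← W.norm_radialDisc_eq_one_iff hy, ← e1,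
          W.norm_radialDisc_eq_one_iff hx]
        exact hv
      · have hv' : vertical y ≠ 0 := by
          rw [Ne, ← W.norm_radialDisc_eq_one_iff hy, ← e1, W.norm_radialDisc_eq_one_iff hx]
          exact hv
        have hlt : ∀ {w : Phase}, w ∈ N → vertical w ≠ 0 → ‖radialDisc V h rc w‖ < 1 :=
          fun hw hvw => lt_of_le_of_ne (W.norm_radialDisc_le hw) fun h3 =>
            hvw ((W.norm_radialDisc_eq_one_iff hw).1 h3)
        have hdir : vertical x / ‖vertical x‖ = vertical y / ‖vertical y‖ := by
          rw [← joinPoint_direction (hlt hx hv) hv, ← joinPoint_direction (hlt hy hv') hv', e]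
        have hxn : 0 < ‖vertical x‖ := norm_pos_iff.2 hv
        have hyn : 0 < ‖vertical y‖ := norm_pos_iff.2 hv'
        -- two points on one ray of the `(p_z, z)`-plane with the same energy coincide
        have key : ∀ {w w' : Phase}, w ∈ N → w' ∈ N → w 2 = w' 2 → w 0 = w' 0 →
            vertical w ≠ 0 → vertical w / ‖vertical w‖ = vertical w' / ‖vertical w'‖ →
            ¬ ‖vertical w‖ < ‖vertical w'‖ := by
          intro w w' hw hw' e2 e0 hvw hdw hlt
          have hwn : 0 < ‖vertical w‖ := norm_pos_iff.2 hvw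
          have hwn' : 0 < ‖vertical w'‖ := hwn.trans hlt
          set l := ‖vertical w'‖ / ‖vertical w‖ with hl
          have hl1 : 1 < l := (one_lt_div hwn).2 hlt
          have hv2 : vertical w' = (l : ℂ) * vertical w := by
            have hwC : (‖vertical w‖ : ℂ) ≠ 0 := by exact_mod_cast hwn.ne'
            have hwC' : (‖vertical w'‖ : ℂ) ≠ 0 := by exact_mod_cast hwn'.ne'
            rw [hl, Complex.ofReal_div]
            field_simp at hdw ⊢
            linear_combination -hdw
          have e3 : w' 1 = l * w 1 := by
            have := congrArg Complex.re hv2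
            simpa [vertical] using this
          have e4 : w' 3 = l * w 3 := by
            have := congrArg Complex.im hv2
            simpa [vertical] using this
          have h5 := W.energy_lt_of_ray (r := w 2) (p := w 1) (z := w 3) (l := l) hw.1
            (e4 ▸ hw'.2.1) hl1 (by
              by_contra! h6
              exact hvw ((vertical_eq_zero_iff w).2 h6))
          have h6 := hw.2.2
          have h7 := hw'.2.2
          unfold wellEnergy at h6 h7
          rw [e3, e4, ← e2, ← e0] at h7
          linarith
        have hnorm : ‖vertical x‖ = ‖vertical y‖ := le_antisymm
          (not_lt.1 (key hy hx er.symm ep.symm hv' hdir.symm)) (not_lt.1 (key hx hy er ep hv hdir))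
        have hyC : (‖vertical y‖ : ℂ) ≠ 0 := by exact_mod_cast hyn.ne'
        rw [hnorm] at hdir
        exact (div_left_inj' hyC).1 hdir
    apply Subtype.ext
    have e3 : x 1 = y 1 := congrArg Complex.re ev
    have e4 : x 3 = y 3 := congrArg Complex.im ev
    ext i
    fin_cases i <;> assumption
  have hsurj : Function.Surjective F := by
    rintro ⟨y, hy⟩
    have hy' := (mem_threeSphere_iff y).1 hy
    have him : |(y 1).im| ≤ 1 := by
      have h3 : ‖y 1‖ ≤ 1 := by nlinarith [sq_nonneg ‖y 0‖, norm_nonneg (y 1)]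
      exact (Complex.abs_im_le_norm _).trans h3
    obtain ⟨r, hr, hrv⟩ := W.exists_radialCoord_eq him
    set p := √(2 * (h - V rc 0)) * (y 1).re with hp
    have hdisc : ∀ q z : ℝ, radialDisc V h rc !₂[p, q, r, z] = y 1 := by
      intro q z
      apply Complex.ext
      · simp only [radialDisc, hp]
        simp
        field_simp
      · simpa [radialDisc] using hrv
    have hres : h - p ^ 2 / 2 - V r 0 = (h - V rc 0) * ‖y 0‖ ^ 2 := by
      have := W.norm_radialDisc_sq (x := !₂[p, 0, r, 0]) hr
      rw [hdisc] at this
      rw [show ‖y 0‖ ^ 2 = 1 - ‖y 1‖ ^ 2 by linarith, this]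
      simp
    by_cases h0 : y 0 = 0
    · refine ⟨⟨!₂[p, 0, r, 0], hr, W.zero_mem, ?_⟩, Subtype.ext ?_⟩
      · rw [h0] at hres
        simp [wellEnergy] at hres ⊢
        linarith
      · change joinPoint _ _ = y
        rw [hdisc]
        have : vertical !₂[p, 0, r, 0] = 0 := by simp [vertical_eq_zero_iff]
        rw [this, ← h0]
        exact joinPoint_self hy
    · set σ := y 0 / ‖y 0‖ with hσ
      have hσn : ‖σ‖ = 1 := norm_div_norm_of_ne_zero h0
      have hσsq : σ.re ^ 2 + σ.im ^ 2 = 1 := by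
        have := Complex.normSq_eq_norm_sq σ
        rw [hσn, Complex.normSq_apply] at this
        nlinarith
      have hpos : 0 < (h - V rc 0) * ‖y 0‖ ^ 2 := mul_pos hd (pow_pos (norm_pos_iff.2 h0) 2)
      -- move outwards in the direction `σ` until the energy is `h`
      obtain ⟨Λ, hΛ0, hΛc, hΛ⟩ : ∃ Λ : ℝ, 0 ≤ Λ ∧ Λ * |σ.im| ≤ c ∧
          h - p ^ 2 / 2 ≤ (Λ * σ.re) ^ 2 / 2 + V r (Λ * σ.im) := by
        by_cases hi : σ.im = 0
        · refine ⟨√(2 * ((h - V rc 0) * ‖y 0‖ ^ 2)), Real.sqrt_nonneg _, ?_, ?_⟩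
          · simp [hi, W.c_pos.le]
          · have : σ.re ^ 2 = 1 := by rw [hi] at hσsq; linarith
            have h3 : (√(2 * ((h - V rc 0) * ‖y 0‖ ^ 2)) * σ.re) ^ 2
                = 2 * ((h - V rc 0) * ‖y 0‖ ^ 2) := by
              rw [mul_pow, this, mul_one, Real.sq_sqrt (by linarith)]
            rw [hi, mul_zero, h3]
            linarith
        · have hi' : 0 < |σ.im| := abs_pos.2 hi
          refine ⟨c / |σ.im|, div_nonneg W.c_pos.le hi'.le, (div_mul_cancel₀ _ hi'.ne').le, ?_⟩
          have h3 : h < V r (c / |σ.im| * σ.im) := by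
            rcases abs_choice σ.im with h4 | h4
            · rw [h4, div_mul_cancel₀ _ hi]
              exact W.boundary r hr c ⟨by linarith [W.c_pos], le_rfl⟩ (by simp)
            · rw [h4, div_neg, neg_mul, div_mul_cancel₀ _ hi]
              exact W.boundary r hr (-c) ⟨le_rfl, by linarith [W.c_pos]⟩ (by simp)
          nlinarith [sq_nonneg p, sq_nonneg (c / |σ.im| * σ.re)]
      have hwin : ∀ l ∈ Icc 0 Λ, l * σ.im ∈ Icc (-c) c := fun l hl => by
        rw [mem_Icc, ← abs_le, abs_mul, abs_of_nonneg hl.1]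
        exact (mul_le_mul_of_nonneg_right hl.2 (abs_nonneg _)).trans hΛc
      have hcontl : ContinuousOn (fun l => (l * σ.re) ^ 2 / 2 + V r (l * σ.im)) (Icc 0 Λ) := by
        refine ContinuousOn.add (by fun_prop) ?_
        exact W.continuousOn.comp (f := fun l => (r, l * σ.im)) (by fun_prop)
          fun l hl => ⟨hr, hwin l hl⟩
      obtain ⟨l, hl, hle⟩ := intermediate_value_Icc hΛ0 hcontl
        (show h - p ^ 2 / 2 ∈ _ from ⟨by simp; linarith, hΛ⟩)
      simp only at hle
      have hl0 : 0 < l := by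
        refine lt_of_le_of_ne hl.1 fun h3 => ?_
        rw [← h3] at hle
        simp at hle
        linarith
      refine ⟨⟨!₂[p, l * σ.re, r, l * σ.im], hr, hwin l hl, ?_⟩, Subtype.ext ?_⟩
      · simp [wellEnergy]
        linarith
      · change joinPoint _ _ = y
        rw [hdisc]
        have hv : vertical !₂[p, l * σ.re, r, l * σ.im] = (l : ℂ) * σ := by
          apply Complex.ext <;> simp [vertical]
        have hln : ((‖(l : ℂ) * σ‖ : ℝ) : ℂ) = l := by
          rw [norm_mul, hσn, Complex.norm_real, Real.norm_of_nonneg hl0.le, mul_one]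
        rw [hv, ← joinPoint_self hy]
        refine joinPoint_congr ?_
        rw [hln, mul_div_cancel_left₀ _ (by exact_mod_cast hl0.ne')]
  have : CompactSpace N := isCompact_iff_compactSpace.1 W.isCompact_wellLevel
  have hF : IsHomeomorph F :=
    isHomeomorph_iff_continuous_bijective.2 ⟨hcont.subtype_mk _, hinj, hsurj⟩
  exact ⟨hF.homeomorph F, fun x => rfl⟩

theorem isPreconnected_wellLevel : IsPreconnected (wellLevel V h a b c) := by
  obtain ⟨Φ, -⟩ := W.exists_homeomorph_sphere
  have h1 : IsPreconnected ThreeSphere := by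
    refine (isConnected_sphere ?_ _ zero_le_one).isPreconnected
    rw [← Module.finrank_eq_rank, finrank_real_of_complex]
    simp
  rw [isPreconnected_iff_preconnectedSpace] at h1 ⊢
  exact Φ.symm.surjective.denseRange.preconnectedSpace Φ.symm.continuous

/-- The part of the energy level over the window is a connected component of the energy level. -/
theorem connectedComponentIn_eq {y : Phase} (hy : y ∈ wellLevel V h a b c) :
    connectedComponentIn {x : Phase | 0 < x 2 ∧ wellEnergy V x = h} y = wellLevel V h a b c := by
  have hsub : wellLevel V h a b c ⊆ {x : Phase | 0 < x 2 ∧ wellEnergy V x = h} :=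
    fun x hx => ⟨W.a_pos.trans_le hx.1.1, hx.2.2⟩
  refine Subset.antisymm ?_ (W.isPreconnected_wellLevel.subset_connectedComponentIn hy hsub)
  have hc2 : Continuous fun x : Phase => x 2 := by fun_prop
  have hc3 : Continuous fun x : Phase => x 3 := by fun_prop
  -- no point of the level lies over the boundary of the window, so the open window and the
  -- complement of the closed window separate it
  have hu : IsOpen {x : Phase | x 2 ∈ Ioo a b ∧ x 3 ∈ Ioo (-c) c} :=
    (isOpen_Ioo.preimage hc2).inter (isOpen_Ioo.preimage hc3)
  have hv : IsOpen {x : Phase | x 2 ∈ Icc a b ∧ x 3 ∈ Icc (-c) c}ᶜ :=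
    ((isClosed_Icc.preimage hc2).inter (isClosed_Icc.preimage hc3)).isOpen_compl
  have hL := connectedComponentIn_subset {x : Phase | 0 < x 2 ∧ wellEnergy V x = h} y
  have hcc := isPreconnected_connectedComponentIn (x := y)
    (F := {x : Phase | 0 < x 2 ∧ wellEnergy V x = h})
  have := hcc.subset_left_of_subset_union hu hv ?_ ?_ ⟨y, mem_connectedComponentIn (hsub hy),
    W.window_of_mem hy⟩
  · intro x hx
    have h1 := this hx
    exact ⟨Ioo_subset_Icc_self h1.1, Ioo_subset_Icc_self h1.2, (hL hx).2⟩
  · rw [disjoint_compl_right_iff_subset]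
    exact fun x hx => ⟨Ioo_subset_Icc_self hx.1, Ioo_subset_Icc_self hx.2⟩
  · intro x hx
    by_cases h1 : x 2 ∈ Icc a b ∧ x 3 ∈ Icc (-c) c
    · exact Or.inl (W.window_of_mem ⟨h1.1, h1.2, (hL hx).2⟩)
    · exact Or.inr h1

end

end HillWell

/-! ### Dynamics in a potential well -/

/-- The Hamiltonian vector field of `wellEnergy V`, where `Vr` and `Vz` are the partial derivatives
of `V`. -/
def wellField (Vr Vz : ℝ → ℝ → ℝ) (x : Phase) : Phase :=
  !₂[-Vr (x 2) (x 3), -Vz (x 2) (x 3), x 0, x 1]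

/-- A solution of Hamilton's equations on the energy surface of the well. -/
structure IsWellSolution (V Vr Vz : ℝ → ℝ → ℝ) (h a b c : ℝ) (ξ : ℝ → Phase) : Prop where
  mem : ∀ t, ξ t ∈ wellLevel V h a b c
  solves : ∀ t, HasDerivAt ξ (wellField Vr Vz (ξ t)) t

/-- A potential well in which Hamilton's equations are uniquely solvable for all times. -/
structure HillFlow (V Vr Vz : ℝ → ℝ → ℝ) (h a b c rc κ : ℝ) : Prop
    extends HillWell V Vr Vz h a b c rc κ where
  exists_solution : ∀ x ∈ wellLevel V h a b c, ∃ ξ, IsWellSolution V Vr Vz h a b c ξ ∧ ξ 0 = x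
  solution_unique : ∀ ξ η, IsWellSolution V Vr Vz h a b c ξ → IsWellSolution V Vr Vz h a b c η →
    ∀ t, ξ t = η t → ξ = η

/-- The reflection `(p_z, z) ↦ (-p_z, -z)`. -/
def reflectZ (x : Phase) : Phase := !₂[x 0, -x 1, x 2, -x 3]

/-- The time-reversing symmetry `diag(-1, 1, 1, -1)`. -/
def reverseZ (x : Phase) : Phase := !₂[-x 0, x 1, x 2, -x 3]

/-- The time-reversing symmetry `diag(-1, -1, 1, 1)`. -/
def reverseP (x : Phase) : Phase := !₂[-x 0, -x 1, x 2, x 3]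

theorem Phase.ext {x y : Phase} (h0 : x 0 = y 0) (h1 : x 1 = y 1) (h2 : x 2 = y 2)
    (h3 : x 3 = y 3) : x = y := by
  ext i
  fin_cases i <;> assumption

theorem HasDerivAt.phase_apply {ξ : ℝ → Phase} {v : Phase} {t : ℝ} (h : HasDerivAt ξ v t)
    (i : Fin 4) : HasDerivAt (fun t => ξ t i) (v i) t :=
  (EuclideanSpace.proj (𝕜 := ℝ) i).hasFDerivAt.comp_hasDerivAt t h

theorem hasDerivAt_phase {ξ : ℝ → Phase} {v : Phase} {t : ℝ}
    (h : ∀ i, HasDerivAt (fun t => ξ t i) (v i) t) : HasDerivAt ξ v t := by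
  have h1 : HasDerivAt (fun t i => ξ t i) (fun i => v i) t := hasDerivAt_pi.2 h
  exact (PiLp.continuousLinearEquiv 2 ℝ fun _ : Fin 4 => ℝ).symm.hasFDerivAt.comp_hasDerivAt t h1

namespace IsWellSolution

variable {V Vr Vz : ℝ → ℝ → ℝ} {h a b c rc κ : ℝ} {ξ η : ℝ → Phase}

theorem continuous (hξ : IsWellSolution V Vr Vz h a b c ξ) : Continuous ξ :=
  continuous_iff_continuousAt.2 fun t => (hξ.solves t).continuousAt

theorem comp_add (hξ : IsWellSolution V Vr Vz h a b c ξ) (s : ℝ) :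
    IsWellSolution V Vr Vz h a b c fun t => ξ (t + s) where
  mem _ := hξ.mem _
  solves t := (hξ.solves (t + s)).comp_add_const t s

theorem reflectZ (hξ : IsWellSolution V Vr Vz h a b c ξ) (W : HillWell V Vr Vz h a b c rc κ) :
    IsWellSolution V Vr Vz h a b c fun t => reflectZ (ξ t) where
  mem t := by
    obtain ⟨h1, h2, h3⟩ := hξ.mem t
    refine ⟨h1, ⟨neg_le_neg h2.2, neg_le.2 h2.1⟩, ?_⟩
    rw [← h3]
    simp [wellEnergy, _root_.reflectZ, W.even _ h1 _ h2]
  solves t := by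
    obtain ⟨h1, h2, h3⟩ := hξ.mem t
    refine hasDerivAt_phase fun i => ?_
    have e1 := W.even_r _ h1 _ h2
    have e2 := W.odd_z _ h1 _ h2
    have := (hξ.solves t).phase_apply i
    fin_cases i
    · simpa [wellField, _root_.reflectZ, e1] using this
    · simpa [wellField, _root_.reflectZ, e2] using this.fun_neg
    · simpa [wellField, _root_.reflectZ] using this
    · simpa [wellField, _root_.reflectZ] using this.fun_neg

theorem reverseP (hξ : IsWellSolution V Vr Vz h a b c ξ) (s : ℝ) :
    IsWellSolution V Vr Vz h a b c fun t => reverseP (ξ (s - t)) where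
  mem t := by
    obtain ⟨h1, h2, h3⟩ := hξ.mem (s - t)
    refine ⟨h1, h2, ?_⟩
    rw [← h3]
    simp [wellEnergy, _root_.reverseP]
  solves t := by
    refine hasDerivAt_phase fun i => ?_
    have := ((hξ.solves (s - t)).phase_apply i).comp_const_sub s t
    fin_cases i
    · simpa [wellField, _root_.reverseP] using this.fun_neg
    · simpa [wellField, _root_.reverseP] using this.fun_neg
    · simpa [wellField, _root_.reverseP] using this
    · simpa [wellField, _root_.reverseP] using this

theorem reverseZ (hξ : IsWellSolution V Vr Vz h a b c ξ) (W : HillWell V Vr Vz h a b c rc κ)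
    (s : ℝ) : IsWellSolution V Vr Vz h a b c fun t => reverseZ (ξ (s - t)) := by
  have := (hξ.reflectZ W).reverseP s
  have e : ∀ x : Phase, _root_.reverseP (_root_.reflectZ x) = _root_.reverseZ x := fun x =>
    Phase.ext rfl (by simp [_root_.reverseP, _root_.reflectZ, _root_.reverseZ]) rfl rfl
  simpa only [e] using this

end IsWellSolution

namespace HillFlow

variable {V Vr Vz : ℝ → ℝ → ℝ} {h a b c rc κ : ℝ} {ξ η : ℝ → Phase}

section
variable (W : HillFlow V Vr Vz h a b c rc κ)
include W

theorem eq_of_apply_eq (hξ : IsWellSolution V Vr Vz h a b c ξ)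
    (hη : IsWellSolution V Vr Vz h a b c η) {s t : ℝ} (hst : ξ s = η t) (u : ℝ) :
    ξ (u + s) = η (u + t) :=
  congrFun (W.solution_unique _ _ (hξ.comp_add s) (hη.comp_add t) 0 (by simpa using hst)) u

/-- A solution that meets the plane `{p_z = z = 0}` stays in it. -/
theorem vertical_eq_zero (hξ : IsWellSolution V Vr Vz h a b c ξ) {s : ℝ}
    (hs : vertical (ξ s) = 0) (t : ℝ) : vertical (ξ t) = 0 := by
  rw [vertical_eq_zero_iff] at hs ⊢
  have h1 : (fun t => reflectZ (ξ t)) = ξ := by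
    refine W.solution_unique _ _ (hξ.reflectZ W.toHillWell) hξ s ?_
    exact Phase.ext rfl (by simp [reflectZ, hs.1]) rfl (by simp [reflectZ, hs.2])
  have h2 := congrArg (fun x : Phase => x 1) (congrFun h1 t)
  have h3 := congrArg (fun x : Phase => x 3) (congrFun h1 t)
  simp [reflectZ] at h2 h3
  constructor <;> linarith

/-- The polar angle of `(p_z, z)` along a solution off the plane `{p_z = z = 0}`. -/
theorem exists_isAngle (hξ : IsWellSolution V Vr Vz h a b c ξ) (h0 : vertical (ξ 0) ≠ 0) :
    ∃ θ, IsAngle κ (fun t => vertical (ξ t)) θ := by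
  have hc := hξ.continuous
  refine exists_isAngle_of_restoring (x := fun t => ξ t 3) (y := fun t => ξ t 1)
    (F := fun t => Vz (ξ t 2) (ξ t 3)) W.κ_le_one (fun t => ?_) (fun t => ?_) ?_ (fun t => ?_)
    fun t ht => ?_
  · simpa [wellField] using (hξ.solves t).phase_apply 3
  · simpa [wellField] using (hξ.solves t).phase_apply 1
  · exact W.continuousOn_z.comp_continuous (f := fun t => (ξ t 2, ξ t 3)) (by fun_prop)
      fun t => ⟨(hξ.mem t).1, (hξ.mem t).2.1⟩
  · exact W.vertical_le _ (hξ.mem t).1 _ (hξ.mem t).2.1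
  · exact h0 (W.vertical_eq_zero hξ (s := t) ht 0)

/-- The polar angle of `(p_r, r - rc)` along a solution in the plane `{p_z = z = 0}`. -/
theorem exists_isAngle_planar (hξ : IsWellSolution V Vr Vz h a b c ξ) (hp : IsPlanar ξ) :
    ∃ θ, IsAngle κ (fun t => (⟨ξ t 0, ξ t 2 - rc⟩ : ℂ)) θ := by
  have hc := hξ.continuous
  refine exists_isAngle_of_restoring (x := fun t => ξ t 2 - rc) (y := fun t => ξ t 0)
    (F := fun t => Vr (ξ t 2) 0) W.κ_le_one (fun t => ?_) (fun t => ?_) ?_ (fun t => ?_)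
    fun t ht => ?_
  · simpa [wellField] using ((hξ.solves t).phase_apply 2).sub_const rc
  · simpa [wellField, (hp t).2] using (hξ.solves t).phase_apply 0
  · exact W.continuousOn_r.comp_continuous (f := fun t => (ξ t 2, 0)) (by fun_prop)
      fun t => ⟨(hξ.mem t).1, W.zero_mem⟩
  · exact W.radial_le _ (hξ.mem t).1
  · rw [Complex.ext_iff] at ht
    simp only [Complex.zero_re, Complex.zero_im] at ht
    have h1 := (hξ.mem t).2.2
    rw [wellEnergy, ht.1, (hp t).1, (hp t).2, sub_eq_zero.1 ht.2] at h1
    have := W.below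
    norm_num at h1
    linarith

/-- The plane `{p_z = z = 0}` meets the energy surface in exactly one periodic orbit. -/
theorem exists_planar : ∃ ξ, IsWellSolution V Vr Vz h a b c ξ ∧ IsPlanar ξ ∧
    (∃ T > 0, Function.Periodic ξ T) ∧
    (∀ η, IsWellSolution V Vr Vz h a b c η → IsPlanar η → ∃ s, ∀ t, η t = ξ (t + s)) ∧
    ∀ x ∈ wellLevel V h a b c, x ∈ range ξ ↔ vertical x = 0 := by
  -- start at the outer turning point of the radial motion
  have hcont : ContinuousOn (fun r => V r 0) (Icc rc b) := fun r hr =>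
    (W.hasDerivAt_r ⟨W.rc_mem.1.le.trans hr.1, hr.2⟩ W.zero_mem).continuousAt.continuousWithinAt
  obtain ⟨r₁, hr₁, hV⟩ := intermediate_value_Icc W.rc_mem.2.le hcont
    (show h ∈ _ from ⟨W.below.le, (W.boundary b ⟨(W.rc_mem.1.trans W.rc_mem.2).le, le_rfl⟩ 0
      W.zero_mem (by simp)).le⟩)
  simp only at hV
  have hr₁' : r₁ ∈ Icc a b := ⟨W.rc_mem.1.le.trans hr₁.1, hr₁.2⟩
  have hx₁ : !₂[0, 0, r₁, 0] ∈ wellLevel V h a b c :=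
    ⟨hr₁', W.zero_mem, by simp [wellEnergy, hV]⟩
  obtain ⟨ξ, hξ, hξ0⟩ := W.exists_solution _ hx₁
  have hplan : ∀ η, IsWellSolution V Vr Vz h a b c η → ∀ s, vertical (η s) = 0 → IsPlanar η :=
    fun η hη s hs t => (vertical_eq_zero_iff _).1 (W.vertical_eq_zero hη hs t)
  have hξp : IsPlanar ξ := hplan ξ hξ 0 (by rw [hξ0, vertical_eq_zero_iff]; simp)
  -- the turning point is the only planar point with `p_r = 0` and `r ≥ rc`
  have hret : ∀ η, IsWellSolution V Vr Vz h a b c η → IsPlanar η → ∀ t, η t 0 = 0 →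
      rc ≤ η t 2 → η t = !₂[0, 0, r₁, 0] := by
    intro η hη hp t h0 h2
    obtain ⟨hm2, hm3, hE⟩ := hη.mem t
    have hr : η t 2 = r₁ := by
      refine W.strictMonoOn_r.injOn ⟨h2, hm2.2⟩ hr₁ ?_
      rw [wellEnergy, h0, (hp t).1, (hp t).2] at hE
      simp only
      rw [hV]
      norm_num at hE
      exact hE
    refine Phase.ext ?_ ?_ ?_ ?_
    · simpa using h0
    · simpa using (hp t).1
    · simpa using hr
    · simpa using (hp t).2
  have huniq : ∀ η, IsWellSolution V Vr Vz h a b c η → IsPlanar η →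
      ∃ s, ∀ t, η t = ξ (t + s) := by
    intro η hη hp
    obtain ⟨θ, hθ⟩ := W.exists_isAngle_planar hη hp
    -- a planar solution reaches the turning point when the polar angle of `(p_r, r - rc)` is `π / 2`
    obtain ⟨s, hs⟩ := hθ.surjective W.κ_pos (Real.pi / 2)
    have h1 := hθ.re_eq s
    have h2 := hθ.im_eq s
    rw [hs] at h1 h2
    simp only [Real.cos_pi_div_two, Real.sin_pi_div_two, mul_zero, mul_one] at h1 h2
    have h3 := hret η hη hp s h1 (sub_nonneg.1 (h2.symm ▸ norm_nonneg _))
    refine ⟨-s, fun t => ?_⟩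
    have h4 := W.eq_of_apply_eq hη hξ (h3.trans hξ0.symm) (t - s)
    simpa [sub_eq_add_neg] using h4
  refine ⟨ξ, hξ, hξp, ?_, huniq, fun x hx => ⟨?_, fun hv => ?_⟩⟩
  · obtain ⟨θ, hθ⟩ := W.exists_isAngle_planar hξ hξp
    obtain ⟨T, hT⟩ := hθ.surjective W.κ_pos (θ 0 + 2 * Real.pi)
    have hT0 : 0 < T := (hθ.strictMono W.κ_pos).lt_iff_lt.1 (by rw [hT]; linarith [Real.pi_pos])
    have hin : 0 < ‖(⟨ξ 0 0, ξ 0 2 - rc⟩ : ℂ)‖ := by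
      rw [norm_pos_iff, Ne, Complex.ext_iff, hξ0]
      simp only [Complex.zero_re, Complex.zero_im]
      rintro ⟨-, h1⟩
      have h2 : r₁ = rc := sub_eq_zero.1 h1
      rw [h2] at hV
      exact W.below.ne hV
    have e1 := hθ.re_eq 0
    have e2 := hθ.im_eq 0
    have e3 := hθ.re_eq T
    have e4 := hθ.im_eq T
    rw [hT, Real.cos_add_two_pi] at e3
    rw [hT, Real.sin_add_two_pi] at e4
    simp only at e1 e2 e3 e4
    generalize ‖(⟨ξ 0 0, ξ 0 2 - rc⟩ : ℂ)‖ = n at e1 e2 hin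
    have hc0 : Real.cos (θ 0) = 0 := by
      have : ξ 0 0 = 0 := by rw [hξ0]; simp
      rw [this] at e1
      exact (mul_eq_zero.1 e1.symm).resolve_left hin.ne'
    have hs0 : 0 ≤ Real.sin (θ 0) := by
      have : ξ 0 2 = r₁ := by rw [hξ0]; simp
      rw [this] at e2
      by_contra! hneg
      nlinarith [hr₁.1]
    have h3 := hret ξ hξ hξp T (by rw [e3, hc0, mul_zero])
      (sub_nonneg.1 (e4.symm ▸ mul_nonneg (norm_nonneg _) hs0))
    refine ⟨T, hT0, fun t => ?_⟩
    simpa using W.eq_of_apply_eq hξ hξ (h3.trans hξ0.symm) t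
  · rintro ⟨t, rfl⟩
    exact (vertical_eq_zero_iff _).2 (hξp t)
  · obtain ⟨η, hη, hη0⟩ := W.exists_solution x hx
    obtain ⟨s, hs⟩ := huniq η hη (hplan η hη 0 (by rw [hη0, hv]))
    exact ⟨0 + s, by rw [← hs, hη0]⟩

end

end HillFlow

/-! ### Symmetric brake orbits and the quarter-period condition -/

/-- The curve starts on the ray `z = 0`, `p_z > 0`, and `p_r` vanishes when the polar angle of
`(p_z, z)` has advanced by a quarter turn, that is, when `p_z` vanishes for the first time. -/
def IsQuarterBrake (κ : ℝ) (ξ : ℝ → Phase) : Prop :=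
  ∃ θ, IsAngle κ (fun t => vertical (ξ t)) θ ∧ θ 0 = 0 ∧ ∃ s, θ s = Real.pi / 2 ∧ ξ s 0 = 0

theorem vertical_reflectZ (x : Phase) : vertical (reflectZ x) = -vertical x := by
  apply Complex.ext <;> simp [vertical, reflectZ]

theorem vertical_reverseZ (x : Phase) :
    vertical (reverseZ x) = (starRingEnd ℂ) (vertical x) := by
  apply Complex.ext <;> simp [vertical, reverseZ]

theorem reverseP_reverseZ (x : Phase) : reverseP (reverseZ x) = reflectZ x :=
  Phase.ext (by simp [reverseP, reverseZ, reflectZ]) (by simp [reverseP, reverseZ, reflectZ])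
    (by simp [reverseP, reverseZ, reflectZ]) (by simp [reverseP, reverseZ, reflectZ])

theorem reflectZ_reflectZ (x : Phase) : reflectZ (reflectZ x) = x :=
  Phase.ext (by simp [reflectZ]) (by simp [reflectZ]) (by simp [reflectZ]) (by simp [reflectZ])

theorem exp_mul_I_eq_of_polar {z : ℂ} {θ : ℝ} (hz : z ≠ 0)
    (h : z = ‖z‖ * Complex.exp (θ * Complex.I)) : z / ‖z‖ = Complex.exp (θ * Complex.I) := by
  have : (‖z‖ : ℂ) ≠ 0 := by simpa using hz
  rw [div_eq_iff this, mul_comm]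
  exact h

/-- If a time shift acts as the reflection `reflectZ`, it advances the polar angle by an odd
multiple of `π`. -/
theorem exists_int_of_vertical_shift {κ : ℝ} {ξ : ℝ → Phase} {θ : ℝ → ℝ}
    (hθ : IsAngle κ (fun t => vertical (ξ t)) θ) (h0 : ∀ t, vertical (ξ t) ≠ 0) {s : ℝ}
    (hs : ∀ t, ξ (t + s) = reflectZ (ξ t)) :
    ∃ n : ℤ, ∀ t, θ (t + s) = θ t + Real.pi + 2 * Real.pi * n := by
  refine exists_int_of_exp_eq (hθ.cont.comp (continuous_add_const s))
    (hθ.cont.add continuous_const) fun t => ?_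
  rw [← exp_mul_I_eq_of_polar (h0 (t + s)) (hθ.polar (t + s)), hs t, vertical_reflectZ, norm_neg,
    neg_div, exp_mul_I_eq_of_polar (h0 t) (hθ.polar t)]
  push_cast
  rw [add_mul, Complex.exp_add, Complex.exp_pi_mul_I]
  ring

namespace HillFlow

variable {V Vr Vz : ℝ → ℝ → ℝ} {h a b c rc κ : ℝ} {ξ η : ℝ → Phase}

section
variable (W : HillFlow V Vr Vz h a b c rc κ)
include W

theorem reverseZ_eq (hξ : IsWellSolution V Vr Vz h a b c ξ) {t₀ : ℝ} (h0 : ξ t₀ 0 = 0)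
    (h3 : ξ t₀ 3 = 0) (t : ℝ) : ξ (t₀ + t) = reverseZ (ξ (t₀ - t)) := by
  have e : ξ t₀ = reverseZ (ξ (2 * t₀ - t₀)) := by
    rw [show 2 * t₀ - t₀ = t₀ by ring]
    exact Phase.ext (by simp [reverseZ, h0]) rfl rfl (by simp [reverseZ, h3])
  have := congrFun (W.solution_unique _ _ hξ (hξ.reverseZ W.toHillWell (2 * t₀)) t₀ e) (t₀ + t)
  rw [this]
  ring_nf

theorem reverseP_eq (hξ : IsWellSolution V Vr Vz h a b c ξ) {t₁ : ℝ} (h0 : ξ t₁ 0 = 0)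
    (h1 : ξ t₁ 1 = 0) (t : ℝ) : ξ (t₁ + t) = reverseP (ξ (t₁ - t)) := by
  have e : ξ t₁ = reverseP (ξ (2 * t₁ - t₁)) := by
    rw [show 2 * t₁ - t₁ = t₁ by ring]
    exact Phase.ext (by simp [reverseP, h0]) (by simp [reverseP, h1]) rfl rfl
  have := congrFun (W.solution_unique _ _ hξ (hξ.reverseP (2 * t₁)) t₁ e) (t₁ + t)
  rw [this]
  ring_nf

/-- A solution with both reversing symmetries, about the times `t₀` and `t₁`, is invariant under
the reflection in `z = 0` combined with the time shift by `2 (t₁ - t₀)`. -/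
theorem reflectZ_eq (hξ : IsWellSolution V Vr Vz h a b c ξ) {t₀ t₁ : ℝ} (h00 : ξ t₀ 0 = 0)
    (h03 : ξ t₀ 3 = 0) (h10 : ξ t₁ 0 = 0) (h11 : ξ t₁ 1 = 0) (t : ℝ) :
    ξ (t + 2 * (t₁ - t₀)) = reflectZ (ξ t) := by
  have e1 := W.reverseP_eq hξ h10 h11 (t + t₁ - 2 * t₀)
  have e2 := W.reverseZ_eq hξ h00 h03 (t₀ - t)
  rw [show t₁ + (t + t₁ - 2 * t₀) = t + 2 * (t₁ - t₀) by ring,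
    show t₁ - (t + t₁ - 2 * t₀) = t₀ + (t₀ - t) by ring, e2, reverseP_reverseZ,
    show t₀ - (t₀ - t) = t by ring] at e1
  exact e1

/-- A solution satisfying the quarter-period condition at a point fixed by the reversing symmetry
`reverseZ` is a `z`-symmetric brake orbit, of period four times the quarter, and it forms a Hopf
link with the planar orbit. -/
theorem isBrake_of_isQuarterBrake (hξ : IsWellSolution V Vr Vz h a b c ξ) (h00 : ξ 0 0 = 0)
    (h03 : ξ 0 3 = 0) (h01 : ξ 0 1 ≠ 0) (hq : IsQuarterBrake κ ξ) {B : Set Phase}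
    (hBN : B ⊆ wellLevel V h a b c) (hB : ∀ x ∈ wellLevel V h a b c, x ∈ B ↔ vertical x = 0) :
    (∃ T > 0, Function.Periodic ξ T) ∧ IsBrake ξ ∧ IsZSymmetric ξ ∧
      IsHopfLink (wellLevel V h a b c) (range ξ) B := by
  obtain ⟨θ, hθ, hθ0, s, hs, hs0⟩ := hq
  have hpi := Real.pi_pos
  have hmono := hθ.strictMono W.κ_pos
  have hv : ∀ t, vertical (ξ t) ≠ 0 := fun t ht =>
    h01 ((vertical_eq_zero_iff _).1 (W.vertical_eq_zero hξ ht 0)).1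
  have hspos : 0 < s := hmono.lt_iff_lt.1 (by rw [hθ0, hs]; positivity)
  have hs1 : ξ s 1 = 0 := by
    have := hθ.re_eq s
    rw [hs, Real.cos_pi_div_two, mul_zero] at this
    exact this
  have hrev : ∀ t, ξ t = reverseZ (ξ (-t)) := fun t => by
    simpa using W.reverseZ_eq hξ h00 h03 t
  have hrefl : ∀ t, ξ (t + 2 * s) = reflectZ (ξ t) := fun t => by
    simpa using W.reflectZ_eq hξ h00 h03 hs0 hs1 t
  have hper : Function.Periodic ξ (4 * s) := fun t => by
    rw [show t + 4 * s = t + 2 * s + 2 * s by ring, hrefl, hrefl, reflectZ_reflectZ]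
  -- `reverseZ` conjugates `p_z + i z`, so the angle is odd in time
  have hodd : ∀ t, θ (-t) = -θ t := by
    obtain ⟨n, hn⟩ := exists_int_of_exp_eq (α := fun t => θ (-t)) (β := fun t => -θ t)
      (hθ.cont.comp continuous_neg) hθ.cont.neg fun t => by
        have e : vertical (ξ t) / ‖vertical (ξ t)‖ =
            (starRingEnd ℂ) (vertical (ξ (-t)) / ‖vertical (ξ (-t))‖) := by
          rw [map_div₀, Complex.conj_ofReal, ← vertical_reverseZ, ← hrev t]
          congr 2
          conv_lhs => rw [hrev t, vertical_reverseZ, RCLike.norm_conj]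
        rw [exp_mul_I_eq_of_polar (hv t) (hθ.polar t),
          exp_mul_I_eq_of_polar (hv (-t)) (hθ.polar (-t)), ← Complex.exp_conj] at e
        simp only [map_mul, Complex.conj_ofReal, Complex.conj_I] at e
        simp only [Complex.ofReal_neg, neg_mul, Complex.exp_neg]
        rw [e, mul_neg, Complex.exp_neg, inv_inv]
    intro t
    have e0 := hn 0
    simp only [neg_zero, hθ0, zero_add] at e0
    have e1 := hn t
    linarith
  -- from `-s` to `s` the angle runs from `-π / 2` to `π / 2`, so the period is one full turn
  have hturn : ∀ t, θ (t + 4 * s) = θ t + 2 * Real.pi := by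
    obtain ⟨n, hn⟩ := exists_int_of_vertical_shift hθ hv hrefl
    have e := hn (-s)
    rw [hodd, show -s + 2 * s = s by ring, hs] at e
    intro t
    rw [show t + 4 * s = t + 2 * s + 2 * s by ring, hn, hn]
    linarith
  refine ⟨⟨4 * s, by positivity, hper⟩, ⟨s, s + 4 * s, by linarith, ⟨hs0, hs1⟩, ?_⟩,
    ⟨0, h00, h03, fun t => W.reverseZ_eq hξ h00 h03 t⟩, ?_⟩
  · rw [hper s]
    exact ⟨hs0, hs1⟩
  obtain ⟨Φ, hΦ⟩ := W.exists_homeomorph_sphere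
  -- the orbit is parametrised by its polar angle
  let e := hmono.orderIsoOfSurjective θ (hθ.surjective W.κ_pos)
  have hτc : Continuous e.symm := e.symm.continuous
  have hτ : ∀ φ, θ (e.symm φ) = φ := fun φ => e.apply_symm_apply φ
  have hτθ : ∀ t, e.symm (θ t) = t := fun t => e.symm_apply_apply t
  have hdisc : ∀ t, radialDisc V h rc (ξ t) =
      (Φ ⟨ξ t, hξ.mem t⟩ : EuclideanSpace ℂ (Fin 2)) 1 := fun t => by rw [hΦ]; simp
  have hFc : Continuous fun φ => radialDisc V h rc (ξ (e.symm φ)) := by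
    simp only [hdisc]
    refine (PiLp.continuous_apply 2 _ 1).comp (continuous_subtype_val.comp (Φ.continuous.comp ?_))
    exact (hξ.continuous.comp hτc).subtype_mk _
  have hturn' : ∀ (n : ℤ) φ, ξ (e.symm (φ + n * (2 * Real.pi))) = ξ (e.symm φ) := by
    have hp : Function.Periodic (fun φ => ξ (e.symm φ)) (2 * Real.pi) := by
      intro φ
      have e1 : e.symm (φ + 2 * Real.pi) = e.symm φ + 4 * s := by
        rw [← hτθ (e.symm φ + 4 * s), hturn, hτ]
      simp only [e1, hper _]
    intro n φ
    exact hp.int_mul n φ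
  obtain ⟨A, hAc, hA⟩ := exists_continuousOn_range (η := fun φ : ℝ => Complex.exp (φ * Complex.I))
    (by fun_prop) (T := 2 * Real.pi) (by positivity)
    (fun φ => by push_cast; rw [add_mul, Complex.exp_add, Complex.exp_two_pi_mul_I, mul_one])
    hFc (fun φ ψ hφψ => by
      obtain ⟨n, hn⟩ := Complex.exp_eq_exp_iff_exists_int.1 hφψ
      have h2 := congrArg Complex.im hn
      simp at h2
      simp only [h2, hturn'])
  have hrange : range (fun φ : ℝ => Complex.exp (φ * Complex.I)) = Metric.sphere 0 1 := by
    ext z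
    rw [mem_sphere_zero_iff_norm]
    constructor
    · rintro ⟨φ, rfl⟩
      exact Complex.norm_exp_ofReal_mul_I φ
    · intro hz
      refine ⟨z.arg, ?_⟩
      have := Complex.norm_mul_exp_arg_mul_I z
      rw [hz] at this
      simpa using this
  rw [hrange] at hAc
  have hlt : ∀ x ∈ wellLevel V h a b c, vertical x ≠ 0 → ‖radialDisc V h rc x‖ < 1 :=
    fun x hx hvx =>
    lt_of_le_of_ne (W.norm_radialDisc_le hx) fun h3 =>
      hvx ((W.norm_radialDisc_eq_one_iff hx).1 h3)
  have hΦ0 : ∀ x : wellLevel V h a b c, (Φ x : EuclideanSpace ℂ (Fin 2)) 0 = 0 ↔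
      vertical x = 0 := fun x => by
    rw [hΦ, joinPoint_zero_eq_zero_iff (W.norm_radialDisc_le x.2)
      (W.norm_radialDisc_eq_one_iff x.2).2, W.norm_radialDisc_eq_one_iff x.2]
  refine isHopfLink_of_graph (range_subset_iff.2 hξ.mem) hBN Φ hAc ?_ (fun x => ?_) fun x => ?_
  · intro σ hσ
    rw [← hrange] at hσ
    obtain ⟨φ, rfl⟩ := hσ
    rw [hA]
    exact hlt _ (hξ.mem _) (hv _)
  · have hdir : vertical x ≠ 0 → (Φ x : EuclideanSpace ℂ (Fin 2)) 0 /
        ‖(Φ x : EuclideanSpace ℂ (Fin 2)) 0‖ = vertical x / ‖vertical x‖ := fun hvx => by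
      rw [hΦ, joinPoint_direction (hlt _ x.2 hvx) hvx]
    have hone : (Φ x : EuclideanSpace ℂ (Fin 2)) 1 = radialDisc V h rc x := by rw [hΦ]; simp
    rw [Ne, hΦ0, hone]
    constructor
    · rintro ⟨t, ht⟩
      have hvx : vertical x ≠ 0 := ht ▸ hv t
      refine ⟨hvx, ?_⟩
      rw [hdir hvx, ← ht, exp_mul_I_eq_of_polar (hv t) (hθ.polar t), hA, hτθ]
    · rintro ⟨hvx, hx⟩
      rw [hdir hvx] at hx
      have hσ : vertical x / ‖vertical x‖ ∈ Metric.sphere (0 : ℂ) 1 :=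
        mem_sphere_zero_iff_norm.2 (norm_div_norm_of_ne_zero hvx)
      rw [← hrange] at hσ
      obtain ⟨φ, hφ⟩ := hσ
      simp only at hφ
      rw [← hφ, hA] at hx
      refine ⟨e.symm φ, ?_⟩
      have : (⟨ξ (e.symm φ), hξ.mem _⟩ : wellLevel V h a b c) = x := by
        apply Φ.injective
        apply Subtype.ext
        rw [hΦ, hΦ, hx]
        refine joinPoint_congr ?_
        rw [← hφ, exp_mul_I_eq_of_polar (hv _) (hθ.polar _), hτ]
      exact congrArg Subtype.val this
  · rw [hB _ x.2, hΦ0]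

/-- A solution that forms a Hopf link with the planar orbit winds around it exactly once during a
suitable period. -/
theorem exists_period_of_isHopfLink (hη : IsWellSolution V Vr Vz h a b c η)
    (hper : ∃ T > 0, Function.Periodic η T) {B : Set Phase}
    (hB : ∀ x ∈ wellLevel V h a b c, x ∈ B ↔ vertical x = 0)
    (hlink : IsHopfLink (wellLevel V h a b c) (range η) B) :
    (∀ t, vertical (η t) ≠ 0) ∧ ∀ θ, IsAngle κ (fun t => vertical (η t)) θ →
      ∃ T > 0, ∀ t, η (t + T) = η t ∧ θ (t + T) = θ t + 2 * Real.pi := by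
  obtain ⟨hA, -, Φ, hΦA, hΦB⟩ := hlink
  have hv : ∀ t, vertical (η t) ≠ 0 := by
    intro t ht
    have h1 := (hΦA ⟨η t, hη.mem t⟩).1 (mem_range_self t)
    have h2 := (hΦB ⟨η t, hη.mem t⟩).1 ((hB _ (hη.mem t)).2 ht)
    have h3 := (mem_threeSphere_iff _).1 (Φ ⟨η t, hη.mem t⟩).2
    rw [h1, h2] at h3
    simp at h3
  refine ⟨hv, fun θ hθ => ?_⟩
  have hset : ∀ x : wellLevel V h a b c, (Φ x : EuclideanSpace ℂ (Fin 2)) 0 ≠ 0 ↔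
      vertical x ≠ 0 := fun x => by
    rw [Ne, ← hΦB, hB _ x.2]
  have hvc : Continuous fun x : wellLevel V h a b c => vertical x :=
    continuous_vertical.comp continuous_subtype_val
  obtain ⟨Φ₀, hΦ₀⟩ := W.exists_homeomorph_sphere
  -- the loop over the circle of directions with fixed radial coordinates
  have hloop : ∀ φ : ℝ, (!₂[Complex.exp (φ * Complex.I), 0] : EuclideanSpace ℂ (Fin 2)) ∈
      ThreeSphere := fun φ => by
    rw [mem_threeSphere_iff]
    simp [Complex.norm_exp_ofReal_mul_I]
  let γ : ℝ → wellLevel V h a b c := fun φ => Φ₀.symm ⟨_, hloop φ⟩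
  have hγ : ∀ φ, joinPoint (vertical (γ φ)) (radialDisc V h rc (γ φ)) =
      !₂[Complex.exp (φ * Complex.I), 0] := fun φ => by
    rw [← hΦ₀]
    simp [γ]
  have hγ1 : ∀ φ, radialDisc V h rc (γ φ) = 0 := fun φ =>
    congrArg (fun w : EuclideanSpace ℂ (Fin 2) => w 1) (hγ φ)
  have hγ0 : ∀ φ, vertical (γ φ) ≠ 0 := fun φ h0 => by
    have := (W.norm_radialDisc_eq_one_iff (γ φ).2).2 h0
    rw [hγ1] at this
    simp at this
  have hγc : Continuous γ := by
    refine Φ₀.symm.continuous.comp (Continuous.subtype_mk ?_ _)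
    refine (PiLp.continuous_toLp 2 _).comp (continuous_pi fun i => ?_)
    fin_cases i
    · simp only [Fin.zero_eta, Matrix.cons_val_zero]
      fun_prop
    · simp only [Fin.mk_one, Matrix.cons_val_one]
      fun_prop
  have hmono := hθ.strictMono W.κ_pos
  obtain ⟨T, hT0, hT⟩ := exists_period_winding_one Φ
    (v := fun x : wellLevel V h a b c => vertical x / ‖vertical x‖) (γ := γ)
    (η := fun t => ⟨η t, hη.mem t⟩) (θ := θ)
    (by
      refine hvc.continuousOn.div ?_ fun x hx => ?_
      · exact (Complex.continuous_ofReal.comp hvc.norm).continuousOn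
      · simpa using (hset x).1 hx)
    (fun x hx => by
      have := (hset x).1 hx
      exact div_ne_zero this (by simpa using this))
    hγc (fun φ => (hset _).2 (hγ0 φ))
    (fun φ => by
      have h1 := joinPoint_direction (u := vertical (γ φ)) (w := radialDisc V h rc (γ φ))
        (by simp [hγ1]) (hγ0 φ)
      rw [← h1, hγ]
      simp [Complex.norm_exp_ofReal_mul_I])
    (by simp [γ, Complex.exp_two_pi_mul_I])
    (hη.continuous.subtype_mk _)
    (fun x => by
      rw [← hΦA]
      constructor
      · rintro ⟨t, ht⟩
        exact ⟨t, congrArg Subtype.val ht⟩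
      · rintro ⟨t, ht⟩
        exact ⟨t, Subtype.ext ht⟩)
    (by
      obtain ⟨T, hT0, hT⟩ := hper
      exact ⟨T, hT0, fun t => Subtype.ext (hT t)⟩)
    (fun s t hst u => Subtype.ext (W.eq_of_apply_eq hη hη (congrArg Subtype.val hst) u))
    hθ.cont hmono (fun t => exp_mul_I_eq_of_polar (hv t) (hθ.polar t))
  exact ⟨T, hT0, fun t => ⟨congrArg Subtype.val (hT t).1, (hT t).2⟩⟩

/-- A brake orbit through a fixed point of `reverseZ` that forms a Hopf link with the planar orbit
satisfies the quarter-period condition, started at a suitable one of its crossings of the plane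
`z = 0`. -/
theorem isQuarterBrake_of_isHopfLink (hη : IsWellSolution V Vr Vz h a b c η)
    (hper : ∃ T > 0, Function.Periodic η T) (hbr : IsBrake η) {B : Set Phase}
    (hB : ∀ x ∈ wellLevel V h a b c, x ∈ B ↔ vertical x = 0)
    (hlink : IsHopfLink (wellLevel V h a b c) (range η) B) {t₀ : ℝ} (h00 : η t₀ 0 = 0)
    (h03 : η t₀ 3 = 0) :
    (0 < η t₀ 1 → IsQuarterBrake κ fun t => η (t + t₀)) ∧
      ∃ s, η s 0 = 0 ∧ η s 3 = 0 ∧ 0 < η s 1 ∧ IsQuarterBrake κ fun t => η (t + s) := by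
  obtain ⟨hv, hT⟩ := W.exists_period_of_isHopfLink hη hper hB hlink
  obtain ⟨θ, hθ⟩ := W.exists_isAngle hη (hv 0)
  obtain ⟨T, hT0, hT⟩ := hT θ hθ
  obtain ⟨t₁, -, -, ⟨h10, h11⟩, -⟩ := hbr
  have hpi := Real.pi_pos
  have hmono := hθ.strictMono W.κ_pos
  have hrefl := W.reflectZ_eq hη h00 h03 h10 h11
  obtain ⟨j, hj⟩ := exists_int_of_vertical_shift hθ hv hrefl
  have hTn : ∀ (n : ℤ) t, θ (t + n * T) = θ t + n * (2 * Real.pi) := by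
    have hp : Function.Periodic (fun t => θ t - t / T * (2 * Real.pi)) T := by
      intro t
      simp only [(hT t).2]
      field_simp
      ring
    intro n t
    have := hp.int_mul n t
    field_simp at this
    refine mul_left_cancel₀ hT0.ne' ?_
    linarith
  have hTp : Function.Periodic η T := fun t => (hT t).1
  -- comparing the advance of the angle, `4 (t₁ - t₀)` is an odd multiple of the period
  have htime : 4 * (t₁ - t₀) = (2 * j + 1) * T := by
    have e1 : θ (0 + 4 * (t₁ - t₀)) = θ 0 + (2 * j + 1) * (2 * Real.pi) := by
      rw [show 0 + 4 * (t₁ - t₀) = 0 + 2 * (t₁ - t₀) + 2 * (t₁ - t₀) by ring, hj, hj]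
      ring
    have e2 := hTn (2 * j + 1) 0
    push_cast at e2
    rw [← e1] at e2
    have := hmono.injective e2
    linarith
  -- so the reflection is the shift by half a period, and the rest points recur after `T / 2`
  have hhalf : ∀ t, η (t + T / 2) = reflectZ (η t) := by
    intro t
    rw [← hrefl t, ← hTp.int_mul j (t + T / 2)]
    congr 1
    linarith
  have hθhalf : ∀ t, θ (t + T / 2) = θ t + Real.pi := by
    intro t
    have e1 := hj t
    have e2 := hTn j (t + T / 2)
    rw [show t + T / 2 + j * T = t + 2 * (t₁ - t₀) by linarith, e1] at e2
    linarith
  have hrest : Function.Periodic (fun t => η t 0 = 0 ∧ η t 1 = 0) (T / 2) := by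
    intro t
    simp [hhalf, reflectZ]
  have hquarter : η (t₀ + T / 4) 0 = 0 ∧ η (t₀ + T / 4) 1 = 0 := by
    have e := hrest.int_mul j (t₀ + T / 4)
    simp only at e
    rw [← e, show t₀ + T / 4 + j * (T / 2) = t₁ by linarith]
    exact ⟨h10, h11⟩
  -- between `s` and `s + T / 2` the angle increases by `π`, so at the rest point `s + T / 4` it has
  -- increased by exactly `π / 2`
  have key : ∀ s, η s 3 = 0 → 0 < η s 1 → η (s + T / 4) 0 = 0 → η (s + T / 4) 1 = 0 →
      IsQuarterBrake κ fun t => η (t + s) := by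
    intro s hs3 hs1 hq0 hq1
    have hn := norm_pos_iff.2 (hv s)
    have e1 := hθ.re_eq s
    have e2 := hθ.im_eq s
    simp only [vertical] at e1 e2 hn
    have hsin : Real.sin (θ s) = 0 := by
      rw [hs3] at e2
      rw [hs3] at hn
      exact (mul_eq_zero.1 e2.symm).resolve_left hn.ne'
    have hcos : 0 < Real.cos (θ s) := by
      rw [e1] at hs1
      exact pos_of_mul_pos_right hs1 (norm_nonneg _)
    have hcos1 : Real.cos (θ s) = 1 := by
      have := Real.sin_sq_add_cos_sq (θ s)
      rw [hsin] at this
      nlinarith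
    obtain ⟨n, hn'⟩ := (Real.cos_eq_one_iff _).1 hcos1
    have hθ' := (hθ.comp_add s).add_two_pi (-n)
    refine ⟨_, hθ', ?_, T / 4, ?_, ?_⟩
    · push_cast
      rw [zero_add, ← hn']
      ring
    · have e3 := hθ'.re_eq (T / 4)
      have hvn := norm_pos_iff.2 (hv (T / 4 + s))
      rw [add_comm] at hq1
      have hre : (vertical (η (T / 4 + s))).re = 0 := hq1
      rw [hre] at e3
      have hc := (mul_eq_zero.1 e3.symm).resolve_left hvn.ne'
      have hlow := hmono (show s < T / 4 + s by linarith)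
      have hhigh := hmono (show T / 4 + s < s + T / 2 by linarith)
      rw [hθhalf, ← hn'] at hhigh
      rw [← hn'] at hlow
      push_cast at hc ⊢
      set φ := θ (T / 4 + s) + 2 * Real.pi * -n with hφ
      have hφ0 : 0 < φ := by rw [hφ]; linarith
      have hφ1 : φ < Real.pi := by rw [hφ]; linarith
      have := Real.cos_pi_div_two
      exact Real.injOn_cos ⟨hφ0.le, hφ1.le⟩ ⟨by linarith, by linarith⟩ (hc.trans this.symm)
    · rwa [add_comm] at hq0
  refine ⟨fun h01 => key t₀ h03 h01 hquarter.1 hquarter.2, ?_⟩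
  -- if `p_z(t₀) < 0`, start half a period later
  rcases lt_trichotomy (η t₀ 1) 0 with h1 | h1 | h1
  · have e := hhalf t₀
    have e0 : η (t₀ + T / 2) 0 = 0 := by rw [e]; simpa [reflectZ] using h00
    have e1 : 0 < η (t₀ + T / 2) 1 := by rw [e]; simpa [reflectZ] using h1
    have e3 : η (t₀ + T / 2) 3 = 0 := by rw [e]; simpa [reflectZ] using h03
    have e4 : t₀ + T / 2 + T / 4 = t₀ + T / 4 + T / 2 := by ring
    refine ⟨t₀ + T / 2, e0, e3, e1, key _ e3 e1 ?_ ?_⟩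
    · rw [e4, hhalf]; simpa [reflectZ] using hquarter.1
    · rw [e4, hhalf]; simpa [reflectZ] using hquarter.2
  · exact absurd ((vertical_eq_zero_iff _).2 ⟨h1, h03⟩) (hv t₀)
  · exact ⟨t₀, h00, h03, h1, key t₀ h03 h1 hquarter.1 hquarter.2⟩

end

end HillFlow

/-! ### Perturbations in cylindrical coordinates -/

/-- The domain `r > 0`, `0 ≤ ε < 1` of the triples `(r, z, ε)`. -/
def cylDomain : Set (ℝ × ℝ × ℝ) := Ioi 0 ×ˢ (univ ×ˢ Ico 0 1)

theorem convex_cylDomain : Convex ℝ cylDomain :=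
  (convex_Ioi 0).prod (convex_univ.prod (convex_Ico 0 1))

theorem uniqueDiffOn_cylDomain : UniqueDiffOn ℝ cylDomain :=
  (uniqueDiffOn_Ioi 0).prod (uniqueDiffOn_univ.prod (uniqueDiffOn_Ico 0 1))

/-- The function `fh(r, z, ε)` is even in `z` and has the partial derivatives `fr` and `fz` with
respect to `r` and `z`; all three are `C¹` jointly in `(r, z, ε)`, up to `ε = 0`. -/
structure IsAxialPerturbation (fh fr fz : ℝ → ℝ → ℝ → ℝ) : Prop where
  contDiffOn : ContDiffOn ℝ 1 (fun q : ℝ × ℝ × ℝ => fh q.1 q.2.1 q.2.2) cylDomain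
  contDiffOn_r : ContDiffOn ℝ 1 (fun q : ℝ × ℝ × ℝ => fr q.1 q.2.1 q.2.2) cylDomain
  contDiffOn_z : ContDiffOn ℝ 1 (fun q : ℝ × ℝ × ℝ => fz q.1 q.2.1 q.2.2) cylDomain
  hasFDerivAt : ∀ r > 0, ∀ z, ∀ ε ∈ Ico (0 : ℝ) 1,
    HasFDerivAt (fun p : ℝ × ℝ => fh p.1 p.2 ε)
      (fr r z ε • ContinuousLinearMap.fst ℝ ℝ ℝ + fz r z ε • ContinuousLinearMap.snd ℝ ℝ ℝ) (r, z)
  even : ∀ r > 0, ∀ z, ∀ ε ∈ Ico (0 : ℝ) 1, fh r (-z) ε = fh r z ε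

/-- The half-plane `{(r, 0, z) : r > 0}` avoids the origin, where the perturbation may be singular;
the derivatives are taken within the domain, which includes its boundary `ε = 0`. -/
theorem IsSymmetricPerturbation.exists_isAxialPerturbation
    {f : EuclideanSpace ℝ (Fin 3) → ℝ → ℝ} (hf : IsSymmetricPerturbation f) :
    ∃ fr fz, IsAxialPerturbation (fun r z ε => f !₂[r, 0, z] ε) fr fz := by
  set g : ℝ × ℝ × ℝ → ℝ := fun q => f !₂[q.1, 0, q.2.1] q.2.2 with hg
  have hne : ∀ r > 0, ∀ z, !₂[r, 0, z] ≠ (0 : EuclideanSpace ℝ (Fin 3)) := fun r hr z h =>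
    hr.ne' (congrArg (fun x : EuclideanSpace ℝ (Fin 3) => x 0) h)
  have hgs : ContDiffOn ℝ ((⊤ : ℕ∞) : WithTop ℕ∞) g cylDomain := by
    refine hf.smooth.comp (f := fun q : ℝ × ℝ × ℝ =>
      ((!₂[q.1, 0, q.2.1] : EuclideanSpace ℝ (Fin 3)), q.2.2)) ?_ fun q hq => ?_
    · refine ContDiff.contDiffOn (ContDiff.prodMk ?_ (by fun_prop))
      rw [contDiff_euclidean]
      intro i
      fin_cases i
      · simpa using contDiff_fst
      · simpa using contDiff_const
      · simpa using contDiff_snd.fst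
    · exact ⟨hne _ hq.1 _, hq.2.2⟩
  have hd : ContDiffOn ℝ 1 (fderivWithin ℝ g cylDomain) cylDomain :=
    hgs.fderivWithin uniqueDiffOn_cylDomain (by norm_cast)
  refine ⟨fun r z ε => fderivWithin ℝ g cylDomain (r, z, ε) (1, 0, 0),
    fun r z ε => fderivWithin ℝ g cylDomain (r, z, ε) (0, 1, 0), ?_, ?_, ?_, ?_, ?_⟩
  · exact hgs.of_le (by norm_cast)
  · exact hd.clm_apply contDiffOn_const
  · exact hd.clm_apply contDiffOn_const
  · intro r hr z ε hε
    have h1 : HasFDerivWithinAt g (fderivWithin ℝ g cylDomain (r, z, ε)) cylDomain (r, z, ε) :=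
      ((hgs.differentiableOn (by norm_num)) (r, z, ε)
        (show (r, z, ε) ∈ cylDomain from ⟨hr, trivial, hε⟩)).hasFDerivWithinAt
    have h2 : HasFDerivAt (fun p : ℝ × ℝ => (p.1, p.2, ε))
        ((ContinuousLinearMap.fst ℝ ℝ ℝ).prod ((ContinuousLinearMap.snd ℝ ℝ ℝ).prod 0)) (r, z) :=
      hasFDerivAt_fst.prodMk (hasFDerivAt_snd.prodMk (hasFDerivAt_const ε _))
    have hmaps : MapsTo (fun p : ℝ × ℝ => (p.1, p.2, ε)) (Ioi 0 ×ˢ univ) cylDomain :=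
      fun p hp => ⟨hp.1, trivial, hε⟩
    have h3 := (h1.comp (r, z) h2.hasFDerivWithinAt hmaps).hasFDerivAt
        ((isOpen_Ioi.prod isOpen_univ).mem_nhds
          (show (r, z) ∈ Ioi (0 : ℝ) ×ˢ (univ : Set ℝ) from ⟨hr, trivial⟩))
    refine HasFDerivAt.congr_fderiv h3 (ContinuousLinearMap.ext fun p => ?_)
    have e : (p.1, p.2, (0 : ℝ)) = p.1 • ((1 : ℝ), (0 : ℝ), (0 : ℝ)) + p.2 • (0, 1, 0) := by simp
    have e2 := congrArg (fderivWithin ℝ g cylDomain (r, z, ε)) e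
    rw [map_add, map_smul, map_smul] at e2
    simpa [mul_comm] using e2
  · intro r hr z ε hε
    exact hf.reflection r 0 z ε hε (hne r hr z)

namespace IsAxialPerturbation

variable {fh fr fz : ℝ → ℝ → ℝ → ℝ} (A : IsAxialPerturbation fh fr fz) {r z ε : ℝ}
include A

theorem hasDerivAt_r (hr : 0 < r) (hε : ε ∈ Ico (0 : ℝ) 1) :
    HasDerivAt (fun r => fh r z ε) (fr r z ε) r := by
  have h1 : HasDerivAt (fun r : ℝ => (r, z)) ((1 : ℝ), (0 : ℝ)) r :=
    (hasDerivAt_id r).prodMk (hasDerivAt_const r z)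
  have := (A.hasFDerivAt r hr z ε hε).comp_hasDerivAt r h1
  simpa [Function.comp_def] using this

theorem hasDerivAt_z (hr : 0 < r) (hε : ε ∈ Ico (0 : ℝ) 1) :
    HasDerivAt (fun z => fh r z ε) (fz r z ε) z := by
  have h1 : HasDerivAt (fun z : ℝ => (r, z)) ((0 : ℝ), (1 : ℝ)) z :=
    (hasDerivAt_const z r).prodMk (hasDerivAt_id z)
  have := (A.hasFDerivAt r hr z ε hε).comp_hasDerivAt z h1
  simpa [Function.comp_def] using this

theorem even_r (hr : 0 < r) (hε : ε ∈ Ico (0 : ℝ) 1) : fr r (-z) ε = fr r z ε := by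
  refine (A.hasDerivAt_r hr hε).unique ((A.hasDerivAt_r (z := z) hr hε).congr_of_eventuallyEq ?_)
  filter_upwards [isOpen_Ioi.mem_nhds hr] with s hs
  exact A.even s hs z ε hε

theorem odd_z (hr : 0 < r) (hε : ε ∈ Ico (0 : ℝ) 1) : fz r (-z) ε = -fz r z ε := by
  have h1 : HasDerivAt (fun z => fh r z ε) (-fz r z ε) (-z) := by
    have := (A.hasDerivAt_z (z := - -z) hr hε).scomp (-z) (hasDerivAt_neg (-z))
    simp only [neg_neg, smul_eq_mul, neg_mul, one_mul] at this
    refine this.congr_of_eventuallyEq (Eventually.of_forall fun s => ?_)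
    exact (A.even r hr s ε hε).symm
  exact (A.hasDerivAt_z hr hε).unique h1

theorem z_zero (hr : 0 < r) (hε : ε ∈ Ico (0 : ℝ) 1) : fz r 0 ε = 0 := by
  have := A.odd_z (z := 0) hr hε
  rw [neg_zero] at this
  linarith

end IsAxialPerturbation

/-- A `C¹` function on a convex set is bounded and Lipschitz on its compact subsets. -/
theorem ContDiffOn.exists_bound_lipschitz {E F : Type*} [NormedAddCommGroup E] [NormedSpace ℝ E]
    [NormedAddCommGroup F] [NormedSpace ℝ F] {g : E → F} {S B : Set E} (hg : ContDiffOn ℝ 1 g S)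
    (hS : Convex ℝ S) (hB : IsCompact B) (hBS : B ⊆ S) :
    ∃ K : ℝ, 0 < K ∧ (∀ x ∈ B, ‖g x‖ ≤ K) ∧ ∀ x ∈ B, ∀ y ∈ B, ‖g x - g y‖ ≤ K * ‖x - y‖ := by
  have h1 : LocallyLipschitzOn S g := fun x hx => by
    obtain ⟨K, t, ht, hK⟩ := (hg x hx).exists_lipschitzOnWith hS
    exact ⟨K, t, ht, hK⟩
  obtain ⟨K, hK⟩ := (h1.mono hBS).exists_lipschitzOnWith_of_compact hB
  obtain ⟨C, hC⟩ := hB.exists_bound_of_continuousOn (hg.continuousOn.mono hBS)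
  refine ⟨max 1 (max K C), by positivity, fun x hx => (hC x hx).trans (by simp),
    fun x hx y hy => ?_⟩
  have := hK.dist_le_mul x hx y hy
  rw [dist_eq_norm, dist_eq_norm] at this
  exact this.trans (mul_le_mul_of_nonneg_right (by simp) (norm_nonneg _))

/-! ### The perturbed Kepler potential -/

/-- The effective potential `V(r, z)` of the reduced system. -/
noncomputable def keplerV (fh : ℝ → ℝ → ℝ → ℝ) (ω ε r z : ℝ) : ℝ :=
  ω ^ 2 / (2 * r ^ 2) - 1 / √(r ^ 2 + z ^ 2) + ε * fh r z ε

/-- The partial derivative `∂V/∂r`. -/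
noncomputable def keplerVr (fr : ℝ → ℝ → ℝ → ℝ) (ω ε r z : ℝ) : ℝ :=
  -(ω ^ 2 / r ^ 3) + r / √(r ^ 2 + z ^ 2) ^ 3 + ε * fr r z ε

/-- The partial derivative `∂V/∂z`. -/
noncomputable def keplerVz (fz : ℝ → ℝ → ℝ → ℝ) (ε r z : ℝ) : ℝ :=
  z / √(r ^ 2 + z ^ 2) ^ 3 + ε * fz r z ε

theorem reducedHamiltonian_eq (f : EuclideanSpace ℝ (Fin 3) → ℝ → ℝ) (ω ε : ℝ) :
    reducedHamiltonian f ω ε = wellEnergy (keplerV (fun r z ε => f !₂[r, 0, z] ε) ω ε) := by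
  funext x
  simp only [reducedHamiltonian, wellEnergy, keplerV]
  ring

theorem hasGradientAt_wellEnergy {V : ℝ → ℝ → ℝ} {x : Phase} {vr vz : ℝ}
    (hV : HasFDerivAt (fun p : ℝ × ℝ => V p.1 p.2)
      (vr • ContinuousLinearMap.fst ℝ ℝ ℝ + vz • ContinuousLinearMap.snd ℝ ℝ ℝ) (x 2, x 3)) :
    HasGradientAt (wellEnergy V) !₂[x 0, x 1, vr, vz] x := by
  have hp : ∀ i : Fin 4, HasFDerivAt (fun y : Phase => y i) (EuclideanSpace.proj (𝕜 := ℝ) i) x :=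
    fun i => (EuclideanSpace.proj (𝕜 := ℝ) i).hasFDerivAt
  have h1 := ((((hp 0).pow 2).add ((hp 1).pow 2)).mul_const (1 / 2 : ℝ)).add
    (HasFDerivAt.comp x (g := fun p : ℝ × ℝ => V p.1 p.2) hV ((hp 2).prodMk (hp 3)))
  rw [hasGradientAt_iff_hasFDerivAt]
  have h2 : wellEnergy V = fun y : Phase => ((y 0) ^ 2 + (y 1) ^ 2) * (1 / 2) + V (y 2) (y 3) := by
    funext y
    simp only [wellEnergy]
    ring
  rw [h2]
  refine HasFDerivAt.congr_fderiv h1 (ContinuousLinearMap.ext fun v => ?_)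
  simp [PiLp.inner_apply, Fin.sum_univ_four]
  ring

theorem hamiltonianField_eq {f : EuclideanSpace ℝ (Fin 3) → ℝ → ℝ} {fr fz : ℝ → ℝ → ℝ → ℝ}
    {ω ε : ℝ} {x : Phase}
    (hV : HasFDerivAt (fun p : ℝ × ℝ => keplerV (fun r z ε => f !₂[r, 0, z] ε) ω ε p.1 p.2)
      (keplerVr fr ω ε (x 2) (x 3) • ContinuousLinearMap.fst ℝ ℝ ℝ +
        keplerVz fz ε (x 2) (x 3) • ContinuousLinearMap.snd ℝ ℝ ℝ) (x 2, x 3)) :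
    hamiltonianField f ω ε x = wellField (keplerVr fr ω ε) (keplerVz fz ε) x := by
  simp only [hamiltonianField, reducedHamiltonian_eq, (hasGradientAt_wellEnergy hV).gradient,
    wellField]
  simp

theorem sq_add_sq_pos {r : ℝ} (hr : 0 < r) (z : ℝ) : 0 < r ^ 2 + z ^ 2 := by positivity

namespace IsAxialPerturbation

variable {fh fr fz : ℝ → ℝ → ℝ → ℝ} (A : IsAxialPerturbation fh fr fz) {ω r z ε : ℝ}
include A

theorem hasFDerivAt_keplerV (hr : 0 < r) (hε : ε ∈ Ico (0 : ℝ) 1) :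
    HasFDerivAt (fun p : ℝ × ℝ => keplerV fh ω ε p.1 p.2)
      (keplerVr fr ω ε r z • ContinuousLinearMap.fst ℝ ℝ ℝ +
        keplerVz fz ε r z • ContinuousLinearMap.snd ℝ ℝ ℝ) (r, z) := by
  have hD := sq_add_sq_pos hr z
  have h1 : HasDerivAt (fun r : ℝ => ω ^ 2 / (2 * r ^ 2)) (-(ω ^ 2 / r ^ 3)) r := by
    have := (hasDerivAt_const r (ω ^ 2)).div ((hasDerivAt_pow 2 r).const_mul 2)
      (by positivity)
    refine this.congr_deriv ?_
    field_simp
    ring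
  have h2 : HasDerivAt (fun s : ℝ => 1 / √s) (-(1 / (2 * √(r ^ 2 + z ^ 2) ^ 3)))
      (r ^ 2 + z ^ 2) := by
    have := (hasDerivAt_const (r ^ 2 + z ^ 2) (1 : ℝ)).div (Real.hasDerivAt_sqrt hD.ne')
      (Real.sqrt_pos.2 hD).ne'
    refine this.congr_deriv ?_
    have := Real.sqrt_pos.2 hD
    field_simp
    ring
  have h3 : HasFDerivAt (fun p : ℝ × ℝ => p.1) (ContinuousLinearMap.fst ℝ ℝ ℝ) (r, z) :=
    hasFDerivAt_fst
  have h4 : HasFDerivAt (fun p : ℝ × ℝ => p.2) (ContinuousLinearMap.snd ℝ ℝ ℝ) (r, z) :=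
    hasFDerivAt_snd
  have h5 := ((h1.comp_hasFDerivAt (r, z) h3).sub (HasDerivAt.comp_hasFDerivAt (r, z)
    (h₂ := fun s : ℝ => 1 / √s) (f := fun p : ℝ × ℝ => p.1 ^ 2 + p.2 ^ 2) h2
    ((h3.pow 2).add (h4.pow 2)))).add ((A.hasFDerivAt r hr z ε hε).const_mul ε)
  refine HasFDerivAt.congr_fderiv h5 (ContinuousLinearMap.ext fun v => ?_)
  have := Real.sqrt_pos.2 hD
  simp [keplerVr, keplerVz]
  field_simp
  ring

theorem hasDerivAt_keplerV_r (hr : 0 < r) (hε : ε ∈ Ico (0 : ℝ) 1) :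
    HasDerivAt (fun r => keplerV fh ω ε r z) (keplerVr fr ω ε r z) r := by
  have h1 : HasDerivAt (fun r : ℝ => (r, z)) ((1 : ℝ), (0 : ℝ)) r :=
    (hasDerivAt_id r).prodMk (hasDerivAt_const r z)
  have := (A.hasFDerivAt_keplerV (ω := ω) (z := z) hr hε).comp_hasDerivAt r h1
  simpa [Function.comp_def] using this

end IsAxialPerturbation

/-! ### Smoothness and bounds on compact boxes -/

/-- Points of phase space together with the parameters `(ω, ε)`. -/
abbrev ParamPhase : Type := Phase × (ℝ × ℝ)

/-- The domain `r > 0`, `0 ≤ ε < 1`. -/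
def phaseDomain : Set ParamPhase := {y | 0 < y.1 2 ∧ y.2.2 ∈ Ico (0 : ℝ) 1}

theorem convex_phaseDomain : Convex ℝ phaseDomain := by
  have h1 : Convex ℝ {y : ParamPhase | 0 < y.1 2} :=
    convex_halfSpace_gt (f := fun y : ParamPhase => y.1 2)
      ⟨fun _ _ => by simp, fun _ _ => by simp⟩ 0
  have h2 : Convex ℝ {y : ParamPhase | 0 ≤ y.2.2} :=
    convex_halfSpace_ge (f := fun y : ParamPhase => y.2.2)
      ⟨fun _ _ => by simp, fun _ _ => by simp⟩ 0
  have h3 : Convex ℝ {y : ParamPhase | y.2.2 < 1} :=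
    convex_halfSpace_lt (f := fun y : ParamPhase => y.2.2)
      ⟨fun _ _ => by simp, fun _ _ => by simp⟩ 1
  exact h1.inter (h2.inter h3)

/-- The component `p_z (L² - D) + z (r p_r + z p_z) / D` along the axis of the vector `L × A`, where
`L` and `A` are the angular momentum and the Laplace–Runge–Lenz vector of the unreduced Kepler
problem and `D = √(r² + z²)`. It is a first integral for `ε = 0`. -/
noncomputable def keplerIntegral (ω : ℝ) (x : Phase) : ℝ :=
  x 1 * ((x 3 * x 0 - x 2 * x 1) ^ 2 + ω ^ 2 * (1 + (x 3) ^ 2 / (x 2) ^ 2)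
    - √((x 2) ^ 2 + (x 3) ^ 2)) + x 3 * (x 2 * x 0 + x 3 * x 1) / √((x 2) ^ 2 + (x 3) ^ 2)

/-- Along solutions of the perturbed system, `keplerIntegral` has the derivative
`-ε * keplerDrift`. -/
noncomputable def keplerDrift (fr fz : ℝ → ℝ → ℝ → ℝ) (ω ε : ℝ) (x : Phase) : ℝ :=
  fz (x 2) (x 3) ε * ((x 3 * x 0 - x 2 * x 1) ^ 2 + ω ^ 2 * (1 + (x 3) ^ 2 / (x 2) ^ 2)
      - √((x 2) ^ 2 + (x 3) ^ 2))
    + 2 * x 1 * (x 3 * x 0 - x 2 * x 1) * (x 3 * fr (x 2) (x 3) ε - x 2 * fz (x 2) (x 3) ε)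
    + x 3 * (x 2 * fr (x 2) (x 3) ε + x 3 * fz (x 2) (x 3) ε) / √((x 2) ^ 2 + (x 3) ^ 2)

section
variable {n : WithTop ℕ∞}

theorem contDiff_phase_coord (i : Fin 4) : ContDiff ℝ n fun y : ParamPhase => y.1 i :=
  (EuclideanSpace.proj (𝕜 := ℝ) i).contDiff.comp contDiff_fst

theorem contDiffOn_dist_axis :
    ContDiffOn ℝ n (fun y : ParamPhase => √((y.1 2) ^ 2 + (y.1 3) ^ 2)) phaseDomain :=
  ContDiffOn.sqrt (((contDiff_phase_coord 2).pow 2).add ((contDiff_phase_coord 3).pow 2)).contDiffOn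
    fun _ hy => (sq_add_sq_pos hy.1 _).ne'

theorem contDiffOn_keplerIntegral :
    ContDiffOn ℝ n (fun y : ParamPhase => keplerIntegral y.2.1 y.1) phaseDomain := by
  have h0 := (contDiff_phase_coord (n := n) 0).contDiffOn (s := phaseDomain)
  have h1 := (contDiff_phase_coord (n := n) 1).contDiffOn (s := phaseDomain)
  have h2 := (contDiff_phase_coord (n := n) 2).contDiffOn (s := phaseDomain)
  have h3 := (contDiff_phase_coord (n := n) 3).contDiffOn (s := phaseDomain)
  have hω : ContDiffOn ℝ n (fun y : ParamPhase => y.2.1) phaseDomain := contDiff_snd.fst.contDiffOn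
  have hD := contDiffOn_dist_axis (n := n)
  exact (h1.mul (((((h3.mul h0).sub (h2.mul h1)).pow 2).add ((hω.pow 2).mul (contDiffOn_const.add
    ((h3.pow 2).div (h2.pow 2) fun y hy => (pow_pos hy.1 2).ne')))).sub hD)).add
    ((h3.mul ((h2.mul h0).add (h3.mul h1))).div hD
      fun y hy => (Real.sqrt_pos.2 (sq_add_sq_pos hy.1 _)).ne')

end

theorem comp_cylinder {g : ℝ → ℝ → ℝ → ℝ}
    (hg : ContDiffOn ℝ 1 (fun q : ℝ × ℝ × ℝ => g q.1 q.2.1 q.2.2) cylDomain) :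
    ContDiffOn ℝ 1 (fun y : ParamPhase => g (y.1 2) (y.1 3) y.2.2) phaseDomain :=
  hg.comp (f := fun y : ParamPhase => (y.1 2, y.1 3, y.2.2))
    (((contDiff_phase_coord 2).prodMk ((contDiff_phase_coord 3).prodMk
      contDiff_snd.snd)).contDiffOn) fun _ hy => ⟨hy.1, trivial, hy.2⟩

namespace IsAxialPerturbation

variable {fh fr fz : ℝ → ℝ → ℝ → ℝ} (A : IsAxialPerturbation fh fr fz)
include A

theorem contDiffOn_keplerDrift :
    ContDiffOn ℝ 1 (fun y : ParamPhase => keplerDrift fr fz y.2.1 y.2.2 y.1) phaseDomain := by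
  have h0 := (contDiff_phase_coord (n := 1) 0).contDiffOn (s := phaseDomain)
  have h1 := (contDiff_phase_coord (n := 1) 1).contDiffOn (s := phaseDomain)
  have h2 := (contDiff_phase_coord (n := 1) 2).contDiffOn (s := phaseDomain)
  have h3 := (contDiff_phase_coord (n := 1) 3).contDiffOn (s := phaseDomain)
  have hω : ContDiffOn ℝ 1 (fun y : ParamPhase => y.2.1) phaseDomain := contDiff_snd.fst.contDiffOn
  have hD := contDiffOn_dist_axis (n := 1)
  have hr := comp_cylinder A.contDiffOn_r
  have hz := comp_cylinder A.contDiffOn_z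
  have hm := (h3.mul h0).sub (h2.mul h1)
  exact ((hz.mul (((hm.pow 2).add ((hω.pow 2).mul (contDiffOn_const.add
    ((h3.pow 2).div (h2.pow 2) fun y hy => (pow_pos hy.1 2).ne')))).sub hD)).add
    (((contDiffOn_const.mul h1).mul hm).mul ((h3.mul hr).sub (h2.mul hz)))).add
    ((h3.mul ((h2.mul hr).add (h3.mul hz))).div hD
      fun y hy => (Real.sqrt_pos.2 (sq_add_sq_pos hy.1 _)).ne')

theorem contDiffOn_keplerV :
    ContDiffOn ℝ 1 (fun y : ParamPhase => keplerV fh y.2.1 y.2.2 (y.1 2) (y.1 3)) phaseDomain := by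
  have h2 := (contDiff_phase_coord (n := 1) 2).contDiffOn (s := phaseDomain)
  have hω : ContDiffOn ℝ 1 (fun y : ParamPhase => y.2.1) phaseDomain := contDiff_snd.fst.contDiffOn
  have hε : ContDiffOn ℝ 1 (fun y : ParamPhase => y.2.2) phaseDomain := contDiff_snd.snd.contDiffOn
  exact (((hω.pow 2).div (contDiffOn_const.mul (h2.pow 2))
    fun y hy => (mul_pos two_pos (pow_pos hy.1 2)).ne').sub
    (contDiffOn_const.div contDiffOn_dist_axis
      fun y hy => (Real.sqrt_pos.2 (sq_add_sq_pos hy.1 _)).ne')).add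
    (hε.mul (comp_cylinder A.contDiffOn))

theorem contDiffOn_keplerVr :
    ContDiffOn ℝ 1 (fun y : ParamPhase => keplerVr fr y.2.1 y.2.2 (y.1 2) (y.1 3))
      phaseDomain := by
  have h2 := (contDiff_phase_coord (n := 1) 2).contDiffOn (s := phaseDomain)
  have hω : ContDiffOn ℝ 1 (fun y : ParamPhase => y.2.1) phaseDomain := contDiff_snd.fst.contDiffOn
  have hε : ContDiffOn ℝ 1 (fun y : ParamPhase => y.2.2) phaseDomain := contDiff_snd.snd.contDiffOn
  exact (((hω.pow 2).div (h2.pow 3) fun y hy => (pow_pos hy.1 3).ne').neg.add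
    (h2.div (contDiffOn_dist_axis.pow 3)
      fun y hy => (pow_pos (Real.sqrt_pos.2 (sq_add_sq_pos hy.1 _)) 3).ne')).add
    (hε.mul (comp_cylinder A.contDiffOn_r))

theorem contDiffOn_keplerVz :
    ContDiffOn ℝ 1 (fun y : ParamPhase => keplerVz fz y.2.2 (y.1 2) (y.1 3))
      phaseDomain := by
  have h3 := (contDiff_phase_coord (n := 1) 3).contDiffOn (s := phaseDomain)
  have hε : ContDiffOn ℝ 1 (fun y : ParamPhase => y.2.2) phaseDomain := contDiff_snd.snd.contDiffOn
  exact (h3.div (contDiffOn_dist_axis.pow 3)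
      fun y hy => (pow_pos (Real.sqrt_pos.2 (sq_add_sq_pos hy.1 _)) 3).ne').add
    (hε.mul (comp_cylinder A.contDiffOn_z))

theorem contDiffOn_field :
    ContDiffOn ℝ 1 (fun y : ParamPhase => wellField (keplerVr fr y.2.1 y.2.2) (keplerVz fz y.2.2)
      y.1) phaseDomain := by
  rw [contDiffOn_euclidean]
  intro i
  fin_cases i
  · exact A.contDiffOn_keplerVr.neg
  · exact A.contDiffOn_keplerVz.neg
  · exact (contDiff_phase_coord 0).contDiffOn
  · exact (contDiff_phase_coord 1).contDiffOn

end IsAxialPerturbation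

/-- The box of the points `x` with `lo i ≤ x i ≤ hi i`. -/
def coordBox (lo hi : Fin 4 → ℝ) : Set Phase := {x | ∀ i, x i ∈ Icc (lo i) (hi i)}

/-- The coordinatewise nearest-point projection onto `coordBox lo hi`. -/
noncomputable def clampBox (lo hi : Fin 4 → ℝ) (x : Phase) : Phase :=
  WithLp.toLp 2 fun i => max (lo i) (min (hi i) (x i))

theorem isCompact_coordBox (lo hi : Fin 4 → ℝ) : IsCompact (coordBox lo hi) := by
  have h1 : IsCompact (Set.pi univ fun i => Icc (lo i) (hi i)) :=
    isCompact_univ_pi fun i => isCompact_Icc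
  have h2 := h1.image (PiLp.continuous_toLp 2 fun _ : Fin 4 => ℝ)
  convert h2 using 1
  ext x
  constructor
  · intro hx
    exact ⟨fun i => x i, fun i _ => hx i, rfl⟩
  · rintro ⟨y, hy, rfl⟩ i
    exact hy i trivial

theorem clampBox_mem {lo hi : Fin 4 → ℝ} (h : ∀ i, lo i ≤ hi i) (x : Phase) :
    clampBox lo hi x ∈ coordBox lo hi := fun i =>
  ⟨le_max_left _ _, max_le (h i) (min_le_left _ _)⟩

theorem clampBox_eq_self {lo hi : Fin 4 → ℝ} {x : Phase} (hx : x ∈ coordBox lo hi) :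
    clampBox lo hi x = x := by
  ext i
  simp [clampBox, (hx i).1, (hx i).2]

theorem norm_clampBox_sub_le (lo hi : Fin 4 → ℝ) (x y : Phase) :
    ‖clampBox lo hi x - clampBox lo hi y‖ ≤ ‖x - y‖ := by
  rw [EuclideanSpace.norm_eq, EuclideanSpace.norm_eq]
  refine Real.sqrt_le_sqrt (Finset.sum_le_sum fun i _ => ?_)
  simp only [PiLp.sub_apply, Real.norm_eq_abs, sq_abs]
  rw [sq_le_sq]
  refine (abs_max_sub_max_le_max _ _ _ _).trans ?_
  rw [sub_self, abs_zero, max_eq_right (abs_nonneg _)]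
  refine (abs_min_sub_min_le_max _ _ _ _).trans ?_
  rw [sub_self, abs_zero, max_eq_right (abs_nonneg _)]

/-- Lower corner of the box of phase points considered for `r₁ ≤ r ≤ R`, `|z| ≤ R`; the bound on
the momenta follows from conservation of energy. -/
noncomputable def boxLo (r₁ R : ℝ) : Fin 4 → ℝ := ![-(2 / r₁ + 2), -(2 / r₁ + 2), r₁, -R]

/-- Upper corner of the box of phase points. -/
noncomputable def boxHi (r₁ R : ℝ) : Fin 4 → ℝ := ![2 / r₁ + 2, 2 / r₁ + 2, R, R]

/-- The box of phase points considered for `r₁ ≤ r ≤ R`, `|z| ≤ R`. -/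
def phaseBox (r₁ R : ℝ) : Set Phase := coordBox (boxLo r₁ R) (boxHi r₁ R)

/-- The range of the parameters `(ω, ε)`. -/
def paramBox (R : ℝ) : Set (ℝ × ℝ) := Icc (-(R + 1)) (R + 1) ×ˢ Icc 0 (1 / 2)

theorem mem_phaseBox_iff {r₁ R : ℝ} {x : Phase} : x ∈ phaseBox r₁ R ↔
    |x 0| ≤ 2 / r₁ + 2 ∧ |x 1| ≤ 2 / r₁ + 2 ∧ x 2 ∈ Icc r₁ R ∧ x 3 ∈ Icc (-R) R := by
  simp only [phaseBox, coordBox, mem_ofPred_eq, Fin.forall_fin_succ, boxLo, boxHi, abs_le, mem_Icc]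
  simp

/-- Bounds and Lipschitz constants for the perturbed Kepler problem on the box of the phase points
with `r₁ ≤ r ≤ R`, `|z| ≤ R`, with one constant `K` for all the functions involved. -/
structure KeplerBox (fh fr fz : ℝ → ℝ → ℝ → ℝ) (r₁ R K : ℝ) : Prop
    extends IsAxialPerturbation fh fr fz where
  r₁_pos : 0 < r₁
  R_pos : 0 < R
  one_le : 1 ≤ K
  bound_h : ∀ r ∈ Icc r₁ R, ∀ z ∈ Icc (-R) R, ∀ ε ∈ Icc (0 : ℝ) (1 / 2), |fh r z ε| ≤ K
  bound_r : ∀ r ∈ Icc r₁ R, ∀ z ∈ Icc (-R) R, ∀ ε ∈ Icc (0 : ℝ) (1 / 2), |fr r z ε| ≤ K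
  bound_z : ∀ r ∈ Icc r₁ R, ∀ z ∈ Icc (-R) R, ∀ ε ∈ Icc (0 : ℝ) (1 / 2), |fz r z ε| ≤ K * |z|
  lip_h : ∀ r ∈ Icc r₁ R, ∀ s ∈ Icc r₁ R, ∀ ε ∈ Icc (0 : ℝ) (1 / 2),
    |fh r 0 ε - fh s 0 ε| ≤ K * |r - s|
  lip_r : ∀ r ∈ Icc r₁ R, ∀ s ∈ Icc r₁ R, ∀ ε ∈ Icc (0 : ℝ) (1 / 2),
    |fr r 0 ε - fr s 0 ε| ≤ K * |r - s|
  lip_V : ∀ y ∈ phaseBox r₁ R ×ˢ paramBox R, ∀ y' ∈ phaseBox r₁ R ×ˢ paramBox R,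
    |keplerV fh y.2.1 y.2.2 (y.1 2) (y.1 3) - keplerV fh y'.2.1 y'.2.2 (y'.1 2) (y'.1 3)| ≤
      K * ‖y - y'‖
  bound_field : ∀ y ∈ phaseBox r₁ R ×ˢ paramBox R,
    ‖wellField (keplerVr fr y.2.1 y.2.2) (keplerVz fz y.2.2) y.1‖ ≤ K
  lip_field : ∀ y ∈ phaseBox r₁ R ×ˢ paramBox R, ∀ y' ∈ phaseBox r₁ R ×ˢ paramBox R,
    ‖wellField (keplerVr fr y.2.1 y.2.2) (keplerVz fz y.2.2) y.1 -
      wellField (keplerVr fr y'.2.1 y'.2.2) (keplerVz fz y'.2.2) y'.1‖ ≤ K * ‖y - y'‖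
  lip_integral : ∀ y ∈ phaseBox r₁ R ×ˢ paramBox R, ∀ y' ∈ phaseBox r₁ R ×ˢ paramBox R,
    |keplerIntegral y.2.1 y.1 - keplerIntegral y'.2.1 y'.1| ≤ K * ‖y - y'‖
  bound_drift : ∀ y ∈ phaseBox r₁ R ×ˢ paramBox R, |keplerDrift fr fz y.2.1 y.2.2 y.1| ≤ K
  lip_drift : ∀ y ∈ phaseBox r₁ R ×ˢ paramBox R, ∀ y' ∈ phaseBox r₁ R ×ˢ paramBox R,
    |keplerDrift fr fz y.2.1 y.2.2 y.1 - keplerDrift fr fz y'.2.1 y'.2.2 y'.1| ≤ K * ‖y - y'‖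

theorem norm_triple_sub_le (r s z w ε : ℝ) :
    ‖((r, z, ε) : ℝ × ℝ × ℝ) - (s, w, ε)‖ = max |r - s| |z - w| := by
  simp [Prod.norm_def]

/-- All the bounds come from compactness of the boxes. As `fz` is odd in `z`, its Lipschitz constant
also gives `|fz| ≤ K |z|`. -/
theorem IsAxialPerturbation.exists_keplerBox {fh fr fz : ℝ → ℝ → ℝ → ℝ}
    (A : IsAxialPerturbation fh fr fz) {r₁ R : ℝ} (hr₁ : 0 < r₁) (hR : 0 < R) :
    ∃ K, KeplerBox fh fr fz r₁ R K := by
  have hC : IsCompact (Icc r₁ R ×ˢ Icc (-R) R ×ˢ Icc (0 : ℝ) (1 / 2)) :=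
    isCompact_Icc.prod (isCompact_Icc.prod isCompact_Icc)
  have hCS : Icc r₁ R ×ˢ Icc (-R) R ×ˢ Icc (0 : ℝ) (1 / 2) ⊆ cylDomain := fun q hq =>
    ⟨hr₁.trans_le hq.1.1, trivial, hq.2.2.1, hq.2.2.2.trans_lt (by norm_num)⟩
  have hB : IsCompact (phaseBox r₁ R ×ˢ paramBox R) :=
    (isCompact_coordBox _ _).prod (isCompact_Icc.prod isCompact_Icc)
  have hBS : phaseBox r₁ R ×ˢ paramBox R ⊆ phaseDomain := fun y hy =>
    ⟨hr₁.trans_le (mem_phaseBox_iff.1 hy.1).2.2.1.1, hy.2.2.1, hy.2.2.2.trans_lt (by norm_num)⟩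
  obtain ⟨K1, -, hb1, hl1⟩ := A.contDiffOn.exists_bound_lipschitz convex_cylDomain hC hCS
  obtain ⟨K2, -, hb2, hl2⟩ := A.contDiffOn_r.exists_bound_lipschitz convex_cylDomain hC hCS
  obtain ⟨K3, -, hb3, hl3⟩ := A.contDiffOn_z.exists_bound_lipschitz convex_cylDomain hC hCS
  obtain ⟨K4, -, hb4, hl4⟩ := A.contDiffOn_keplerV.exists_bound_lipschitz convex_phaseDomain hB hBS
  obtain ⟨K5, -, hb5, hl5⟩ := A.contDiffOn_field.exists_bound_lipschitz convex_phaseDomain hB hBS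
  obtain ⟨K6, -, hb6, hl6⟩ :=
    (contDiffOn_keplerIntegral (n := 1)).exists_bound_lipschitz convex_phaseDomain hB hBS
  obtain ⟨K7, -, hb7, hl7⟩ :=
    A.contDiffOn_keplerDrift.exists_bound_lipschitz convex_phaseDomain hB hBS
  obtain ⟨K, hK, k1, k2, k3, k4, k5, k6, k7⟩ : ∃ K : ℝ, 1 ≤ K ∧ K1 ≤ K ∧ K2 ≤ K ∧ K3 ≤ K ∧ K4 ≤ K ∧
      K5 ≤ K ∧ K6 ≤ K ∧ K7 ≤ K :=
    ⟨max 1 (max K1 (max K2 (max K3 (max K4 (max K5 (max K6 K7)))))), by simp⟩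
  have hz0 : (0 : ℝ) ∈ Icc (-R) R := ⟨by linarith, hR.le⟩
  refine ⟨K, A, hr₁, hR, hK, ?_, ?_, ?_, ?_, ?_, ?_, ?_, ?_, ?_, ?_, ?_⟩
  · exact fun r hr z hz ε hε => (hb1 (r, z, ε) ⟨hr, hz, hε⟩).trans k1
  · exact fun r hr z hz ε hε => (hb2 (r, z, ε) ⟨hr, hz, hε⟩).trans k2
  · intro r hr z hz ε hε
    have h1 := hl3 (r, z, ε) ⟨hr, hz, hε⟩ (r, 0, ε) ⟨hr, hz0, hε⟩
    rw [norm_triple_sub_le] at h1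
    simp only [A.z_zero (hr₁.trans_le hr.1) ⟨hε.1, hε.2.trans_lt (by norm_num)⟩, sub_zero,
      Real.norm_eq_abs, sub_self, abs_zero, max_eq_right (abs_nonneg z)] at h1
    exact h1.trans (mul_le_mul_of_nonneg_right k3 (abs_nonneg _))
  · intro r hr s hs ε hε
    have h1 := hl1 (r, 0, ε) ⟨hr, hz0, hε⟩ (s, 0, ε) ⟨hs, hz0, hε⟩
    rw [norm_triple_sub_le, sub_self, abs_zero, max_eq_left (abs_nonneg _)] at h1
    exact h1.trans (mul_le_mul_of_nonneg_right k1 (abs_nonneg _))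
  · intro r hr s hs ε hε
    have h1 := hl2 (r, 0, ε) ⟨hr, hz0, hε⟩ (s, 0, ε) ⟨hs, hz0, hε⟩
    rw [norm_triple_sub_le, sub_self, abs_zero, max_eq_left (abs_nonneg _)] at h1
    exact h1.trans (mul_le_mul_of_nonneg_right k2 (abs_nonneg _))
  · exact fun y hy y' hy' =>
      (hl4 y hy y' hy').trans (mul_le_mul_of_nonneg_right k4 (norm_nonneg _))
  · exact fun y hy => (hb5 y hy).trans k5
  · exact fun y hy y' hy' =>
      (hl5 y hy y' hy').trans (mul_le_mul_of_nonneg_right k5 (norm_nonneg _))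
  · exact fun y hy y' hy' =>
      (hl6 y hy y' hy').trans (mul_le_mul_of_nonneg_right k6 (norm_nonneg _))
  · exact fun y hy => (hb7 y hy).trans k7
  · exact fun y hy y' hy' =>
      (hl7 y hy y' hy').trans (mul_le_mul_of_nonneg_right k7 (norm_nonneg _))

/-! ### The Hill region of the perturbed Kepler problem -/

/-- Explicit inequalities under which the perturbed Kepler problem has a potential well over the
window `ω² / 2 ≤ r ≤ R`, `|z| ≤ R`; they are satisfied near any `(ω, h)` with `-1 < 2hω² < 0` if
`r₁` and `R` are suitable and `ε` is small. -/
structure IsAdmissible (r₁ R K ω h ε : ℝ) : Prop where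
  ε_mem : ε ∈ Icc (0 : ℝ) (1 / 2)
  r₁_le : r₁ ≤ ω ^ 2 / 2
  ω_le : 4 * ω ^ 2 ≤ R
  h_le : h * R ≤ -2
  below : -(1 / (2 * ω ^ 2)) + ε * K < h
  small₀ : ε * K ≤ 1
  small₁ : ε * K * R < 1
  small₂ : 2 * (ε * K) * R ^ 2 ≤ 1
  small₃ : 8 * (ε * K) * R ^ 3 ≤ 1
  small₄ : ε * K * (R ^ 2 + 2 * R) * R ^ 2 ≤ r₁

/-- The rate of the potential well. -/
noncomputable def keplerRate (r₁ R : ℝ) : ℝ := min 1 (min (1 / (8 * R ^ 3)) (r₁ / R ^ 4))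

theorem Icc_half_subset_Ico_one {ε : ℝ} (hε : ε ∈ Icc (0 : ℝ) (1 / 2)) : ε ∈ Ico (0 : ℝ) 1 :=
  ⟨hε.1, hε.2.trans_lt (by norm_num)⟩

theorem keplerRate_pos {r₁ R : ℝ} (hr₁ : 0 < r₁) (hR : 0 < R) : 0 < keplerRate r₁ R := by
  unfold keplerRate
  positivity

theorem IsAdmissible.param_mem {r₁ R K ω h ε : ℝ} (P : IsAdmissible r₁ R K ω h ε) :
    (ω, ε) ∈ paramBox R := by
  refine ⟨?_, P.ε_mem⟩
  have := P.ω_le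
  constructor <;> nlinarith [sq_nonneg (ω - 1), sq_nonneg (ω + 1)]

theorem IsAdmissible.mem_Icc_of_mem_window {r₁ R K ω h ε r : ℝ} (P : IsAdmissible r₁ R K ω h ε)
    (hr : r ∈ Icc (ω ^ 2 / 2) R) : r ∈ Icc r₁ R :=
  ⟨P.r₁_le.trans hr.1, hr.2⟩

namespace KeplerBox

variable {fh fr fz : ℝ → ℝ → ℝ → ℝ} {r₁ R K ω h ε : ℝ} (B : KeplerBox fh fr fz r₁ R K)
  (P : IsAdmissible r₁ R K ω h ε)
include B

theorem K_pos : 0 < K := one_pos.trans_le B.one_le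

theorem zero_mem_Icc : (0 : ℝ) ∈ Icc (-R) R := ⟨by linarith [B.R_pos], B.R_pos.le⟩

include P

theorem sq_pos : 0 < ω ^ 2 := by linarith [P.r₁_le, B.r₁_pos]

theorem εK_nonneg : 0 ≤ ε * K := mul_nonneg P.ε_mem.1 B.K_pos.le

theorem pos_of_mem_window {r : ℝ} (hr : r ∈ Icc (ω ^ 2 / 2) R) : 0 < r :=
  B.r₁_pos.trans_le (P.mem_Icc_of_mem_window hr).1

theorem h_neg : h < 0 := by
  have := P.h_le
  have := B.R_pos
  by_contra! h0
  nlinarith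

theorem abs_perturbation_le {r z : ℝ} (hr : r ∈ Icc (ω ^ 2 / 2) R) (hz : z ∈ Icc (-R) R) :
    |ε * fh r z ε| ≤ ε * K := by
  rw [abs_mul, abs_of_nonneg P.ε_mem.1]
  exact mul_le_mul_of_nonneg_left
    (B.bound_h r (P.mem_Icc_of_mem_window hr) z hz ε P.ε_mem) P.ε_mem.1

/-- On the side `r = ω² / 2` the centrifugal term compensates `-1/r`, and on the other sides the
attraction is at most `1 / R`, while `h ≤ -2 / R`. -/
theorem lt_keplerV_of_boundary {r z : ℝ} (hr : r ∈ Icc (ω ^ 2 / 2) R) (hz : z ∈ Icc (-R) R)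
    (hb : r = ω ^ 2 / 2 ∨ r = R ∨ z = -R ∨ z = R) : h < keplerV fh ω ε r z := by
  have h1 := (abs_le.1 (B.abs_perturbation_le P hr hz)).1
  have hr0 := B.pos_of_mem_window P hr
  have hR := B.R_pos
  have hω := B.sq_pos P
  have hs := P.small₁
  have hh := P.h_le
  have h2 : h < -(1 / R) - ε * K := by
    rw [← mul_lt_mul_iff_left₀ hR]
    field_simp
    nlinarith
  have hpos : 0 < ω ^ 2 / (2 * r ^ 2) := by positivity
  unfold keplerV
  rcases hb with hb | hb
  · have h3 : 1 / √(r ^ 2 + z ^ 2) ≤ ω ^ 2 / (2 * r ^ 2) := by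
      have : r ≤ √(r ^ 2 + z ^ 2) := Real.le_sqrt_of_sq_le (by nlinarith [sq_nonneg z])
      calc 1 / √(r ^ 2 + z ^ 2) ≤ 1 / r := one_div_le_one_div_of_le hr0 this
        _ = ω ^ 2 / (2 * r ^ 2) := by
          have : ω ^ 2 = 2 * r := by linarith
          rw [this]
          field_simp
    have : 0 < 1 / R := by positivity
    linarith
  · have h3 : 1 / √(r ^ 2 + z ^ 2) ≤ 1 / R := by
      refine one_div_le_one_div_of_le hR (Real.le_sqrt_of_sq_le ?_)
      rcases hb with hb | hb | hb <;> rw [hb] <;> nlinarith [sq_nonneg z, sq_nonneg r]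
    linarith

theorem keplerVz_rate {r z : ℝ} (hr : r ∈ Icc (ω ^ 2 / 2) R) (hz : z ∈ Icc (-R) R) :
    1 / (8 * R ^ 3) * z ^ 2 ≤ z * keplerVz fz ε r z := by
  have hr0 := B.pos_of_mem_window P hr
  have hR := B.R_pos
  have hD := Real.sqrt_pos.2 (sq_add_sq_pos hr0 z)
  have hD2 := Real.sq_sqrt (sq_add_sq_pos hr0 z).le
  have hz2 : z ^ 2 ≤ R ^ 2 := sq_le_sq' hz.1 hz.2
  have hr2 : r ^ 2 ≤ R ^ 2 := by nlinarith [hr.2]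
  unfold keplerVz
  generalize √(r ^ 2 + z ^ 2) = D at *
  have hDR : D ≤ 3 / 2 * R := by nlinarith
  have h1 : 1 / (4 * R ^ 3) ≤ 1 / D ^ 3 := by
    refine one_div_le_one_div_of_le (by positivity) ?_
    have : D ^ 3 = D ^ 2 * D := by ring
    rw [this]
    calc D ^ 2 * D ≤ (2 * R ^ 2) * (3 / 2 * R) :=
          mul_le_mul (by linarith) hDR hD.le (by positivity)
      _ ≤ 4 * R ^ 3 := by nlinarith [pow_pos hR 3]
  have h2 : |z * (ε * fz r z ε)| ≤ 1 / (8 * R ^ 3) * z ^ 2 := by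
    rw [abs_mul, abs_mul, abs_of_nonneg P.ε_mem.1]
    have h3 := B.bound_z r (P.mem_Icc_of_mem_window hr) z hz ε P.ε_mem
    have h4 : ε * K ≤ 1 / (8 * R ^ 3) := by
      rw [le_div_iff₀ (by positivity)]
      linarith [P.small₃]
    calc |z| * (ε * |fz r z ε|) ≤ |z| * (ε * (K * |z|)) := by
          gcongr
          exact P.ε_mem.1
      _ = ε * K * z ^ 2 := by rw [← sq_abs z]; ring
      _ ≤ _ := by gcongr
  have h5 := (abs_le.1 h2).1
  have h6 : z * (z / D ^ 3 + ε * fz r z ε) = 1 / D ^ 3 * z ^ 2 + z * (ε * fz r z ε) := by ring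
  have h7 : 1 / (4 * R ^ 3) * z ^ 2 ≤ 1 / D ^ 3 * z ^ 2 := by gcongr
  have h8 : 1 / (4 * R ^ 3) * z ^ 2 = 1 / (8 * R ^ 3) * z ^ 2 + 1 / (8 * R ^ 3) * z ^ 2 := by
    field_simp
    ring
  linarith

theorem sq_mul_keplerVr {r : ℝ} (hr : r ∈ Icc (ω ^ 2 / 2) R) :
    r ^ 2 * keplerVr fr ω ε r 0 = 1 - ω ^ 2 / r + ε * (r ^ 2 * fr r 0 ε) := by
  have hr0 := B.pos_of_mem_window P hr
  have : √(r ^ 2 + 0 ^ 2) = r := by rw [zero_pow two_ne_zero, add_zero, Real.sqrt_sq hr0.le]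
  rw [keplerVr, this]
  field_simp
  ring

theorem sq_mem_window : ω ^ 2 ∈ Icc (ω ^ 2 / 2) R := by
  have := P.ω_le
  have := B.sq_pos P
  constructor <;> linarith

theorem keplerV_sq_lt : keplerV fh ω ε (ω ^ 2) 0 < h := by
  have hω := B.sq_pos P
  refine lt_of_le_of_lt ?_ P.below
  have h1 := (abs_le.1 (B.abs_perturbation_le P (B.sq_mem_window P) B.zero_mem_Icc)).2
  have e : √((ω ^ 2) ^ 2 + 0 ^ 2) = ω ^ 2 := by
    rw [zero_pow two_ne_zero, add_zero, Real.sqrt_sq hω.le]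
  rw [keplerV, e]
  have : ω ^ 2 / (2 * (ω ^ 2) ^ 2) - 1 / ω ^ 2 = -(1 / (2 * ω ^ 2)) := by
    have := hω.ne'
    generalize ω ^ 2 = w at *
    field_simp
    ring
  linarith

/-- The centre `rc` is the zero of `∂V/∂r(r, 0)`; it is unique as `r² ∂V/∂r(r, 0)` is strictly
increasing. As `V(·, 0)` is minimal at `rc`, its value there is at most `V(ω², 0) < h`. -/
theorem exists_centre : ∃ rc ∈ Ioo (ω ^ 2 / 2) R,
    (∀ r ∈ Icc (ω ^ 2 / 2) R, r₁ / R ^ 4 * (r - rc) ^ 2 ≤ (r - rc) * keplerVr fr ω ε r 0) ∧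
    keplerV fh ω ε rc 0 < h := by
  have hR := B.R_pos
  have hr₁ := B.r₁_pos
  have hω := B.sq_pos P
  have hωR := P.ω_le
  have hεK := B.εK_nonneg P
  set k : ℝ → ℝ := fun r => 1 - ω ^ 2 / r + ε * (r ^ 2 * fr r 0 ε) with hk
  have hab : ω ^ 2 / 2 < R := by linarith
  have hbd : ∀ r ∈ Icc (ω ^ 2 / 2) R, |ε * (r ^ 2 * fr r 0 ε)| ≤ 1 / 2 := fun r hr => by
    have h1 := B.bound_r r (P.mem_Icc_of_mem_window hr) 0 B.zero_mem_Icc ε P.ε_mem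
    have hr0 := B.pos_of_mem_window P hr
    have h2 : r ^ 2 ≤ R ^ 2 := by nlinarith [hr.2]
    rw [abs_mul, abs_mul, abs_of_nonneg P.ε_mem.1, abs_of_nonneg (by positivity : 0 ≤ r ^ 2)]
    calc ε * (r ^ 2 * |fr r 0 ε|) ≤ ε * (R ^ 2 * K) := by
          gcongr
          exact P.ε_mem.1
      _ ≤ 1 / 2 := by linarith [P.small₂]
  -- `k(r) = r² ∂V/∂r(r, 0)` is strictly increasing
  have hkmono : ∀ s ∈ Icc (ω ^ 2 / 2) R, ∀ r ∈ Icc (ω ^ 2 / 2) R, s ≤ r →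
      r₁ / R ^ 2 * (r - s) ≤ k r - k s := by
    intro s hs r hr hsr
    have hr0 := B.pos_of_mem_window P hr
    have hs0 := B.pos_of_mem_window P hs
    have hd : 0 ≤ r - s := sub_nonneg.2 hsr
    have h1 := B.bound_r s (P.mem_Icc_of_mem_window hs) 0 B.zero_mem_Icc ε P.ε_mem
    have h2 := B.lip_r r (P.mem_Icc_of_mem_window hr) s (P.mem_Icc_of_mem_window hs) ε P.ε_mem
    rw [abs_of_nonneg hd] at h2
    have h3 : |r ^ 2 * fr r 0 ε - s ^ 2 * fr s 0 ε| ≤ K * (R ^ 2 + 2 * R) * (r - s) := by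
      have e : r ^ 2 * fr r 0 ε - s ^ 2 * fr s 0 ε =
        r ^ 2 * (fr r 0 ε - fr s 0 ε) + (r + s) * (r - s) * fr s 0 ε := by ring
      rw [e]
      refine (abs_add_le _ _).trans ?_
      rw [abs_mul, abs_mul, abs_of_nonneg (by positivity : 0 ≤ r ^ 2),
        abs_of_nonneg (by positivity : 0 ≤ (r + s) * (r - s))]
      have h4 : r ^ 2 ≤ R ^ 2 := by nlinarith [hr.2]
      have h5 : r + s ≤ 2 * R := by linarith [hr.2, hs.2]
      have hK := B.K_pos
      calc r ^ 2 * |fr r 0 ε - fr s 0 ε| + (r + s) * (r - s) * |fr s 0 ε|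
          ≤ R ^ 2 * (K * (r - s)) + 2 * R * (r - s) * K := by gcongr
        _ = _ := by ring
    have h4 : |ε * (r ^ 2 * fr r 0 ε - s ^ 2 * fr s 0 ε)| ≤ r₁ / R ^ 2 * (r - s) := by
      rw [abs_mul, abs_of_nonneg P.ε_mem.1]
      have h5 : ε * K * (R ^ 2 + 2 * R) ≤ r₁ / R ^ 2 := by
        rw [le_div_iff₀ (by positivity)]
        exact P.small₄
      calc ε * |r ^ 2 * fr r 0 ε - s ^ 2 * fr s 0 ε| ≤ ε * (K * (R ^ 2 + 2 * R) * (r - s)) := by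
            gcongr
            exact P.ε_mem.1
        _ = ε * K * (R ^ 2 + 2 * R) * (r - s) := by ring
        _ ≤ _ := by gcongr
    have h5 : 2 * (r₁ / R ^ 2 * (r - s)) ≤ ω ^ 2 / s - ω ^ 2 / r := by
      have e : ω ^ 2 / s - ω ^ 2 / r = ω ^ 2 / (r * s) * (r - s) := by
        field_simp
      rw [e, ← mul_assoc]
      refine mul_le_mul_of_nonneg_right ?_ hd
      rw [← mul_div_assoc]
      have h6 : r * s ≤ R ^ 2 := by
        rw [sq]
        exact mul_le_mul hr.2 hs.2 hs0.le hR.le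
      exact div_le_div₀ hω.le (by linarith [P.r₁_le]) (by positivity) h6
    have h6 := (abs_le.1 h4).1
    have e : k r - k s = ω ^ 2 / s - ω ^ 2 / r + ε * (r ^ 2 * fr r 0 ε - s ^ 2 * fr s 0 ε) := by
      simp only [hk]
      ring
    rw [e]
    linarith
  have hkc : ContinuousOn k (Icc (ω ^ 2 / 2) R) := by
    have hfr : ContinuousOn (fun r => fr r 0 ε) (Icc (ω ^ 2 / 2) R) :=
      B.contDiffOn_r.continuousOn.comp (f := fun r : ℝ => (r, (0 : ℝ), ε)) (by fun_prop)
        fun r hr => ⟨B.pos_of_mem_window P hr, trivial, Icc_half_subset_Ico_one P.ε_mem⟩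
    exact (continuousOn_const.sub (continuousOn_const.div continuousOn_id
      fun r hr => (B.pos_of_mem_window P hr).ne')).add
      (continuousOn_const.mul ((continuousOn_id.pow 2).mul hfr))
  have hka : k (ω ^ 2 / 2) < 0 := by
    have h1 := (abs_le.1 (hbd _ ⟨le_rfl, hab.le⟩)).2
    have e : ω ^ 2 / (ω ^ 2 / 2) = 2 := by rw [div_div_eq_mul_div, mul_div_cancel_left₀ _ hω.ne']
    simp only [hk, e]
    linarith
  have hkb : 0 < k R := by
    have h1 := (abs_le.1 (hbd _ ⟨hab.le, le_rfl⟩)).1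
    have e : ω ^ 2 / R ≤ 1 / 4 := by
      rw [div_le_iff₀ hR]
      linarith
    simp only [hk]
    linarith
  obtain ⟨rc, hrc, hrc0⟩ := intermediate_value_Ioo hab.le hkc ⟨hka, hkb⟩
  have hrc' := Ioo_subset_Icc_self hrc
  have hrate : ∀ r ∈ Icc (ω ^ 2 / 2) R,
      r₁ / R ^ 4 * (r - rc) ^ 2 ≤ (r - rc) * keplerVr fr ω ε r 0 := by
    intro r hr
    have hr0 := B.pos_of_mem_window P hr
    have h1 : r₁ / R ^ 2 * (r - rc) ^ 2 ≤ (r - rc) * k r := by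
      rcases le_total rc r with h2 | h2
      · have h3 := hkmono rc hrc' r hr h2
        rw [hrc0] at h3
        nlinarith
      · have h3 := hkmono r hr rc hrc' h2
        rw [hrc0] at h3
        nlinarith
    have h2 : (r - rc) * keplerVr fr ω ε r 0 = (r - rc) * k r / r ^ 2 := by
      rw [eq_div_iff (by positivity)]
      have := B.sq_mul_keplerVr P hr
      simp only [hk]
      rw [← this]
      ring
    rw [h2, le_div_iff₀ (by positivity)]
    refine le_trans ?_ h1
    have h3 : r ^ 2 ≤ R ^ 2 := by nlinarith [hr.2]
    calc r₁ / R ^ 4 * (r - rc) ^ 2 * r ^ 2 ≤ r₁ / R ^ 4 * (r - rc) ^ 2 * R ^ 2 := by gcongr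
      _ = r₁ / R ^ 2 * (r - rc) ^ 2 := by field_simp
  refine ⟨rc, hrc, hrate, ?_⟩
  have hωmem : ω ^ 2 ∈ Icc (ω ^ 2 / 2) R := B.sq_mem_window P
  have hle : keplerV fh ω ε rc 0 ≤ keplerV fh ω ε (ω ^ 2) 0 := by
    have hd : ∀ r ∈ Icc (ω ^ 2 / 2) R,
        HasDerivAt (fun r => keplerV fh ω ε r 0) (keplerVr fr ω ε r 0) r := fun r hr =>
      B.hasDerivAt_keplerV_r (B.pos_of_mem_window P hr) (Icc_half_subset_Ico_one P.ε_mem)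
    have hsign : ∀ r ∈ Icc (ω ^ 2 / 2) R, 0 ≤ (r - rc) * keplerVr fr ω ε r 0 := fun r hr =>
      le_trans (by positivity) (hrate r hr)
    rcases le_total rc (ω ^ 2) with h1 | h1
    · have hsub : Icc rc (ω ^ 2) ⊆ Icc (ω ^ 2 / 2) R := Icc_subset_Icc hrc'.1 hωmem.2
      refine monotoneOn_of_deriv_nonneg (convex_Icc rc (ω ^ 2))
        (fun r hr => (hd r (hsub hr)).continuousAt.continuousWithinAt)
        (fun r hr => (hd r (hsub (interior_subset hr))).differentiableAt.differentiableWithinAt)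
        (fun r hr => ?_) ⟨le_rfl, h1⟩ ⟨h1, le_rfl⟩ h1
      rw [interior_Icc] at hr
      rw [(hd r (hsub (Ioo_subset_Icc_self hr))).deriv]
      exact nonneg_of_mul_nonneg_right (hsign r (hsub (Ioo_subset_Icc_self hr))) (sub_pos.2 hr.1)
    · have hsub : Icc (ω ^ 2) rc ⊆ Icc (ω ^ 2 / 2) R := Icc_subset_Icc hωmem.1 hrc'.2
      refine antitoneOn_of_deriv_nonpos (convex_Icc (ω ^ 2) rc)
        (fun r hr => (hd r (hsub hr)).continuousAt.continuousWithinAt)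
        (fun r hr => (hd r (hsub (interior_subset hr))).differentiableAt.differentiableWithinAt)
        (fun r hr => ?_) ⟨le_rfl, h1⟩ ⟨h1, le_rfl⟩ h1
      rw [interior_Icc] at hr
      rw [(hd r (hsub (Ioo_subset_Icc_self hr))).deriv]
      have h2 := hsign r (hsub (Ioo_subset_Icc_self hr))
      have h3 := sub_neg.2 hr.2
      by_contra! h4
      nlinarith
  exact hle.trans_lt (B.keplerV_sq_lt P)

theorem exists_hillWell : ∃ rc, HillWell (keplerV fh ω ε) (keplerVr fr ω ε) (keplerVz fz ε) h
    (ω ^ 2 / 2) R R rc (keplerRate r₁ R) := by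
  obtain ⟨rc, hrc, hrate, hbelow⟩ := B.exists_centre P
  have hε := Icc_half_subset_Ico_one P.ε_mem
  have hpos : ∀ r ∈ Icc (ω ^ 2 / 2) R, 0 < r := fun r hr => B.pos_of_mem_window P hr
  have hc : ContinuousOn (fun p : ℝ × ℝ => ((!₂[0, 0, p.1, p.2] : Phase), (ω, ε)))
      (Icc (ω ^ 2 / 2) R ×ˢ Icc (-R) R) := by
    refine ContinuousOn.prodMk (Continuous.continuousOn ?_) continuousOn_const
    refine (PiLp.continuous_toLp 2 _).comp (continuous_pi fun i => ?_)
    fin_cases i <;> simp <;> fun_prop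
  have hm : MapsTo (fun p : ℝ × ℝ => ((!₂[0, 0, p.1, p.2] : Phase), (ω, ε)))
      (Icc (ω ^ 2 / 2) R ×ˢ Icc (-R) R) phaseDomain := fun p hp => ⟨by simpa using hpos _ hp.1, hε⟩
  refine ⟨rc, half_pos (B.sq_pos P), B.R_pos, keplerRate_pos B.r₁_pos B.R_pos, min_le_left _ _,
    hrc, hbelow, ?_, ?_, ?_, ?_, ?_, ?_, ?_, ?_, ?_⟩
  · exact fun r hr z hz => B.hasFDerivAt_keplerV (hpos r hr) hε
  · simpa [Function.comp_def] using B.contDiffOn_keplerVr.continuousOn.comp hc hm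
  · simpa [Function.comp_def] using B.contDiffOn_keplerVz.continuousOn.comp hc hm
  · intro r hr z hz
    simp only [keplerV, neg_sq, B.even r (hpos r hr) z ε hε]
  · intro r hr z hz
    simp only [keplerVr, neg_sq, B.even_r (hpos r hr) hε]
  · intro r hr z hz
    simp only [keplerVz, neg_sq, B.odd_z (hpos r hr) hε]
    ring
  · exact fun r hr z hz hb => B.lt_keplerV_of_boundary P hr hz hb
  · exact fun r hr => le_trans (mul_le_mul_of_nonneg_right
      ((min_le_right _ _).trans (min_le_right _ _)) (sq_nonneg _)) (hrate r hr)
  · exact fun r hr z hz => le_trans (mul_le_mul_of_nonneg_right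
      ((min_le_right _ _).trans (min_le_left _ _)) (sq_nonneg _)) (B.keplerVz_rate P hr hz)

end KeplerBox

/-! ### The flow of the perturbed Kepler problem -/

/-- The energy surface of the perturbed Kepler problem over the window `ω² / 2 ≤ r ≤ R`,
`|z| ≤ R`. -/
def keplerLevel (fh : ℝ → ℝ → ℝ → ℝ) (R ω h ε : ℝ) : Set Phase :=
  wellLevel (keplerV fh ω ε) h (ω ^ 2 / 2) R R

/-- The Hamiltonian vector field of the perturbed Kepler problem. -/
noncomputable def keplerField (fr fz : ℝ → ℝ → ℝ → ℝ) (ω ε : ℝ) (x : Phase) : Phase :=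
  wellField (keplerVr fr ω ε) (keplerVz fz ε) x

/-- A solution of the perturbed Kepler problem on `keplerLevel`. -/
def IsKeplerSolution (fh fr fz : ℝ → ℝ → ℝ → ℝ) (R ω h ε : ℝ) (ξ : ℝ → Phase) : Prop :=
  IsWellSolution (keplerV fh ω ε) (keplerVr fr ω ε) (keplerVz fz ε) h (ω ^ 2 / 2) R R ξ

/-- The point with the same `p_r`, `r` in the plane `{p_z = z = 0}`. -/
def planarPart (x : Phase) : Phase := !₂[x 0, 0, x 2, 0]

theorem norm_sub_planarPart (x : Phase) : ‖x - planarPart x‖ = ‖vertical x‖ := by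
  rw [EuclideanSpace.norm_eq, Complex.norm_eq_sqrt_sq_add_sq]
  simp [Fin.sum_univ_four, planarPart, vertical]

theorem abs_apply_le_norm (x : Phase) (i : Fin 4) : |x i| ≤ ‖x‖ := PiLp.norm_apply_le x i

/-- The energy is conserved. -/
theorem hasDerivAt_wellEnergy {V : ℝ → ℝ → ℝ} {Vr Vz : ℝ → ℝ → ℝ} {ξ : ℝ → Phase} {t : ℝ}
    (hV : HasFDerivAt (fun p : ℝ × ℝ => V p.1 p.2)
      (Vr (ξ t 2) (ξ t 3) • ContinuousLinearMap.fst ℝ ℝ ℝ +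
        Vz (ξ t 2) (ξ t 3) • ContinuousLinearMap.snd ℝ ℝ ℝ) (ξ t 2, ξ t 3))
    (hξ : HasDerivAt ξ (wellField Vr Vz (ξ t)) t) :
    HasDerivAt (fun t => wellEnergy V (ξ t)) 0 t := by
  have := (hasGradientAt_wellEnergy hV).hasFDerivAt.comp_hasDerivAt t hξ
  refine this.congr_deriv ?_
  simp [wellField, PiLp.inner_apply, Fin.sum_univ_four]
  ring

theorem IsKeplerSolution.hasDerivAt_vertical {fh fr fz : ℝ → ℝ → ℝ → ℝ} {R ω h ε : ℝ}
    {ξ : ℝ → Phase} (hξ : IsKeplerSolution fh fr fz R ω h ε ξ) (t : ℝ) :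
    HasDerivAt (fun t => vertical (ξ t)) ⟨-keplerVz fz ε (ξ t 2) (ξ t 3), ξ t 1⟩ t := by
  have h1 := (hξ.solves t).phase_apply 1
  have h3 := (hξ.solves t).phase_apply 3
  have := h1.ofReal_comp.add (h3.ofReal_comp.mul_const Complex.I)
  have e : (fun t => vertical (ξ t)) = fun t => ((ξ t 1 : ℝ) : ℂ) + (ξ t 3 : ℝ) * Complex.I :=
    funext fun t => Complex.mk_eq_add_mul_I _ _
  rw [e]
  refine this.congr_deriv ?_
  apply Complex.ext <;> simp [wellField]

namespace KeplerBox

variable {fh fr fz : ℝ → ℝ → ℝ → ℝ} {r₁ R K ω h ε ω' h' ε' : ℝ} {ξ ξ' : ℝ → Phase} {x : Phase}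
  (B : KeplerBox fh fr fz r₁ R K)
include B

theorem r₁_pos_of_mem (hx : x ∈ phaseBox r₁ R) : 0 < x 2 :=
  B.r₁_pos.trans_le (mem_phaseBox_iff.1 hx).2.2.1.1

theorem planarPart_mem (hx : x ∈ phaseBox r₁ R) : planarPart x ∈ phaseBox r₁ R := by
  have hr := B.r₁_pos
  rw [mem_phaseBox_iff] at hx ⊢
  refine ⟨by simpa [planarPart] using hx.1, ?_, by simpa [planarPart] using hx.2.2.1, ?_⟩
  · simp [planarPart]
    positivity
  · simpa [planarPart] using B.R_pos.le

theorem abs_keplerVz_le (hx : x ∈ phaseBox r₁ R) (hp : (ω, ε) ∈ paramBox R) :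
    |keplerVz fz ε (x 2) (x 3)| ≤ K * ‖vertical x‖ := by
  have h1 := B.lip_field (x, ω, ε) ⟨hx, hp⟩ (planarPart x, ω, ε) ⟨B.planarPart_mem hx, hp⟩
  have h2 := (abs_apply_le_norm _ 1).trans h1
  have h3 : fz (x 2) 0 ε = 0 := B.z_zero (B.r₁_pos_of_mem hx) (Icc_half_subset_Ico_one hp.2)
  rw [Prod.mk_sub_mk, sub_self, Prod.norm_mk, norm_zero, max_eq_left (norm_nonneg _),
    norm_sub_planarPart] at h2
  have h4 : keplerVz fz ε (planarPart x 2) (planarPart x 3) = 0 := by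
    simp [keplerVz, planarPart, h3]
  simp only [wellField, PiLp.sub_apply] at h2
  simpa [h4] using h2

theorem abs_keplerDrift_le (hx : x ∈ phaseBox r₁ R) (hp : (ω, ε) ∈ paramBox R) :
    |keplerDrift fr fz ω ε x| ≤ K * ‖vertical x‖ := by
  have h1 := B.lip_drift (x, ω, ε) ⟨hx, hp⟩ (planarPart x, ω, ε) ⟨B.planarPart_mem hx, hp⟩
  have h3 : fz (x 2) 0 ε = 0 := B.z_zero (B.r₁_pos_of_mem hx) (Icc_half_subset_Ico_one hp.2)
  rw [Prod.mk_sub_mk, sub_self, Prod.norm_mk, norm_zero, max_eq_left (norm_nonneg _),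
    norm_sub_planarPart] at h1
  have h4 : keplerDrift fr fz ω ε (planarPart x) = 0 := by
    simp [keplerDrift, planarPart, h3]
  simpa [h4] using h1

theorem lipschitzOnWith_keplerField (hp : (ω, ε) ∈ paramBox R) :
    LipschitzOnWith (Real.toNNReal K) (keplerField fr fz ω ε) (phaseBox r₁ R) :=
  LipschitzOnWith.of_dist_le_mul fun x hx y hy => by
    have := B.lip_field (x, ω, ε) ⟨hx, hp⟩ (y, ω, ε) ⟨hy, hp⟩
    rw [Prod.mk_sub_mk, sub_self, Prod.norm_mk, norm_zero, max_eq_left (norm_nonneg _)] at this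
    rw [dist_eq_norm, dist_eq_norm, Real.coe_toNNReal _ B.K_pos.le]
    exact this

section
variable (P : IsAdmissible r₁ R K ω h ε)
include P

/-- The energy surface lies in the interior of the box: over the window `V ≥ -1 / r₁ - 1` and `h <
0`, which bounds the momenta. -/
theorem phaseBox_mem_nhds (hx : x ∈ keplerLevel fh R ω h ε) : phaseBox r₁ R ∈ 𝓝 x := by
  obtain ⟨rc, W⟩ := B.exists_hillWell P
  obtain ⟨h2, h3⟩ := W.window_of_mem hx
  have hr := B.pos_of_mem_window P (Ioo_subset_Icc_self h2)
  have hr₁ := B.r₁_pos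
  have hV : -(1 / r₁ + 1) ≤ keplerV fh ω ε (x 2) (x 3) := by
    have h4 := (abs_le.1 (B.abs_perturbation_le P (Ioo_subset_Icc_self h2)
      (Ioo_subset_Icc_self h3))).1
    have h5 : 1 / √((x 2) ^ 2 + (x 3) ^ 2) ≤ 1 / r₁ := by
      refine one_div_le_one_div_of_le hr₁ ?_
      refine (P.r₁_le.trans h2.1.le).trans (Real.le_sqrt_of_sq_le ?_)
      nlinarith [sq_nonneg (x 3)]
    have h6 : 0 ≤ ω ^ 2 / (2 * (x 2) ^ 2) := by positivity
    have h7 := P.small₀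
    unfold keplerV
    linarith
  have hE := hx.2.2
  rw [wellEnergy] at hE
  have hh := B.h_neg P
  have h8 : (x 0) ^ 2 + (x 1) ^ 2 < 2 / r₁ + 2 := by
    have : 2 / r₁ = 2 * (1 / r₁) := by ring
    linarith
  have h9 : 0 < 2 / r₁ := by positivity
  have h0 : |x 0| < 2 / r₁ + 2 := abs_lt_of_sq_lt_sq (by nlinarith [sq_nonneg (x 1)]) (by linarith)
  have h1 : |x 1| < 2 / r₁ + 2 := abs_lt_of_sq_lt_sq (by nlinarith [sq_nonneg (x 0)]) (by linarith)
  have hc : ∀ i : Fin 4, Continuous fun y : Phase => y i := fun i => by fun_prop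
  have e0 := (hc 0).abs.continuousAt.eventually_lt continuousAt_const h0
  have e1 := (hc 1).abs.continuousAt.eventually_lt continuousAt_const h1
  have e2 := (hc 2).continuousAt.eventually (Ioo_mem_nhds (P.r₁_le.trans_lt h2.1) h2.2)
  have e3 := (hc 3).continuousAt.eventually (Ioo_mem_nhds h3.1 h3.2)
  filter_upwards [e0, e1, e2, e3] with y y0 y1 y2 y3
  exact mem_phaseBox_iff.2 ⟨y0.le, y1.le, Ioo_subset_Icc_self y2, Ioo_subset_Icc_self y3⟩

theorem mem_phaseBox (hx : x ∈ keplerLevel fh R ω h ε) : x ∈ phaseBox r₁ R :=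
  mem_of_mem_nhds (B.phaseBox_mem_nhds P hx)

theorem exists_keplerSolution (hx : x ∈ keplerLevel fh R ω h ε) :
    ∃ ξ, IsKeplerSolution fh fr fz R ω h ε ξ ∧ ξ 0 = x := by
  obtain ⟨rc, W⟩ := B.exists_hillWell P
  have hp := P.param_mem
  have hε := Icc_half_subset_Ico_one P.ε_mem
  have hlohi : ∀ i, boxLo r₁ R i ≤ boxHi r₁ R i := fun i => by
    have := B.mem_phaseBox P hx i
    exact this.1.trans this.2
  -- the field is made globally Lipschitz and bounded by projecting onto the box
  set cl := clampBox (boxLo r₁ R) (boxHi r₁ R) with hcl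
  have hcm : ∀ y, cl y ∈ phaseBox r₁ R := clampBox_mem hlohi
  have hlip : LipschitzWith (Real.toNNReal K) fun y => keplerField fr fz ω ε (cl y) :=
    LipschitzWith.of_dist_le_mul fun y y' => by
      refine ((B.lipschitzOnWith_keplerField hp).dist_le_mul _ (hcm y) _ (hcm y')).trans ?_
      rw [dist_eq_norm, dist_eq_norm]
      exact mul_le_mul_of_nonneg_left (norm_clampBox_sub_le _ _ _ _) (by positivity)
  obtain ⟨ξ, hξ0, hξ⟩ := hlip.exists_global_solution (L := Real.toNNReal K) (fun y => by
    rw [Real.coe_toNNReal _ B.K_pos.le]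
    exact B.bound_field (cl y, ω, ε) ⟨hcm y, hp⟩) x
  have hcont : Continuous ξ := continuous_iff_continuousAt.2 fun t => (hξ t).continuousAt
  -- while the modified solution is on the energy surface it solves the original equation nearby, so
  -- that the energy is locally constant and the solution cannot leave
  have hclopen : IsClopen {t | ξ t ∈ keplerLevel fh R ω h ε} := by
    refine ⟨W.isClosed_wellLevel.preimage hcont, isOpen_iff_mem_nhds.2 fun t ht => ?_⟩
    obtain ⟨h2, h3⟩ := W.window_of_mem ht
    have e1 := hcont.continuousAt.eventually (B.phaseBox_mem_nhds P ht)
    have hc : ∀ i : Fin 4, Continuous fun t => ξ t i := fun i => by fun_prop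
    have e2 := (hc 2).continuousAt.eventually (Ioo_mem_nhds h2.1 h2.2)
    have e3 := (hc 3).continuousAt.eventually (Ioo_mem_nhds h3.1 h3.2)
    obtain ⟨δ, hδ, hball⟩ := Metric.eventually_nhds_iff_ball.1 (e1.and (e2.and e3))
    have hd : ∀ s ∈ Metric.ball t δ, HasDerivAt (fun s => wellEnergy (keplerV fh ω ε) (ξ s)) 0 s := by
      intro s hs
      obtain ⟨hb, hs2, hs3⟩ := hball s hs
      have h4 := hξ s
      simp only [hcl, clampBox_eq_self hb] at h4
      exact hasDerivAt_wellEnergy (B.hasFDerivAt_keplerV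
        (B.pos_of_mem_window P (Ioo_subset_Icc_self hs2)) hε) h4
    filter_upwards [Metric.ball_mem_nhds t hδ] with s hs
    obtain ⟨hb, hs2, hs3⟩ := hball s hs
    refine ⟨Ioo_subset_Icc_self hs2, Ioo_subset_Icc_self hs3, ?_⟩
    rw [← ht.2.2]
    exact Metric.isOpen_ball.is_const_of_deriv_eq_zero (convex_ball t δ).isPreconnected
      (fun s hs => (hd s hs).differentiableAt.differentiableWithinAt)
      (fun s hs => (hd s hs).deriv) hs (Metric.mem_ball_self hδ)
  have huniv := hclopen.eq_univ ⟨0, by rw [mem_ofPred_eq, hξ0]; exact hx⟩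
  have hmem : ∀ t, ξ t ∈ keplerLevel fh R ω h ε := fun t => by
    have : t ∈ {t | ξ t ∈ keplerLevel fh R ω h ε} := huniv ▸ mem_univ t
    exact this
  refine ⟨ξ, ⟨hmem, fun t => ?_⟩, hξ0⟩
  have h4 := hξ t
  simp only [hcl, clampBox_eq_self (B.mem_phaseBox P (hmem t))] at h4
  exact h4

theorem exists_hillFlow : ∃ rc, HillFlow (keplerV fh ω ε) (keplerVr fr ω ε) (keplerVz fz ε) h
    (ω ^ 2 / 2) R R rc (keplerRate r₁ R) := by
  obtain ⟨rc, W⟩ := B.exists_hillWell P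
  refine ⟨rc, W, fun x hx => B.exists_keplerSolution P hx, fun ξ η hξ hη t ht => ?_⟩
  exact ODE_solution_unique_univ (v := fun _ => keplerField fr fz ω ε)
    (s := fun _ => phaseBox r₁ R) (fun _ => B.lipschitzOnWith_keplerField P.param_mem)
    (fun s => ⟨hξ.solves s, B.mem_phaseBox P (hξ.mem s)⟩)
    (fun s => ⟨hη.solves s, B.mem_phaseBox P (hη.mem s)⟩) ht

theorem norm_vertical_deriv_le (hξ : IsKeplerSolution fh fr fz R ω h ε ξ) (t : ℝ) :
    ‖(⟨-keplerVz fz ε (ξ t 2) (ξ t 3), ξ t 1⟩ : ℂ)‖ ≤ 2 * K * ‖vertical (ξ t)‖ := by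
  have h1 := B.abs_keplerVz_le (B.mem_phaseBox P (hξ.mem t)) P.param_mem
  have h2 : |ξ t 1| ≤ ‖vertical (ξ t)‖ := Complex.abs_re_le_norm (vertical (ξ t))
  have h3 := Complex.norm_le_abs_re_add_abs_im ⟨-keplerVz fz ε (ξ t 2) (ξ t 3), ξ t 1⟩
  simp only [abs_neg] at h3
  have := B.one_le
  nlinarith [norm_nonneg (vertical (ξ t))]

/-- The distance from the plane `{p_z = z = 0}` grows at most exponentially. -/
theorem norm_vertical_le (hξ : IsKeplerSolution fh fr fz R ω h ε ξ) {t : ℝ} (ht : 0 ≤ t) :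
    ‖vertical (ξ t)‖ ≤ ‖vertical (ξ 0)‖ * Real.exp (2 * K * t) := by
  have h1 := norm_le_gronwallBound_of_norm_deriv_right_le (f := fun t => vertical (ξ t)) (ε := 0)
    (a := 0) (b := t) (continuous_vertical.comp hξ.continuous).continuousOn
    (fun s _ => (hξ.hasDerivAt_vertical s).hasDerivWithinAt) le_rfl
    (fun s _ => by rw [add_zero]; exact B.norm_vertical_deriv_le P hξ s) t ⟨ht, le_rfl⟩
  simpa [gronwallBound_ε0] using h1

/-- The distance from the plane `{p_z = z = 0}` decays at most exponentially. -/
theorem le_norm_vertical (hξ : IsKeplerSolution fh fr fz R ω h ε ξ) {t : ℝ} (ht : 0 ≤ t) :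
    ‖vertical (ξ 0)‖ ≤ ‖vertical (ξ t)‖ * Real.exp (2 * K * t) := by
  have hd : ∀ s, HasDerivAt (fun s => vertical (ξ (t - s)))
      (-(⟨-keplerVz fz ε (ξ (t - s) 2) (ξ (t - s) 3), ξ (t - s) 1⟩ : ℂ)) s := fun s =>
    (hξ.hasDerivAt_vertical (t - s)).comp_const_sub t s
  have h1 := norm_le_gronwallBound_of_norm_deriv_right_le (f := fun s => vertical (ξ (t - s)))
    (ε := 0) (a := 0) (b := t) (fun s _ => (hd s).continuousAt.continuousWithinAt)
    (fun s _ => (hd s).hasDerivWithinAt) le_rfl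
    (fun s _ => by rw [add_zero, norm_neg]; exact B.norm_vertical_deriv_le P hξ (t - s)) t
    ⟨ht, le_rfl⟩
  simpa [gronwallBound_ε0] using h1

end

/-- Lipschitz dependence of solutions on initial values and parameters. -/
theorem norm_sub_le (P : IsAdmissible r₁ R K ω h ε) (P' : IsAdmissible r₁ R K ω' h' ε')
    (hξ : IsKeplerSolution fh fr fz R ω h ε ξ) (hξ' : IsKeplerSolution fh fr fz R ω' h' ε' ξ')
    {t : ℝ} (ht : 0 ≤ t) : ‖ξ t - ξ' t‖ ≤
      (‖ξ 0 - ξ' 0‖ + K * ‖((ω, ε) : ℝ × ℝ) - (ω', ε')‖) * Real.exp (K * t) := by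
  have hK := B.one_le
  have hcoe : ((Real.toNNReal K : NNReal) : ℝ) = K := Real.coe_toNNReal _ B.K_pos.le
  have h1 := dist_le_of_approx_trajectories_ODE_of_mem (v := fun _ => keplerField fr fz ω ε)
    (s := fun _ => phaseBox r₁ R) (K := Real.toNNReal K) (f := ξ) (g := ξ')
    (f' := fun t => keplerField fr fz ω ε (ξ t)) (g' := fun t => keplerField fr fz ω' ε' (ξ' t))
    (a := 0) (b := t) (εf := 0) (εg := K * ‖((ω, ε) : ℝ × ℝ) - (ω', ε')‖)
    (fun _ _ => B.lipschitzOnWith_keplerField P.param_mem) hξ.continuous.continuousOn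
    (fun s _ => (hξ.solves s).hasDerivWithinAt) (fun s _ => by rw [dist_self])
    (fun s _ => B.mem_phaseBox P (hξ.mem s)) hξ'.continuous.continuousOn
    (fun s _ => (hξ'.solves s).hasDerivWithinAt) (fun s _ => by
      have h2 := B.lip_field (ξ' s, ω', ε') ⟨B.mem_phaseBox P' (hξ'.mem s), P'.param_mem⟩
        (ξ' s, ω, ε) ⟨B.mem_phaseBox P' (hξ'.mem s), P.param_mem⟩
      rw [Prod.mk_sub_mk, sub_self, Prod.norm_mk, norm_zero, max_eq_right (norm_nonneg _),
        norm_sub_rev (ω', ε')] at h2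
      rw [dist_eq_norm]
      exact h2)
    (fun s _ => B.mem_phaseBox P' (hξ'.mem s)) (dist_eq_norm _ _).le t ⟨ht, le_rfl⟩
  rw [hcoe, gronwallBound_of_K_ne_0 B.K_pos.ne', dist_eq_norm, sub_zero, zero_add] at h1
  refine h1.trans ?_
  rw [add_mul]
  refine add_le_add le_rfl ?_
  have h2 : 0 ≤ K * ‖((ω, ε) : ℝ × ℝ) - (ω', ε')‖ := by have := B.K_pos; positivity
  have h3 := Real.exp_pos (K * t)
  have h4 : K * ‖((ω, ε) : ℝ × ℝ) - (ω', ε')‖ / K ≤ K * ‖((ω, ε) : ℝ × ℝ) - (ω', ε')‖ :=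
    div_le_self h2 hK
  have h5 : 0 ≤ Real.exp (K * t) - 1 := by
    have := Real.add_one_le_exp (K * t)
    have : 0 ≤ K * t := mul_nonneg B.K_pos.le ht
    linarith
  calc _ ≤ K * ‖((ω, ε) : ℝ × ℝ) - (ω', ε')‖ * (Real.exp (K * t) - 1) := by gcongr
    _ ≤ _ := by nlinarith

end KeplerBox

/-! ### The quarter-period equation -/

/-- The Kepler integral changes at a rate proportional to `ε`. -/
theorem hasDerivAt_keplerIntegral {fr fz : ℝ → ℝ → ℝ → ℝ} {ω ε t : ℝ} {ξ : ℝ → Phase}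
    (hr : 0 < ξ t 2) (hξ : HasDerivAt ξ (keplerField fr fz ω ε (ξ t)) t) :
    HasDerivAt (fun t => keplerIntegral ω (ξ t)) (-(ε * keplerDrift fr fz ω ε (ξ t))) t := by
  have h0 := hξ.phase_apply 0
  have h1 := hξ.phase_apply 1
  have h2 := hξ.phase_apply 2
  have h3 := hξ.phase_apply 3
  have hD := sq_add_sq_pos hr (ξ t 3)
  have hD' := Real.sqrt_pos.2 hD
  have hd := ((h2.pow 2).add (h3.pow 2)).sqrt hD.ne'
  have hm := (h3.mul h0).sub (h2.mul h1)
  have hL := ((hm.pow 2).add ((((h3.pow 2).div (h2.pow 2) (by simpa using hr.ne')).const_add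
    (1 : ℝ)).const_mul (ω ^ 2))).sub hd
  have hC := (h1.mul hL).add ((h3.mul ((h2.mul h0).add (h3.mul h1))).div hd hD'.ne')
  refine HasDerivAt.congr_deriv hC ?_
  have hD2 := Real.sq_sqrt hD.le
  simp [keplerField, wellField, keplerDrift, keplerVr, keplerVz]
  generalize √((ξ t 2) ^ 2 + (ξ t 3) ^ 2) = D at *
  generalize fr (ξ t 2) (ξ t 3) ε = a
  generalize fz (ξ t 2) (ξ t 3) ε = b
  generalize ξ t 0 = p at *
  generalize ξ t 1 = q at *
  generalize ξ t 2 = r at *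
  generalize ξ t 3 = z at *
  field_simp
  linear_combination (D * z * r ^ 3 * (p ^ 2 + q ^ 2) + r * z * D * ω ^ 2 + z * r ^ 3) * hD2

/-- Where `p_z = 0`, the Kepler integral is `z r p_r / √(r² + z²)`. At the quarter time it therefore
vanishes exactly if the quarter-period condition holds. -/
theorem keplerIntegral_eq_zero_iff {ω : ℝ} {x : Phase} (h1 : x 1 = 0) (h2 : 0 < x 2)
    (h3 : 0 < x 3) : keplerIntegral ω x = 0 ↔ x 0 = 0 := by
  have hD := Real.sqrt_pos.2 (sq_add_sq_pos h2 (x 3))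
  simp [keplerIntegral, h1, hD.ne', h2.ne', h3.ne']

/-- The polar angle of `(p_z, z)`, starting from `0`, has advanced by a quarter turn at time `t₁`.
-/
def IsQuarterTime (κ : ℝ) (ξ : ℝ → Phase) (t₁ : ℝ) : Prop :=
  ∃ θ, IsAngle κ (fun t => vertical (ξ t)) θ ∧ θ 0 = 0 ∧ θ t₁ = Real.pi / 2

theorem isQuarterBrake_iff {κ : ℝ} {ξ : ℝ → Phase} :
    IsQuarterBrake κ ξ ↔ ∃ t₁, IsQuarterTime κ ξ t₁ ∧ ξ t₁ 0 = 0 := by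
  constructor
  · rintro ⟨θ, h1, h2, s, h3, h4⟩
    exact ⟨s, ⟨θ, h1, h2, h3⟩, h4⟩
  · rintro ⟨s, ⟨θ, h1, h2, h3⟩, h4⟩
    exact ⟨θ, h1, h2, s, h3, h4⟩

namespace IsQuarterTime

variable {κ t₁ t₁' : ℝ} {ξ ξ' : ℝ → Phase}

theorem pos (hκ : 0 < κ) (h : IsQuarterTime κ ξ t₁) : 0 < t₁ := by
  obtain ⟨θ, h1, h2, h3⟩ := h
  refine (h1.strictMono hκ).lt_iff_lt.1 ?_
  rw [h2, h3]
  positivity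

theorem le (hκ : 0 < κ) (h : IsQuarterTime κ ξ t₁) : t₁ ≤ Real.pi / (2 * κ) := by
  have h0 := h.pos hκ
  obtain ⟨θ, h1, h2, h3⟩ := h
  have := h1.rate 0 t₁ h0.le
  rw [h2, h3] at this
  rw [le_div_iff₀ (by positivity)]
  linarith

theorem apply_one (h : IsQuarterTime κ ξ t₁) : ξ t₁ 1 = 0 := by
  obtain ⟨θ, h1, h2, h3⟩ := h
  have := h1.re_eq t₁
  rw [h3, Real.cos_pi_div_two, mul_zero] at this
  exact this

theorem apply_three (h : IsQuarterTime κ ξ t₁) : ξ t₁ 3 = ‖vertical (ξ t₁)‖ := by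
  obtain ⟨θ, h1, h2, h3⟩ := h
  have := h1.im_eq t₁
  rw [h3, Real.sin_pi_div_two, mul_one] at this
  exact this

/-- Comparison of the quarter times of two curves. -/
theorem sub_mul_le (hκ : 0 < κ) (h : IsQuarterTime κ ξ t₁) (h' : IsQuarterTime κ ξ' t₁')
    (hle : t₁ ≤ t₁') :
    (t₁' - t₁) * ‖vertical (ξ' t₁)‖ ≤ Real.pi / (2 * κ) * ‖ξ t₁ - ξ' t₁‖ := by
  have h0 := h.pos hκ
  have e1 := h.apply_one
  obtain ⟨θ, k1, k2, k3⟩ := h'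
  have hmono := k1.strictMono hκ
  have e2 := k1.re_eq t₁
  have e3 := k1.rate t₁ t₁' hle
  have e4 := hmono.monotone h0.le
  have e5 := hmono.monotone hle
  rw [k3] at e3 e5
  rw [k2] at e4
  -- Jordan's inequality bounds the missing angle at time `t₁` by `p_z = ‖vertical‖ cos θ`
  have e6 := Real.mul_le_sin (x := Real.pi / 2 - θ t₁) (by linarith) (by linarith)
  rw [Real.sin_pi_div_two_sub] at e6
  have e7 : ξ' t₁ 1 ≤ ‖ξ t₁ - ξ' t₁‖ := by
    have := abs_apply_le_norm (ξ t₁ - ξ' t₁) 1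
    rw [PiLp.sub_apply, e1, zero_sub, abs_neg] at this
    exact (le_abs_self _).trans this
  have hpi := Real.pi_pos
  have e8 : (t₁' - t₁) * (2 * κ / Real.pi) ≤ Real.cos (θ t₁) := by
    refine le_trans ?_ e6
    have : (t₁' - t₁) * (2 * κ / Real.pi) = 2 / Real.pi * (κ * (t₁' - t₁)) := by ring
    rw [this]
    gcongr
  have e9 : ‖vertical (ξ' t₁)‖ * ((t₁' - t₁) * (2 * κ / Real.pi)) ≤ ‖ξ t₁ - ξ' t₁‖ := by
    refine le_trans (mul_le_mul_of_nonneg_left e8 (norm_nonneg _)) ?_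
    rw [← e2]
    exact e7
  calc (t₁' - t₁) * ‖vertical (ξ' t₁)‖
      = Real.pi / (2 * κ) * (‖vertical (ξ' t₁)‖ * ((t₁' - t₁) * (2 * κ / Real.pi))) := by
        field_simp
    _ ≤ _ := by gcongr

end IsQuarterTime

/-- The solution starts on the ray `p_r = z = 0`, `p_z > 0`. -/
structure IsLaunch (ξ : ℝ → Phase) : Prop where
  zero : ξ 0 0 = 0
  one : 0 < ξ 0 1
  three : ξ 0 3 = 0

theorem IsLaunch.norm_vertical {ξ : ℝ → Phase} (h : IsLaunch ξ) : ‖vertical (ξ 0)‖ = ξ 0 1 := by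
  rw [Complex.norm_eq_sqrt_sq_add_sq]
  simp [vertical, h.three, Real.sqrt_sq h.one.le]

/-- The energy relation at a launch. -/
theorem IsKeplerSolution.launch_energy {fh fr fz : ℝ → ℝ → ℝ → ℝ} {R ω h ε : ℝ} {ξ : ℝ → Phase}
    (hξ : IsKeplerSolution fh fr fz R ω h ε ξ) (hl : IsLaunch ξ) :
    (ξ 0 1) ^ 2 = 2 * (h - keplerV fh ω ε (ξ 0 2) 0) := by
  have hE := (hξ.mem 0).2.2
  rw [wellEnergy, hl.zero, hl.three] at hE
  linarith

/-- An upper bound for the quarter times. -/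
noncomputable def quarterBound (r₁ R : ℝ) : ℝ := Real.pi / (2 * keplerRate r₁ R)

/-- The constant in the exponential bounds over a quarter period. -/
noncomputable def quarterExp (r₁ R K : ℝ) : ℝ := Real.exp (2 * K * quarterBound r₁ R)

namespace KeplerBox

variable {fh fr fz : ℝ → ℝ → ℝ → ℝ} {r₁ R K ω h ε ω' h' ε' t₁ t₁' : ℝ} {ξ ξ' : ℝ → Phase}
  (B : KeplerBox fh fr fz r₁ R K)
include B

theorem rate_pos : 0 < keplerRate r₁ R := keplerRate_pos B.r₁_pos B.R_pos

theorem quarterBound_pos : 0 < quarterBound r₁ R := by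
  have := B.rate_pos
  have := Real.pi_pos
  unfold quarterBound
  positivity

theorem exp_le_quarterExp {t : ℝ} (ht : t ≤ quarterBound r₁ R) :
    Real.exp (2 * K * t) ≤ quarterExp r₁ R K :=
  Real.exp_le_exp.2 (mul_le_mul_of_nonneg_left ht (by linarith [B.K_pos]))

theorem exp_le_quarterExp' {t : ℝ} (h0 : 0 ≤ t) (ht : t ≤ quarterBound r₁ R) :
    Real.exp (K * t) ≤ quarterExp r₁ R K :=
  (Real.exp_le_exp.2 (by nlinarith [mul_nonneg B.K_pos.le h0])).trans (B.exp_le_quarterExp ht)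

section
variable (P : IsAdmissible r₁ R K ω h ε)
include P

theorem exists_quarterTime (hξ : IsKeplerSolution fh fr fz R ω h ε ξ) (hl : IsLaunch ξ) :
    ∃ t₁, IsQuarterTime (keplerRate r₁ R) ξ t₁ := by
  obtain ⟨rc, W⟩ := B.exists_hillFlow P
  have hn := hl.norm_vertical
  obtain ⟨θ, hθ⟩ := W.exists_isAngle hξ (norm_pos_iff.1 (hn ▸ hl.one))
  have e1 := hθ.re_eq 0
  have e2 : Real.cos (θ 0) = 1 := by
    have h1 : ξ 0 1 = ‖vertical (ξ 0)‖ * Real.cos (θ 0) := e1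
    rw [hn] at h1
    exact mul_left_cancel₀ hl.one.ne' (by linarith)
  obtain ⟨n, hn⟩ := (Real.cos_eq_one_iff _).1 e2
  have hθ' := hθ.add_two_pi (-n)
  obtain ⟨t₁, ht₁⟩ := hθ'.surjective B.rate_pos (Real.pi / 2)
  refine ⟨t₁, _, hθ', ?_, ht₁⟩
  push_cast
  rw [← hn]
  ring

theorem hasDerivAt_integral (hξ : IsKeplerSolution fh fr fz R ω h ε ξ) (t : ℝ) :
    HasDerivAt (fun t => keplerIntegral ω (ξ t)) (-(ε * keplerDrift fr fz ω ε (ξ t))) t :=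
  hasDerivAt_keplerIntegral (B.r₁_pos_of_mem (B.mem_phaseBox P (hξ.mem t))) (hξ.solves t)

theorem integral_quarter_eq_zero_iff (hξ : IsKeplerSolution fh fr fz R ω h ε ξ) (hl : IsLaunch ξ)
    (hq : IsQuarterTime (keplerRate r₁ R) ξ t₁) :
    keplerIntegral ω (ξ t₁) = 0 ↔ ξ t₁ 0 = 0 := by
  refine keplerIntegral_eq_zero_iff hq.apply_one
    (B.r₁_pos_of_mem (B.mem_phaseBox P (hξ.mem t₁))) ?_
  rw [hq.apply_three]
  have h1 := B.le_norm_vertical P hξ (hq.pos B.rate_pos).le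
  rw [hl.norm_vertical] at h1
  exact pos_of_mul_pos_left (hl.one.trans_le h1) (Real.exp_pos _).le

/-- The value of the Kepler integral at a launch. -/
theorem integral_launch (hξ : IsKeplerSolution fh fr fz R ω h ε ξ) (hl : IsLaunch ξ) :
    keplerIntegral ω (ξ 0) =
      ξ 0 1 * ξ 0 2 * (1 + 2 * ξ 0 2 * h - 2 * ξ 0 2 * (ε * fh (ξ 0 2) 0 ε)) := by
  have hE := hξ.launch_energy hl
  have hr := B.r₁_pos_of_mem (B.mem_phaseBox P (hξ.mem 0))
  have hs : √((ξ 0 2) ^ 2 + 0 ^ 2) = ξ 0 2 := by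
    rw [zero_pow two_ne_zero, add_zero, Real.sqrt_sq hr.le]
  rw [keplerV, hs] at hE
  have h1 : (ξ 0 2) ^ 2 * (ξ 0 1) ^ 2 + ω ^ 2 =
      2 * (ξ 0 2) ^ 2 * (h - ε * fh (ξ 0 2) 0 ε) + 2 * ξ 0 2 := by
    rw [hE]
    field_simp
    ring
  rw [keplerIntegral, hl.zero, hl.three, hs]
  linear_combination ξ 0 1 * h1

/-- Over a quarter period the Kepler integral changes by `O(ε)`, proportionally to the initial
vertical momentum. -/
theorem abs_integral_sub_le (hξ : IsKeplerSolution fh fr fz R ω h ε ξ) (hl : IsLaunch ξ)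
    (hq : IsQuarterTime (keplerRate r₁ R) ξ t₁) :
    |keplerIntegral ω (ξ t₁) - keplerIntegral ω (ξ 0)| ≤
      ε * (K * quarterExp r₁ R K * quarterBound r₁ R) * ξ 0 1 := by
  have h0 := (hq.pos B.rate_pos).le
  have hT : t₁ ≤ quarterBound r₁ R := hq.le B.rate_pos
  have hK := B.K_pos
  have h1 := norm_image_sub_le_of_norm_deriv_le_segment' (a := 0) (b := t₁)
    (C := ε * (K * (ξ 0 1 * quarterExp r₁ R K)))
    (fun t _ => (B.hasDerivAt_integral P hξ t).hasDerivWithinAt) (fun t ht => by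
      rw [norm_neg, Real.norm_eq_abs, abs_mul, abs_of_nonneg P.ε_mem.1]
      refine mul_le_mul_of_nonneg_left ?_ P.ε_mem.1
      refine (B.abs_keplerDrift_le (B.mem_phaseBox P (hξ.mem t)) P.param_mem).trans ?_
      refine mul_le_mul_of_nonneg_left ?_ hK.le
      refine (B.norm_vertical_le P hξ ht.1).trans ?_
      rw [hl.norm_vertical]
      exact mul_le_mul_of_nonneg_left (B.exp_le_quarterExp (ht.2.le.trans hT)) hl.one.le)
    t₁ ⟨h0, le_rfl⟩
  rw [Real.norm_eq_abs, sub_zero] at h1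
  refine h1.trans ?_
  have h2 : 0 ≤ ε * (K * (ξ 0 1 * quarterExp r₁ R K)) := by
    have := hl.one
    have := P.ε_mem.1
    have := Real.exp_pos (2 * K * quarterBound r₁ R)
    unfold quarterExp
    positivity
  calc _ ≤ ε * (K * (ξ 0 1 * quarterExp r₁ R K)) * quarterBound r₁ R := by gcongr
    _ = _ := by ring

/-- Up to `O(ε)`, the normalised value of the Kepler integral at the quarter time is `1 + 2 h r`,
where `r` is the radius of the launch. -/
theorem abs_quotient_sub_le (hξ : IsKeplerSolution fh fr fz R ω h ε ξ) (hl : IsLaunch ξ)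
    (hq : IsQuarterTime (keplerRate r₁ R) ξ t₁) :
    |keplerIntegral ω (ξ t₁) / (ξ 0 1 * ξ 0 2) - (1 + 2 * ξ 0 2 * h)| ≤
      ε * (2 * R * K + K * quarterExp r₁ R K * quarterBound r₁ R / r₁) := by
  have h1 := B.abs_integral_sub_le P hξ hl hq
  rw [B.integral_launch P hξ hl] at h1
  obtain ⟨-, -, hr2, -⟩ := mem_phaseBox_iff.1 (B.mem_phaseBox P (hξ.mem 0))
  have hr := B.r₁_pos
  have hr0 := hr.trans_le hr2.1
  have hp := hl.one
  have hfh := B.abs_perturbation_le P (hξ.mem 0).1 B.zero_mem_Icc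
  set g := 1 + 2 * ξ 0 2 * h - 2 * ξ 0 2 * (ε * fh (ξ 0 2) 0 ε) with hg
  have e1 : keplerIntegral ω (ξ t₁) - ξ 0 1 * ξ 0 2 * g =
      ξ 0 1 * ξ 0 2 * (keplerIntegral ω (ξ t₁) / (ξ 0 1 * ξ 0 2) - g) := by
    field_simp
  rw [e1, abs_mul, abs_of_pos (mul_pos hp hr0)] at h1
  have h2 : |keplerIntegral ω (ξ t₁) / (ξ 0 1 * ξ 0 2) - g| ≤
      ε * (K * quarterExp r₁ R K * quarterBound r₁ R) / r₁ := by
    rw [le_div_iff₀ hr]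
    refine le_of_mul_le_mul_left ?_ hp
    calc _ = ξ 0 1 * r₁ * |keplerIntegral ω (ξ t₁) / (ξ 0 1 * ξ 0 2) - g| := by ring
      _ ≤ ξ 0 1 * ξ 0 2 * |keplerIntegral ω (ξ t₁) / (ξ 0 1 * ξ 0 2) - g| := by
          gcongr
          exact hr2.1
      _ ≤ _ := by linarith
  have h3 : |2 * ξ 0 2 * (ε * fh (ξ 0 2) 0 ε)| ≤ 2 * R * (ε * K) := by
    rw [abs_mul, abs_of_pos (by positivity : 0 < 2 * ξ 0 2)]
    have := hr2.2
    have := B.R_pos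
    gcongr
  have h4 := abs_le.1 h2
  have h5 := abs_le.1 h3
  have e : ε * (2 * R * K + K * quarterExp r₁ R K * quarterBound r₁ R / r₁) =
    2 * R * (ε * K) + ε * (K * quarterExp r₁ R K * quarterBound r₁ R) / r₁ := by ring
  rw [e, abs_le]
  constructor <;> linarith [h4.1, h4.2, h5.1, h5.2]

end

section
variable (P : IsAdmissible r₁ R K ω h ε) (P' : IsAdmissible r₁ R K ω' h' ε')
include P P'

theorem norm_sub_le_quarter (hξ : IsKeplerSolution fh fr fz R ω h ε ξ)
    (hξ' : IsKeplerSolution fh fr fz R ω' h' ε' ξ') {t : ℝ} (h0 : 0 ≤ t)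
    (ht : t ≤ quarterBound r₁ R) : ‖ξ t - ξ' t‖ ≤
      (‖ξ 0 - ξ' 0‖ + K * ‖((ω, ε) : ℝ × ℝ) - (ω', ε')‖) * quarterExp r₁ R K := by
  have := B.K_pos
  refine (B.norm_sub_le P P' hξ hξ' h0).trans ?_
  gcongr
  exact B.exp_le_quarterExp' h0 ht

/-- Lipschitz dependence of the quarter time. The vertical momentum of the launch is bounded below
by `m`, which keeps `‖vertical‖` away from zero over a quarter period. -/
theorem quarterTime_sub_le (hξ : IsKeplerSolution fh fr fz R ω h ε ξ)
    (hξ' : IsKeplerSolution fh fr fz R ω' h' ε' ξ') (hl' : IsLaunch ξ')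
    (hq : IsQuarterTime (keplerRate r₁ R) ξ t₁) (hq' : IsQuarterTime (keplerRate r₁ R) ξ' t₁')
    (hle : t₁ ≤ t₁') {m : ℝ} (hm : 0 < m) (hm' : m ≤ ξ' 0 1) :
    t₁' - t₁ ≤ quarterBound r₁ R * quarterExp r₁ R K ^ 2 / m *
      (‖ξ 0 - ξ' 0‖ + K * ‖((ω, ε) : ℝ × ℝ) - (ω', ε')‖) := by
  have h0 := (hq.pos B.rate_pos).le
  have hT : t₁ ≤ quarterBound r₁ R := hq.le B.rate_pos
  have hTp := B.quarterBound_pos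
  have hE : 0 < quarterExp r₁ R K := Real.exp_pos _
  have h1 := hq.sub_mul_le B.rate_pos hq' hle
  have h2 := B.norm_sub_le_quarter P P' hξ hξ' h0 hT
  have h3 := B.le_norm_vertical P' hξ' h0
  rw [hl'.norm_vertical] at h3
  have h4 : m ≤ ‖vertical (ξ' t₁)‖ * quarterExp r₁ R K := hm'.trans (h3.trans (by
    gcongr
    exact B.exp_le_quarterExp hT))
  change (t₁' - t₁) * ‖vertical (ξ' t₁)‖ ≤ quarterBound r₁ R * ‖ξ t₁ - ξ' t₁‖ at h1
  set d := ‖ξ 0 - ξ' 0‖ + K * ‖((ω, ε) : ℝ × ℝ) - (ω', ε')‖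
  have h5 : 0 ≤ t₁' - t₁ := sub_nonneg.2 hle
  rw [div_mul_eq_mul_div, le_div_iff₀ hm]
  calc (t₁' - t₁) * m ≤ (t₁' - t₁) * (‖vertical (ξ' t₁)‖ * quarterExp r₁ R K) := by gcongr
    _ = (t₁' - t₁) * ‖vertical (ξ' t₁)‖ * quarterExp r₁ R K := by ring
    _ ≤ quarterBound r₁ R * ‖ξ t₁ - ξ' t₁‖ * quarterExp r₁ R K := by gcongr
    _ ≤ quarterBound r₁ R * (d * quarterExp r₁ R K) * quarterExp r₁ R K := by gcongr
    _ = _ := by ring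

theorem abs_integral_quarter_sub_le_of_le (hξ : IsKeplerSolution fh fr fz R ω h ε ξ)
    (hξ' : IsKeplerSolution fh fr fz R ω' h' ε' ξ') (hl' : IsLaunch ξ')
    (hq : IsQuarterTime (keplerRate r₁ R) ξ t₁) (hq' : IsQuarterTime (keplerRate r₁ R) ξ' t₁')
    (hle : t₁ ≤ t₁') {m : ℝ} (hm : 0 < m) (hm' : m ≤ ξ' 0 1) :
    |keplerIntegral ω (ξ t₁) - keplerIntegral ω' (ξ' t₁')| ≤
      (K * quarterExp r₁ R K + K * (quarterBound r₁ R * quarterExp r₁ R K ^ 2 / m) + 1) *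
        (‖ξ 0 - ξ' 0‖ + K * ‖((ω, ε) : ℝ × ℝ) - (ω', ε')‖) := by
  have h0 := (hq.pos B.rate_pos).le
  have hT : t₁ ≤ quarterBound r₁ R := hq.le B.rate_pos
  have h1 := B.norm_sub_le_quarter P P' hξ hξ' h0 hT
  have h2 := B.quarterTime_sub_le P P' hξ hξ' hl' hq hq' hle hm hm'
  have hK := B.K_pos
  have h3 := B.lip_integral (ξ t₁, ω, ε) ⟨B.mem_phaseBox P (hξ.mem t₁), P.param_mem⟩
    (ξ' t₁, ω', ε') ⟨B.mem_phaseBox P' (hξ'.mem t₁), P'.param_mem⟩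
  have h4 := norm_image_sub_le_of_norm_deriv_le_segment' (a := t₁) (b := t₁') (C := K)
    (fun t _ => (B.hasDerivAt_integral P' hξ' t).hasDerivWithinAt) (fun t ht => by
      rw [norm_neg, Real.norm_eq_abs, abs_mul, abs_of_nonneg P'.ε_mem.1]
      have h5 := B.bound_drift (ξ' t, ω', ε') ⟨B.mem_phaseBox P' (hξ'.mem t), P'.param_mem⟩
      have := P'.ε_mem.2
      have := P'.ε_mem.1
      simp only at h5
      nlinarith [abs_nonneg (keplerDrift fr fz ω' ε' (ξ' t))])
    t₁' ⟨hle, le_rfl⟩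
  rw [Real.norm_eq_abs, abs_sub_comm] at h4
  have h6 : ‖((ξ t₁, ω, ε) : ParamPhase) - (ξ' t₁, ω', ε')‖ ≤
      ‖ξ t₁ - ξ' t₁‖ + ‖((ω, ε) : ℝ × ℝ) - (ω', ε')‖ := by
    rw [Prod.mk_sub_mk, Prod.norm_mk]
    exact max_le_add_of_nonneg (norm_nonneg _) (norm_nonneg _)
  have h7 := abs_add_le (keplerIntegral ω (ξ t₁) - keplerIntegral ω' (ξ' t₁))
    (keplerIntegral ω' (ξ' t₁) - keplerIntegral ω' (ξ' t₁'))
  rw [sub_add_sub_cancel] at h7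
  set d := ‖ξ 0 - ξ' 0‖ + K * ‖((ω, ε) : ℝ × ℝ) - (ω', ε')‖ with hd
  have h8 : K * ‖((ω, ε) : ℝ × ℝ) - (ω', ε')‖ ≤ d := by
    rw [hd]
    linarith [norm_nonneg (ξ 0 - ξ' 0)]
  have h9 := mul_le_mul_of_nonneg_left h6 hK.le
  have h10 := mul_le_mul_of_nonneg_left h1 hK.le
  have h11 := mul_le_mul_of_nonneg_left h2 hK.le
  linarith

/-- Lipschitz dependence of the Kepler integral at the quarter time on the initial value and the
parameters. -/
theorem abs_integral_quarter_sub_le (hξ : IsKeplerSolution fh fr fz R ω h ε ξ)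
    (hξ' : IsKeplerSolution fh fr fz R ω' h' ε' ξ') (hl : IsLaunch ξ) (hl' : IsLaunch ξ')
    (hq : IsQuarterTime (keplerRate r₁ R) ξ t₁) (hq' : IsQuarterTime (keplerRate r₁ R) ξ' t₁')
    {m : ℝ} (hm0 : 0 < m) (hm : m ≤ ξ 0 1) (hm' : m ≤ ξ' 0 1) :
    |keplerIntegral ω (ξ t₁) - keplerIntegral ω' (ξ' t₁')| ≤
      (K * quarterExp r₁ R K + K * (quarterBound r₁ R * quarterExp r₁ R K ^ 2 / m) + 1) *
        (‖ξ 0 - ξ' 0‖ + K * ‖((ω, ε) : ℝ × ℝ) - (ω', ε')‖) := by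
  rcases le_total t₁ t₁' with h1 | h1
  · exact B.abs_integral_quarter_sub_le_of_le P P' hξ hξ' hl' hq hq' h1 hm0 hm'
  · rw [abs_sub_comm, norm_sub_rev (ξ 0), norm_sub_rev (ω, ε)]
    exact B.abs_integral_quarter_sub_le_of_le P' P hξ' hξ hl hq' hq h1 hm0 hm

end

end KeplerBox

namespace KeplerBox

variable {fh fr fz : ℝ → ℝ → ℝ → ℝ} {r₁ R K ω h ε t₁ t₁' m : ℝ} {ξ ξ' : ℝ → Phase}
  (B : KeplerBox fh fr fz r₁ R K)
include B

section
variable (P : IsAdmissible r₁ R K ω h ε) (hξ : IsKeplerSolution fh fr fz R ω h ε ξ)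
  (hξ' : IsKeplerSolution fh fr fz R ω h ε ξ') (hl : IsLaunch ξ) (hl' : IsLaunch ξ')
  (hm0 : 0 < m) (hm : m ≤ ξ 0 1) (hm' : m ≤ ξ' 0 1)
include P hξ hξ' hl hl' hm0 hm hm'

/-- By the energy relation the vertical momentum of a launch is a Lipschitz function of the radius.
-/
theorem abs_launch_one_sub_le : |ξ 0 1 - ξ' 0 1| ≤ K / m * |ξ 0 2 - ξ' 0 2| := by
  have hb := B.planarPart_mem (B.mem_phaseBox P (hξ.mem 0))
  have hb' := B.planarPart_mem (B.mem_phaseBox P (hξ'.mem 0))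
  have h1 := B.lip_V (planarPart (ξ 0), ω, ε) ⟨hb, P.param_mem⟩ (planarPart (ξ' 0), ω, ε)
    ⟨hb', P.param_mem⟩
  have h2 : ‖planarPart (ξ 0) - planarPart (ξ' 0)‖ = |ξ 0 2 - ξ' 0 2| := by
    rw [EuclideanSpace.norm_eq]
    simp [Fin.sum_univ_four, planarPart, hl.zero, hl'.zero, Real.sqrt_sq_eq_abs]
  rw [Prod.mk_sub_mk, sub_self, Prod.norm_mk, norm_zero, max_eq_left (norm_nonneg _), h2] at h1
  have h3 : |keplerV fh ω ε (ξ 0 2) 0 - keplerV fh ω ε (ξ' 0 2) 0| ≤ K * |ξ 0 2 - ξ' 0 2| := h1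
  have e : (ξ 0 1 - ξ' 0 1) * (ξ 0 1 + ξ' 0 1) =
      -(2 * (keplerV fh ω ε (ξ 0 2) 0 - keplerV fh ω ε (ξ' 0 2) 0)) := by
    linear_combination hξ.launch_energy hl - hξ'.launch_energy hl'
  have e2 := congrArg abs e
  rw [abs_mul, abs_neg, abs_mul, abs_two,
    abs_of_pos (by linarith : 0 < ξ 0 1 + ξ' 0 1)] at e2
  rw [div_mul_eq_mul_div, le_div_iff₀ hm0]
  nlinarith [abs_nonneg (ξ 0 1 - ξ' 0 1)]

theorem norm_launch_sub_le : ‖ξ 0 - ξ' 0‖ ≤ (1 + K / m) * |ξ 0 2 - ξ' 0 2| := by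
  have h1 := B.abs_launch_one_sub_le P hξ hξ' hl hl' hm0 hm hm'
  have h2 : ‖ξ 0 - ξ' 0‖ ≤ |ξ 0 1 - ξ' 0 1| + |ξ 0 2 - ξ' 0 2| := by
    rw [EuclideanSpace.norm_eq]
    refine Real.sqrt_le_iff.2 ⟨by positivity, ?_⟩
    simp only [Fin.sum_univ_four, PiLp.sub_apply, hl.zero, hl'.zero, hl.three, hl'.three, sub_self,
      Real.norm_eq_abs, abs_zero]
    nlinarith [mul_nonneg (abs_nonneg (ξ 0 1 - ξ' 0 1)) (abs_nonneg (ξ 0 2 - ξ' 0 2))]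
  linarith

omit hl hm in
/-- Up to the smaller quarter time the two integrands `ε * keplerDrift` are compared; the remaining
time interval has length `O(‖ξ 0 - ξ' 0‖)`. -/
theorem abs_change_sub_le_of_le (hq : IsQuarterTime (keplerRate r₁ R) ξ t₁)
    (hq' : IsQuarterTime (keplerRate r₁ R) ξ' t₁') (hle : t₁ ≤ t₁') :
    |(keplerIntegral ω (ξ 0) - keplerIntegral ω (ξ t₁)) -
      (keplerIntegral ω (ξ' 0) - keplerIntegral ω (ξ' t₁'))| ≤
      ε * (K * quarterExp r₁ R K * quarterBound r₁ R +
        K * (quarterBound r₁ R * quarterExp r₁ R K ^ 2 / m)) * ‖ξ 0 - ξ' 0‖ := by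
  have h0 := (hq.pos B.rate_pos).le
  have hT : t₁ ≤ quarterBound r₁ R := hq.le B.rate_pos
  have hK := B.K_pos
  have hε := P.ε_mem.1
  have hE : 0 < quarterExp r₁ R K := Real.exp_pos _
  have h1 := norm_image_sub_le_of_norm_deriv_le_segment' (a := 0) (b := t₁)
    (C := ε * (K * (‖ξ 0 - ξ' 0‖ * quarterExp r₁ R K)))
    (fun t _ => ((B.hasDerivAt_integral P hξ t).sub (B.hasDerivAt_integral P hξ' t)).hasDerivWithinAt)
    (fun t ht => by
      have e : -(ε * keplerDrift fr fz ω ε (ξ t)) - -(ε * keplerDrift fr fz ω ε (ξ' t)) =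
        -(ε * (keplerDrift fr fz ω ε (ξ t) - keplerDrift fr fz ω ε (ξ' t))) := by ring
      rw [e, norm_neg, Real.norm_eq_abs, abs_mul, abs_of_nonneg hε]
      refine mul_le_mul_of_nonneg_left ?_ hε
      have h2 := B.lip_drift (ξ t, ω, ε) ⟨B.mem_phaseBox P (hξ.mem t), P.param_mem⟩
        (ξ' t, ω, ε) ⟨B.mem_phaseBox P (hξ'.mem t), P.param_mem⟩
      rw [Prod.mk_sub_mk, sub_self, Prod.norm_mk, norm_zero, max_eq_left (norm_nonneg _)] at h2
      refine h2.trans (mul_le_mul_of_nonneg_left ?_ hK.le)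
      have h3 := B.norm_sub_le_quarter P P hξ hξ' ht.1 (ht.2.le.trans hT)
      rwa [sub_self, norm_zero, mul_zero, add_zero] at h3)
    t₁ ⟨h0, le_rfl⟩
  have h2 := B.quarterTime_sub_le P P hξ hξ' hl' hq hq' hle hm0 hm'
  rw [sub_self, norm_zero, mul_zero, add_zero] at h2
  have h4 := norm_image_sub_le_of_norm_deriv_le_segment' (a := t₁) (b := t₁') (C := ε * K)
    (fun t _ => (B.hasDerivAt_integral P hξ' t).hasDerivWithinAt) (fun t ht => by
      rw [norm_neg, Real.norm_eq_abs, abs_mul, abs_of_nonneg hε]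
      exact mul_le_mul_of_nonneg_left
        (B.bound_drift (ξ' t, ω, ε) ⟨B.mem_phaseBox P (hξ'.mem t), P.param_mem⟩) hε)
    t₁' ⟨hle, le_rfl⟩
  rw [Real.norm_eq_abs, sub_zero] at h1
  rw [Real.norm_eq_abs] at h4
  simp only [Pi.sub_apply] at h1
  have h5 : ε * (K * (‖ξ 0 - ξ' 0‖ * quarterExp r₁ R K)) * t₁ ≤
      ε * (K * (‖ξ 0 - ξ' 0‖ * quarterExp r₁ R K)) * quarterBound r₁ R := by gcongr
  have h6 : ε * K * (t₁' - t₁) ≤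
      ε * K * (quarterBound r₁ R * quarterExp r₁ R K ^ 2 / m * ‖ξ 0 - ξ' 0‖) := by gcongr
  have h7 := abs_le.1 h1
  have h8 := abs_le.1 h4
  rw [abs_le]
  constructor <;> linarith [h7.1, h7.2, h8.1, h8.2]

/-- The change of the Kepler integral over a quarter period is a Lipschitz function of the launch,
with a Lipschitz constant proportional to `ε`. -/
theorem abs_change_sub_le (hq : IsQuarterTime (keplerRate r₁ R) ξ t₁)
    (hq' : IsQuarterTime (keplerRate r₁ R) ξ' t₁') :
    |(keplerIntegral ω (ξ 0) - keplerIntegral ω (ξ t₁)) -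
      (keplerIntegral ω (ξ' 0) - keplerIntegral ω (ξ' t₁'))| ≤
      ε * (K * quarterExp r₁ R K * quarterBound r₁ R +
        K * (quarterBound r₁ R * quarterExp r₁ R K ^ 2 / m)) * ‖ξ 0 - ξ' 0‖ := by
  rcases le_total t₁ t₁' with h1 | h1
  · exact B.abs_change_sub_le_of_le P hξ hξ' hl' hm0 hm' hq hq' h1
  · rw [abs_sub_comm, norm_sub_rev]
    exact B.abs_change_sub_le_of_le P hξ' hξ hl hm0 hm hq' hq h1

/-- The normalised Kepler integral at the quarter time is strictly decreasing in the radius of the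
launch, at a rate `-2h - O(ε)`. -/
theorem le_quotient_sub (hq : IsQuarterTime (keplerRate r₁ R) ξ t₁)
    (hq' : IsQuarterTime (keplerRate r₁ R) ξ' t₁') (hr : ξ 0 2 ≤ ξ' 0 2) :
    (-2 * h - ε * (2 * (K + R * K) +
      (K * quarterExp r₁ R K * quarterBound r₁ R +
        K * (quarterBound r₁ R * quarterExp r₁ R K ^ 2 / m)) * (1 + K / m) / (m * r₁) +
      K * quarterExp r₁ R K * quarterBound r₁ R * (K / m / (m * r₁) + 1 / r₁ ^ 2))) *
        (ξ' 0 2 - ξ 0 2) ≤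
      keplerIntegral ω (ξ t₁) / (ξ 0 1 * ξ 0 2) - keplerIntegral ω (ξ' t₁') / (ξ' 0 1 * ξ' 0 2) := by
  have h1 := B.abs_change_sub_le P hξ hξ' hl hl' hm0 hm hm' hq hq'
  have h2 := B.norm_launch_sub_le P hξ hξ' hl hl' hm0 hm hm'
  have h3 := B.abs_launch_one_sub_le P hξ hξ' hl hl' hm0 hm hm'
  have h4 := B.abs_integral_sub_le P hξ' hl' hq'
  have hi := B.integral_launch P hξ hl
  have hi' := B.integral_launch P hξ' hl'
  obtain ⟨-, -, hb, -⟩ := mem_phaseBox_iff.1 (B.mem_phaseBox P (hξ.mem 0))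
  obtain ⟨-, -, hb', -⟩ := mem_phaseBox_iff.1 (B.mem_phaseBox P (hξ'.mem 0))
  have hlip := B.lip_h _ hb _ hb' ε P.ε_mem
  have hfh := B.bound_h _ hb' 0 B.zero_mem_Icc ε P.ε_mem
  have hK := B.K_pos
  have hε := P.ε_mem.1
  have hr₁ := B.r₁_pos
  have hR := B.R_pos
  have hT := B.quarterBound_pos
  have hE : 0 < quarterExp r₁ R K := Real.exp_pos _
  have hd : 0 ≤ ξ' 0 2 - ξ 0 2 := sub_nonneg.2 hr
  have ed : |ξ 0 2 - ξ' 0 2| = ξ' 0 2 - ξ 0 2 := by rw [abs_sub_comm, abs_of_nonneg hd]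
  rw [ed] at h2 h3 hlip
  rw [abs_sub_comm] at h4
  set L := K * quarterExp r₁ R K * quarterBound r₁ R +
        K * (quarterBound r₁ R * quarterExp r₁ R K ^ 2 / m) with hL
  set Q := K * quarterExp r₁ R K * quarterBound r₁ R with hQ
  have hL0 : 0 ≤ L := by positivity
  have hQ0 : 0 ≤ Q := by positivity
  set N := keplerIntegral ω (ξ 0) - keplerIntegral ω (ξ t₁) with hN
  set N' := keplerIntegral ω (ξ' 0) - keplerIntegral ω (ξ' t₁') with hN'
  set p := ξ 0 1
  set p' := ξ' 0 1
  set r := ξ 0 2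
  set r' := ξ' 0 2
  have hp : 0 < p := hl.one
  have hp' : 0 < p' := hl'.one
  have hr0 : 0 < r := hr₁.trans_le hb.1
  have hr0' : 0 < r' := hr₁.trans_le hb'.1
  have e1 : keplerIntegral ω (ξ t₁) / (p * r) =
      1 + 2 * r * h - 2 * r * (ε * fh r 0 ε) - N / (p * r) := by
    rw [hN, hi]
    field_simp
    ring
  have e2 : keplerIntegral ω (ξ' t₁') / (p' * r') =
      1 + 2 * r' * h - 2 * r' * (ε * fh r' 0 ε) - N' / (p' * r') := by
    rw [hN', hi']
    field_simp
    ring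
  -- apart from `1 + 2 r h`, all contributions are Lipschitz in `r` with a constant `O(ε)`
  have b1 : |2 * r * (ε * fh r 0 ε) - 2 * r' * (ε * fh r' 0 ε)| ≤
      ε * (2 * (K + R * K)) * (r' - r) := by
    have e : 2 * r * (ε * fh r 0 ε) - 2 * r' * (ε * fh r' 0 ε) =
      2 * ε * (r * (fh r 0 ε - fh r' 0 ε) + -((r' - r) * fh r' 0 ε)) := by ring
    rw [e, abs_mul, abs_of_nonneg (by positivity : 0 ≤ 2 * ε)]
    calc _ ≤ 2 * ε * (|r * (fh r 0 ε - fh r' 0 ε)| + |-((r' - r) * fh r' 0 ε)|) := by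
          gcongr
          exact abs_add_le _ _
      _ = 2 * ε * (r * |fh r 0 ε - fh r' 0 ε| + (r' - r) * |fh r' 0 ε|) := by
          rw [abs_neg, abs_mul, abs_mul, abs_of_pos hr0, abs_of_nonneg hd]
      _ ≤ 2 * ε * (R * (K * (r' - r)) + (r' - r) * K) := by
          have := hb.2
          gcongr
      _ = _ := by ring
  have b2 : |(N - N') / (p * r)| ≤ ε * (L * (1 + K / m) / (m * r₁)) * (r' - r) := by
    rw [abs_div, abs_of_pos (mul_pos hp hr0)]
    calc |N - N'| / (p * r) ≤ ε * L * ((1 + K / m) * (r' - r)) / (m * r₁) := by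
          have := hb.1
          gcongr
          exact h1.trans (by gcongr)
      _ = _ := by ring
  have b3 : |N' * (1 / (p * r) - 1 / (p' * r'))| ≤
      ε * (Q * (K / m / (m * r₁) + 1 / r₁ ^ 2)) * (r' - r) := by
    have e : 1 / (p * r) - 1 / (p' * r') = ((p' - p) / (p * r) + (r' - r) / (r * r')) / p' := by
      field_simp
      ring
    rw [e, mul_div_assoc', abs_div, abs_of_pos hp', abs_mul, div_le_iff₀ hp']
    have b4 : |(p' - p) / (p * r) + (r' - r) / (r * r')| ≤
        (K / m / (m * r₁) + 1 / r₁ ^ 2) * (r' - r) := by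
      refine (abs_add_le _ _).trans ?_
      rw [abs_div, abs_div, abs_of_pos (mul_pos hp hr0), abs_of_pos (mul_pos hr0 hr0'),
        abs_of_nonneg hd, abs_sub_comm p' p]
      have c1 : |p - p'| / (p * r) ≤ K / m * (r' - r) / (m * r₁) := by
        have := hb.1
        gcongr
      have c2 : (r' - r) / (r * r') ≤ (r' - r) / (r₁ * r₁) := by
        have := hb.1
        have := hb'.1
        gcongr
      calc _ ≤ K / m * (r' - r) / (m * r₁) + (r' - r) / (r₁ * r₁) := add_le_add c1 c2
        _ = _ := by field_simp
    calc _ ≤ ε * Q * p' * ((K / m / (m * r₁) + 1 / r₁ ^ 2) * (r' - r)) := by gcongr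
      _ = _ := by ring
  have e3 : N / (p * r) - N' / (p' * r') =
      (N - N') / (p * r) + N' * (1 / (p * r) - 1 / (p' * r')) := by ring
  have a1 := abs_le.1 b1
  have a2 := abs_le.1 b2
  have a3 := abs_le.1 b3
  rw [e1, e2]
  linarith [a1.1, a1.2, a2.1, a2.2, a3.1, a3.2]

end

end KeplerBox

/-- The root of a family of functions that change sign from positive to negative depends
continuously on the parameter. -/
theorem continuousOn_of_sign_change {α : Type*} [TopologicalSpace α] {U : Set α} {a b : ℝ}
    {S : α → ℝ → ℝ} {ρ : α → ℝ} (hρ : ∀ q ∈ U, ρ q ∈ Ioo a b)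
    (hS : ∀ r ∈ Icc a b, ContinuousOn (fun q => S q r) U)
    (hpos : ∀ q ∈ U, ∀ r ∈ Icc a b, 0 < S q r → r < ρ q)
    (hneg : ∀ q ∈ U, ∀ r ∈ Icc a b, S q r < 0 → ρ q < r)
    (hpos' : ∀ q ∈ U, ∀ r ∈ Icc a b, r < ρ q → 0 < S q r)
    (hneg' : ∀ q ∈ U, ∀ r ∈ Icc a b, ρ q < r → S q r < 0) : ContinuousOn ρ U := by
  intro q hq
  obtain ⟨ha, hb⟩ := hρ q hq
  refine (nhds_basis_Ioo (ρ q)).tendsto_right_iff.2 fun i hi => ?_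
  obtain ⟨l, hl, hl'⟩ := exists_between (max_lt hi.1 ha)
  obtain ⟨u, hu, hu'⟩ := exists_between (lt_min hi.2 hb)
  have hlm : l ∈ Icc a b := ⟨((le_max_right _ _).trans_lt hl).le, (hl'.trans hb).le⟩
  have hum : u ∈ Icc a b := ⟨(ha.trans hu).le, (hu'.trans_le (min_le_right _ _)).le⟩
  filter_upwards [(hS l hlm q hq).eventually_const_lt (hpos' q hq l hlm hl'),
    (hS u hum q hq).eventually_lt_const (hneg' q hq u hum hu), self_mem_nhdsWithin] with s s1 s2 hs
  exact ⟨((le_max_left _ _).trans_lt hl).trans (hpos s hs l hlm s1),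
    (hneg s hs u hum s2).trans (hu'.trans_le (min_le_left _ _))⟩

/-- The point of the energy surface with `p_r = z = 0`, `p_z ≥ 0` over the radius `r`. -/
noncomputable def launchPoint (fh : ℝ → ℝ → ℝ → ℝ) (ω h ε r : ℝ) : Phase :=
  !₂[0, √(2 * (h - keplerV fh ω ε r 0)), r, 0]

theorem IsKeplerSolution.eq_launchPoint {fh fr fz : ℝ → ℝ → ℝ → ℝ} {R ω h ε : ℝ} {ξ : ℝ → Phase}
    (hξ : IsKeplerSolution fh fr fz R ω h ε ξ) (hl : IsLaunch ξ) :
    ξ 0 = launchPoint fh ω h ε (ξ 0 2) := by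
  refine Phase.ext ?_ ?_ ?_ ?_
  · simpa [launchPoint] using hl.zero
  · simp [launchPoint, ← hξ.launch_energy hl, Real.sqrt_sq hl.one.le]
  · simp [launchPoint]
  · simpa [launchPoint] using hl.three

theorem launchPoint_mem {fh : ℝ → ℝ → ℝ → ℝ} {R ω h ε r : ℝ} (hr : r ∈ Icc (ω ^ 2 / 2) R)
    (hR : 0 ≤ R) (hV : keplerV fh ω ε r 0 ≤ h) : launchPoint fh ω h ε r ∈ keplerLevel fh R ω h ε := by
  refine ⟨hr, ⟨by simpa [launchPoint] using hR, by simpa [launchPoint] using hR⟩, ?_⟩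
  have e := Real.sq_sqrt (show 0 ≤ 2 * (h - keplerV fh ω ε r 0) by linarith)
  simp only [launchPoint, wellEnergy, Matrix.cons_val, e]
  ring

theorem eventually_isAdmissible {r₁ R ω₀ h₀ : ℝ} (K : ℝ) (hr₁ : 0 < r₁) (h1 : r₁ < ω₀ ^ 2 / 2)
    (h2 : 4 * ω₀ ^ 2 < R) (h3 : h₀ * R < -2) (h4 : -(1 / (2 * ω₀ ^ 2)) < h₀) :
    ∀ᶠ q : ℝ × ℝ × ℝ in 𝓝[{q | 0 ≤ q.1}] (0, ω₀, h₀), IsAdmissible r₁ R K q.2.1 q.2.2 q.1 := by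
  have hω : ω₀ ≠ 0 := by
    rintro rfl
    norm_num at h1
    linarith
  have lt : ∀ {u v : ℝ × ℝ × ℝ → ℝ}, ContinuousAt u (0, ω₀, h₀) → ContinuousAt v (0, ω₀, h₀) →
      u (0, ω₀, h₀) < v (0, ω₀, h₀) → ∀ᶠ q in 𝓝[{q | 0 ≤ q.1}] (0, ω₀, h₀), u q < v q :=
    fun hu hv huv => (hu.eventually_lt hv huv).filter_mono nhdsWithin_le_nhds
  have c1 : ContinuousAt (fun q : ℝ × ℝ × ℝ => -(1 / (2 * q.2.1 ^ 2)) + q.1 * K) (0, ω₀, h₀) := by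
    refine ContinuousAt.add (ContinuousAt.neg (continuousAt_const.div ?_ ?_)) ?_
    · fun_prop
    · simpa using hω
    · fun_prop
  have e0 := lt (u := fun q => q.1) (v := fun _ => 1 / 2) (by fun_prop) (by fun_prop) (by norm_num)
  have e1 := lt (u := fun _ => r₁) (v := fun q => q.2.1 ^ 2 / 2) (by fun_prop) (by fun_prop) h1
  have e2 := lt (u := fun q => 4 * q.2.1 ^ 2) (v := fun _ => R) (by fun_prop) (by fun_prop) h2
  have e3 := lt (u := fun q => q.2.2 * R) (v := fun _ => -2) (by fun_prop) (by fun_prop) h3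
  have e4 := lt (v := fun q => q.2.2) c1 (by fun_prop) (by simpa using h4)
  have e5 := lt (u := fun q => q.1 * K) (v := fun _ => 1) (by fun_prop) (by fun_prop) (by norm_num)
  have e6 := lt (u := fun q => q.1 * K * R) (v := fun _ => 1) (by fun_prop) (by fun_prop)
    (by norm_num)
  have e7 := lt (u := fun q => 2 * (q.1 * K) * R ^ 2) (v := fun _ => 1) (by fun_prop) (by fun_prop)
    (by norm_num)
  have e8 := lt (u := fun q => 8 * (q.1 * K) * R ^ 3) (v := fun _ => 1) (by fun_prop) (by fun_prop)
    (by norm_num)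
  have e9 := lt (u := fun q => q.1 * K * (R ^ 2 + 2 * R) * R ^ 2) (v := fun _ => r₁) (by fun_prop)
    (by fun_prop) (by simpa using hr₁)
  filter_upwards [e0, e1, e2, e3, e4, e5, e6, e7, e8, e9, self_mem_nhdsWithin] with q
    k0 k1 k2 k3 k4 k5 k6 k7 k8 k9 hq
  exact ⟨⟨hq, k0.le⟩, k1.le, k2.le, k3.le, k4, k5.le, k6, k7.le, k8.le, k9.le⟩

namespace KeplerBox

variable {fh fr fz : ℝ → ℝ → ℝ → ℝ} {r₁ R K : ℝ} (B : KeplerBox fh fr fz r₁ R K)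
include B

set_option maxHeartbeats 1600000 in
/-- Near the parameters `ε = 0`, `(ω₀, h₀)` there is exactly one launch satisfying the
quarter-period condition, and it depends continuously on the parameters. -/
theorem exists_brake_launch {ω₀ h₀ : ℝ} (h1 : r₁ < ω₀ ^ 2 / 2) (h2 : 8 * ω₀ ^ 2 < R)
    (h3 : h₀ * R = -4) : ∃ δ > 0, ∃ X : ℝ × ℝ × ℝ → Phase,
      ContinuousOn X (Metric.ball (0, ω₀, h₀) δ ∩ {q | 0 ≤ q.1}) ∧
      ∀ q ∈ Metric.ball (0, ω₀, h₀) δ ∩ {q : ℝ × ℝ × ℝ | 0 ≤ q.1},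
        IsAdmissible r₁ R K q.2.1 q.2.2 q.1 ∧
        (∃ ξ, IsKeplerSolution fh fr fz R q.2.1 q.2.2 q.1 ξ ∧ ξ 0 = X q ∧ IsLaunch ξ ∧
          IsQuarterBrake (keplerRate r₁ R) ξ) ∧
        ∀ ξ, IsKeplerSolution fh fr fz R q.2.1 q.2.2 q.1 ξ → IsLaunch ξ →
          IsQuarterBrake (keplerRate r₁ R) ξ → ξ 0 = X q := by
  have hr₁ := B.r₁_pos
  have hR := B.R_pos
  have hK := B.K_pos
  have hω : 0 < ω₀ ^ 2 := by linarith
  have hh₀ : h₀ = -4 / R := by rw [eq_div_iff hR.ne', h3]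
  -- the depth of the well at the radius `R / 8 = -1 / (2 h₀)`
  set v := h₀ - keplerV fh ω₀ 0 (R / 8) 0 with hv
  have hv0 : 0 < v := by
    have hs : √((R / 8) ^ 2 + 0 ^ 2) = R / 8 := by
      rw [zero_pow two_ne_zero, add_zero, Real.sqrt_sq (by positivity)]
    have e : v = 4 / R * (1 - 8 * ω₀ ^ 2 / R) := by
      rw [hv, keplerV, hs, hh₀]
      field_simp
      ring
    have : 8 * ω₀ ^ 2 / R < 1 := (div_lt_one hR).2 h2
    rw [e]
    exact mul_pos (by positivity) (by linarith)
  set m := √v with hm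
  have hm0 : 0 < m := Real.sqrt_pos.2 hv0
  -- `[a, b]` is so short that the well remains at least `v / 2` deep over it
  set δ₁ := min (R / 32) (v / (4 * K)) with hδ₁
  have hδ₁0 : 0 < δ₁ := by positivity
  set a := R / 8 - δ₁ with ha
  set b := R / 8 + δ₁ with hb
  have hab : a < b := by linarith
  have hδR : δ₁ ≤ R / 32 := min_le_left _ _
  have hδv : δ₁ ≤ v / (4 * K) := min_le_right _ _
  -- `ε M₀` is the error in `abs_quotient_sub_le`, `ε M` the one in `le_quotient_sub`
  set M₀ := 2 * R * K + K * quarterExp r₁ R K * quarterBound r₁ R / r₁ with hM₀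
  set M := 2 * (K + R * K) +
      (K * quarterExp r₁ R K * quarterBound r₁ R +
        K * (quarterBound r₁ R * quarterExp r₁ R K ^ 2 / m)) * (1 + K / m) / (m * r₁) +
      K * quarterExp r₁ R K * quarterBound r₁ R * (K / m / (m * r₁) + 1 / r₁ ^ 2) with hM
  have lt : ∀ {u w : ℝ × ℝ × ℝ → ℝ}, ContinuousAt u (0, ω₀, h₀) → ContinuousAt w (0, ω₀, h₀) →
      u (0, ω₀, h₀) < w (0, ω₀, h₀) → ∀ᶠ q in 𝓝[{q | 0 ≤ q.1}] (0, ω₀, h₀), u q < w q :=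
    fun hu hv huv => (hu.eventually_lt hv huv).filter_mono nhdsWithin_le_nhds
  have e1 := eventually_isAdmissible (ω₀ := ω₀) (h₀ := h₀) (R := R) K hr₁ h1 (by linarith)
    (by linarith) (by
      rw [hh₀, ← neg_div', neg_lt_neg_iff, div_lt_div_iff₀ hR (by positivity)]
      linarith)
  have hvK : 0 < v / (4 * K) := by positivity
  have e2 := lt (u := fun q => |q.2.1 - ω₀|) (w := fun _ => v / (4 * K)) (by fun_prop) (by fun_prop)
    (by simpa using hvK)
  have e3 := lt (u := fun q => |q.1|) (w := fun _ => v / (4 * K)) (by fun_prop) (by fun_prop)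
    (by simpa using hvK)
  have e4 := lt (u := fun q => |q.2.2 - h₀|) (w := fun _ => v / 4) (by fun_prop) (by fun_prop)
    (by simpa using hv0)
  have e5 := lt (u := fun q => q.2.1 ^ 2 / 2) (w := fun _ => R / 16) (by fun_prop) (by fun_prop)
    (by simp only; linarith)
  have e6 := lt (u := fun q => q.1 * M) (w := fun q => -2 * q.2.2) (by fun_prop) (by fun_prop)
    (by
      have : 0 < 4 / R := by positivity
      simp only [hh₀, zero_mul]
      rw [neg_div]
      linarith)
  have e7 := lt (u := fun q => q.1 * M₀ + 2 * R * |q.2.2 - h₀|) (w := fun _ => 8 / R * δ₁)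
    (by fun_prop) (by fun_prop) (by simp; positivity)
  obtain ⟨δ, hδ, hU⟩ := Metric.mem_nhdsWithin_iff.1
    (e1.and (e2.and (e3.and (e4.and (e5.and (e6.and e7))))))
  set U := Metric.ball ((0 : ℝ), ω₀, h₀) δ ∩ {q : ℝ × ℝ × ℝ | 0 ≤ q.1} with hUdef
  have hP : ∀ q ∈ U, IsAdmissible r₁ R K q.2.1 q.2.2 q.1 := fun q hq => (hU hq).1
  have hI : ∀ q ∈ U, ∀ r ∈ Icc a b, r ∈ Icc (q.2.1 ^ 2 / 2) R := fun q hq r hr => by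
    obtain ⟨-, -, -, -, k5, -⟩ := hU hq
    constructor <;> linarith [hr.1, hr.2]
  -- the vertical momentum of a launch over `[a, b]` is bounded below
  have hdepth : ∀ q ∈ U, ∀ r ∈ Icc a b, v / 2 ≤ q.2.2 - keplerV fh q.2.1 q.1 r 0 := by
    intro q hq r hr
    obtain ⟨-, k2, k3, k4, -⟩ := hU hq
    have hmem : ∀ s ∈ Icc r₁ R, (!₂[0, 0, s, 0] : Phase) ∈ phaseBox r₁ R := fun s hs => by
      rw [mem_phaseBox_iff]
      simp only [Matrix.cons_val, abs_zero]
      exact ⟨by positivity, by positivity, hs, B.zero_mem_Icc⟩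
    have hp₀ : (ω₀, (0 : ℝ)) ∈ paramBox R := by
      refine ⟨?_, le_rfl, by norm_num⟩
      constructor <;> nlinarith [sq_nonneg (ω₀ - 1), sq_nonneg (ω₀ + 1)]
    have hlip := B.lip_V (!₂[0, 0, r, 0], q.2.1, q.1)
      ⟨hmem r ((hP q hq).mem_Icc_of_mem_window (hI q hq r hr)), (hP q hq).param_mem⟩
      (!₂[0, 0, R / 8, 0], ω₀, 0) ⟨hmem (R / 8) ⟨by linarith, by linarith⟩, hp₀⟩
    have hn : ‖((!₂[0, 0, r, 0], q.2.1, q.1) : ParamPhase) - (!₂[0, 0, R / 8, 0], ω₀, 0)‖ ≤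
        v / (4 * K) := by
      have hx : ‖(!₂[0, 0, r, 0] : Phase) - !₂[0, 0, R / 8, 0]‖ = |r - R / 8| := by
        rw [EuclideanSpace.norm_eq]
        simp [Fin.sum_univ_four, Real.sqrt_sq_eq_abs]
      rw [Prod.mk_sub_mk, Prod.mk_sub_mk, Prod.norm_mk, Prod.norm_mk, hx]
      refine max_le ((abs_le.2 ⟨?_, ?_⟩).trans hδv) (max_le k2.le ?_)
      · linarith [hr.1]
      · linarith [hr.2]
      · rw [sub_zero]
        exact k3.le
    have hlip' := (abs_le.1 (hlip.trans (mul_le_mul_of_nonneg_left hn hK.le))).2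
    have e : K * (v / (4 * K)) = v / 4 := by field_simp
    simp only [Matrix.cons_val, e] at hlip'
    have k4' := (abs_le.1 k4.le).1
    linarith
  have hmp : ∀ q ∈ U, ∀ r ∈ Icc a b, m ≤ √(2 * (q.2.2 - keplerV fh q.2.1 q.1 r 0)) :=
    fun q hq r hr => Real.sqrt_le_sqrt (by linarith [hdepth q hq r hr])
  have hex : ∀ q ∈ U, ∀ r ∈ Icc a b, ∃ ξ t₁, IsKeplerSolution fh fr fz R q.2.1 q.2.2 q.1 ξ ∧
      ξ 0 = launchPoint fh q.2.1 q.2.2 q.1 r ∧ IsLaunch ξ ∧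
      IsQuarterTime (keplerRate r₁ R) ξ t₁ := by
    intro q hq r hr
    obtain ⟨ξ, hξ, hξ0⟩ := B.exists_keplerSolution (hP q hq)
      (launchPoint_mem (hI q hq r hr) hR.le (by linarith [hdepth q hq r hr]))
    have hl : IsLaunch ξ := ⟨by simp [hξ0, launchPoint],
      by
        simp only [hξ0, launchPoint, Matrix.cons_val]
        exact hm0.trans_le (hmp q hq r hr), by simp [hξ0, launchPoint]⟩
    obtain ⟨t₁, ht₁⟩ := B.exists_quarterTime (hP q hq) hξ hl
    exact ⟨ξ, t₁, hξ, hξ0, hl, ht₁⟩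
  -- `Ξ q r` is the launch at the radius `r`, `τ q r` its quarter time, and `S`, `G` are the Kepler
  -- integral there and its normalisation; the quarter-period condition reads `S q r = 0`
  choose! Ξ τ hΞ hΞ0 hΞl hτ using hex
  have hΞ1 : ∀ q ∈ U, ∀ r ∈ Icc a b, m ≤ Ξ q r 0 1 := fun q hq r hr => by
    simp only [hΞ0 q hq r hr, launchPoint, Matrix.cons_val]
    exact hmp q hq r hr
  have hΞ2 : ∀ q ∈ U, ∀ r ∈ Icc a b, Ξ q r 0 2 = r := fun q hq r hr => by
    simp [hΞ0 q hq r hr, launchPoint]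
  have hpr : ∀ q ∈ U, ∀ r ∈ Icc a b, 0 < Ξ q r 0 1 * Ξ q r 0 2 := fun q hq r hr => by
    refine mul_pos (hΞl q hq r hr).one ?_
    rw [hΞ2 q hq r hr]
    exact B.pos_of_mem_window (hP q hq) (hI q hq r hr)
  set S : ℝ × ℝ × ℝ → ℝ → ℝ := fun q r => keplerIntegral q.2.1 (Ξ q r (τ q r)) with hS
  set G : ℝ × ℝ × ℝ → ℝ → ℝ := fun q r => S q r / (Ξ q r 0 1 * Ξ q r 0 2) with hG
  have hSG : ∀ q ∈ U, ∀ r ∈ Icc a b, S q r = G q r * (Ξ q r 0 1 * Ξ q r 0 2) :=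
    fun q hq r hr => (div_mul_cancel₀ _ (hpr q hq r hr).ne').symm
  have hGanti : ∀ q ∈ U, StrictAntiOn (G q) (Icc a b) := by
    intro q hq r hr s hs hrs
    have k := B.le_quotient_sub (hP q hq) (hΞ q hq r hr) (hΞ q hq s hs) (hΞl q hq r hr)
      (hΞl q hq s hs) hm0 (hΞ1 q hq r hr) (hΞ1 q hq s hs) (hτ q hq r hr) (hτ q hq s hs)
      (by rw [hΞ2 q hq r hr, hΞ2 q hq s hs]; exact hrs.le)
    rw [← hM] at k
    obtain ⟨-, -, -, -, -, k6, -⟩ := hU hq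
    have k7 : 0 < (-2 * q.2.2 - q.1 * M) * (Ξ q s 0 2 - Ξ q r 0 2) := by
      rw [hΞ2 q hq r hr, hΞ2 q hq s hs]
      exact mul_pos (by linarith) (by linarith)
    exact sub_pos.1 (k7.trans_le k)
  have hGapprox : ∀ q ∈ U, ∀ r ∈ Icc a b, |G q r - (1 + 2 * r * q.2.2)| ≤ q.1 * M₀ := by
    intro q hq r hr
    have k := B.abs_quotient_sub_le (hP q hq) (hΞ q hq r hr) (hΞl q hq r hr) (hτ q hq r hr)
    rw [← hM₀, hΞ2 q hq r hr] at k
    simp only [hG, hS, hΞ2 q hq r hr]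
    exact k
  have hlin : ∀ q ∈ U, ∀ r ∈ Icc r₁ R, |1 + 2 * r * q.2.2 + 8 / R * (r - R / 8)| ≤
      2 * R * |q.2.2 - h₀| := by
    intro q hq r hr
    have e : 1 + 2 * r * q.2.2 + 8 / R * (r - R / 8) = 2 * r * (q.2.2 - h₀) := by
      rw [hh₀]
      field_simp
      ring
    have hr0 := hr₁.trans_le hr.1
    rw [e, abs_mul, abs_of_pos (by positivity : 0 < 2 * r)]
    have := hr.2
    gcongr
  have haI : a ∈ Icc a b := ⟨le_rfl, hab.le⟩
  have hbI : b ∈ Icc a b := ⟨hab.le, le_rfl⟩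
  -- `G q r` is within `8 / R * δ₁` of `-(8 / R) (r - R / 8)`, hence changes sign on `[a, b]`
  have hGa : ∀ q ∈ U, 0 < G q a := fun q hq => by
    have k1 := (abs_le.1 (hGapprox q hq a haI)).1
    have k2 := (abs_le.1 (hlin q hq a ((hP q hq).mem_Icc_of_mem_window (hI q hq a haI)))).1
    obtain ⟨-, -, -, -, -, -, k7⟩ := hU hq
    have e : 8 / R * (a - R / 8) = -(8 / R * δ₁) := by rw [ha]; ring
    linarith
  have hGb : ∀ q ∈ U, G q b < 0 := fun q hq => by
    have k1 := (abs_le.1 (hGapprox q hq b hbI)).2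
    have k2 := (abs_le.1 (hlin q hq b ((hP q hq).mem_Icc_of_mem_window (hI q hq b hbI)))).2
    obtain ⟨-, -, -, -, -, -, k7⟩ := hU hq
    have e : 8 / R * (b - R / 8) = 8 / R * δ₁ := by rw [hb]; ring
    linarith
  -- continuity of the launch points and of the Kepler integral at the quarter time
  have hLc : ContinuousOn (fun p : (ℝ × ℝ × ℝ) × ℝ => launchPoint fh p.1.2.1 p.1.2.2 p.1.1 p.2)
      (U ×ˢ Icc a b) := by
    have k1 : ContinuousOn (fun p : (ℝ × ℝ × ℝ) × ℝ => keplerV fh p.1.2.1 p.1.1 p.2 0)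
        (U ×ˢ Icc a b) := by
      have k2 : Continuous fun p : (ℝ × ℝ × ℝ) × ℝ =>
          ((!₂[0, 0, p.2, 0] : Phase), (p.1.2.1, p.1.1)) := by
        refine Continuous.prodMk ((PiLp.continuous_toLp 2 _).comp (continuous_pi fun i => ?_))
          (by fun_prop)
        fin_cases i <;> simp <;> fun_prop
      have k3 : MapsTo (fun p : (ℝ × ℝ × ℝ) × ℝ => ((!₂[0, 0, p.2, 0] : Phase), (p.1.2.1, p.1.1)))
          (U ×ˢ Icc a b) phaseDomain := fun p hp =>
        ⟨by simpa using B.pos_of_mem_window (hP _ hp.1) (hI _ hp.1 _ hp.2),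
          Icc_half_subset_Ico_one (hP _ hp.1).ε_mem⟩
      simpa [Function.comp_def] using B.contDiffOn_keplerV.continuousOn.comp k2.continuousOn k3
    refine (PiLp.continuous_toLp 2 _).comp_continuousOn (continuousOn_pi.2 fun i => ?_)
    fin_cases i
    · exact continuousOn_const
    · exact (continuousOn_const.mul ((by fun_prop : Continuous
        fun p : (ℝ × ℝ × ℝ) × ℝ => p.1.2.2).continuousOn.sub k1)).sqrt
    · exact continuousOn_snd
    · exact continuousOn_const
  have hSc : ContinuousOn (fun p : (ℝ × ℝ × ℝ) × ℝ => S p.1 p.2) (U ×ˢ Icc a b) := by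
    intro p hp
    set M₁ := K * quarterExp r₁ R K + K * (quarterBound r₁ R * quarterExp r₁ R K ^ 2 / m) + 1
    have k1 : ∀ p' ∈ U ×ˢ Icc a b, dist (S p'.1 p'.2) (S p.1 p.2) ≤
        M₁ * (‖launchPoint fh p'.1.2.1 p'.1.2.2 p'.1.1 p'.2 -
          launchPoint fh p.1.2.1 p.1.2.2 p.1.1 p.2‖ +
          K * ‖((p'.1.2.1, p'.1.1) : ℝ × ℝ) - (p.1.2.1, p.1.1)‖) := by
      intro p' hp'
      have k := B.abs_integral_quarter_sub_le (hP _ hp'.1) (hP _ hp.1) (hΞ _ hp'.1 _ hp'.2)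
        (hΞ _ hp.1 _ hp.2) (hΞl _ hp'.1 _ hp'.2) (hΞl _ hp.1 _ hp.2) (hτ _ hp'.1 _ hp'.2)
        (hτ _ hp.1 _ hp.2) hm0 (hΞ1 _ hp'.1 _ hp'.2) (hΞ1 _ hp.1 _ hp.2)
      rw [hΞ0 _ hp'.1 _ hp'.2, hΞ0 _ hp.1 _ hp.2] at k
      exact k
    refine tendsto_iff_dist_tendsto_zero.2 (squeeze_zero' (Eventually.of_forall fun _ => dist_nonneg)
      (eventually_mem_nhdsWithin.mono k1) ?_)
    have k2 : ContinuousWithinAt (fun p' : (ℝ × ℝ × ℝ) × ℝ =>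
        M₁ * (‖launchPoint fh p'.1.2.1 p'.1.2.2 p'.1.1 p'.2 -
          launchPoint fh p.1.2.1 p.1.2.2 p.1.1 p.2‖ +
          K * ‖((p'.1.2.1, p'.1.1) : ℝ × ℝ) - (p.1.2.1, p.1.1)‖)) (U ×ˢ Icc a b) p :=
      continuousWithinAt_const.mul (((hLc p hp).sub continuousWithinAt_const).norm.add
        (by fun_prop : Continuous fun p' : (ℝ × ℝ × ℝ) × ℝ =>
          K * ‖((p'.1.2.1, p'.1.1) : ℝ × ℝ) - (p.1.2.1, p.1.1)‖).continuousWithinAt)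
    have k3 := k2.tendsto
    simpa using k3
  have hroot : ∀ q ∈ U, ∃ r ∈ Ioo a b, S q r = 0 := by
    intro q hq
    have k1 : ContinuousOn (S q) (Icc a b) :=
      hSc.comp (f := fun r => (q, r)) (by fun_prop) fun r hr => ⟨hq, hr⟩
    obtain ⟨r, hr, hr0⟩ := intermediate_value_Ioo' hab.le k1 (show (0 : ℝ) ∈ Ioo (S q b) (S q a) from
      ⟨by rw [hSG q hq b hbI]; exact mul_neg_of_neg_of_pos (hGb q hq) (hpr q hq b hbI),
        by rw [hSG q hq a haI]; exact mul_pos (hGa q hq) (hpr q hq a haI)⟩)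
    exact ⟨r, hr, hr0⟩
  choose! ρ hρ hρ0 using hroot
  have hGρ : ∀ q ∈ U, G q (ρ q) = 0 := fun q hq => by simp only [hG, hρ0 q hq, zero_div]
  have hρI : ∀ q ∈ U, ρ q ∈ Icc a b := fun q hq => Ioo_subset_Icc_self (hρ q hq)
  have hρc : ContinuousOn ρ U := by
    have hsign : ∀ q ∈ U, ∀ r ∈ Icc a b, (0 < S q r ↔ r < ρ q) ∧ (S q r < 0 ↔ ρ q < r) := by
      intro q hq r hr
      have k1 := (hGanti q hq).lt_iff_gt (hρI q hq) hr
      have k2 := (hGanti q hq).lt_iff_gt hr (hρI q hq)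
      rw [hGρ q hq] at k1 k2
      rw [hSG q hq r hr]
      exact ⟨(mul_pos_iff_of_pos_right (hpr q hq r hr)).trans k1,
        Iff.trans ⟨fun k => neg_of_mul_neg_left k (hpr q hq r hr).le,
          fun k => mul_neg_of_neg_of_pos k (hpr q hq r hr)⟩ k2⟩
    exact continuousOn_of_sign_change (S := S) hρ
      (fun r hr => hSc.comp (f := fun q => (q, r)) (by fun_prop) fun q hq => ⟨hq, hr⟩)
      (fun q hq r hr => (hsign q hq r hr).1.1) (fun q hq r hr => (hsign q hq r hr).2.1)
      (fun q hq r hr => (hsign q hq r hr).1.2) (fun q hq r hr => (hsign q hq r hr).2.2)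
  refine ⟨δ, hδ, fun q => launchPoint fh q.2.1 q.2.2 q.1 (ρ q),
    hLc.comp (continuousOn_id.prodMk hρc) fun q hq => ⟨hq, hρI q hq⟩, fun q hq => ⟨hP q hq, ?_, ?_⟩⟩
  · refine ⟨Ξ q (ρ q), hΞ q hq _ (hρI q hq), hΞ0 q hq _ (hρI q hq), hΞl q hq _ (hρI q hq),
      isQuarterBrake_iff.2 ⟨_, hτ q hq _ (hρI q hq), ?_⟩⟩
    exact (B.integral_quarter_eq_zero_iff (hP q hq) (hΞ q hq _ (hρI q hq)) (hΞl q hq _ (hρI q hq))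
      (hτ q hq _ (hρI q hq))).1 (hρ0 q hq)
  · intro ξ hξ hl hqb
    obtain ⟨t₁, ht₁, hz⟩ := isQuarterBrake_iff.1 hqb
    have hz' := (B.integral_quarter_eq_zero_iff (hP q hq) hξ hl ht₁).2 hz
    have k1 := B.abs_quotient_sub_le (hP q hq) hξ hl ht₁
    rw [hz', zero_div, zero_sub, abs_neg, ← hM₀] at k1
    obtain ⟨-, -, hr, -⟩ := mem_phaseBox_iff.1 (B.mem_phaseBox (hP q hq) (hξ.mem 0))
    have k2 := abs_le.1 (hlin q hq _ hr)
    have k3 := abs_le.1 k1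
    obtain ⟨-, -, -, -, -, k6, k7⟩ := hU hq
    -- by the a priori estimate the launch lies over `[a, b]`
    have hrI : ξ 0 2 ∈ Icc a b := by
      have k8 : 8 / R * (ξ 0 2 - R / 8) ≤ 8 / R * δ₁ := by linarith [k2.1, k2.2, k3.1, k3.2]
      have k9 : 8 / R * -δ₁ ≤ 8 / R * (ξ 0 2 - R / 8) := by linarith [k2.1, k2.2, k3.1, k3.2]
      have k10 := le_of_mul_le_mul_left k8 (by positivity)
      have k11 := le_of_mul_le_mul_left k9 (by positivity)
      constructor <;> linarith
    have hξ0 := hξ.eq_launchPoint hl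
    have hm1 : m ≤ ξ 0 1 := by
      have := hmp q hq _ hrI
      rw [← hξ.launch_energy hl, Real.sqrt_sq hl.one.le] at this
      exact this
    have hzero : ∀ r ∈ Icc a b, G q r = 0 → ξ 0 2 = r := by
      intro r hr' hGr
      rcases le_total (ξ 0 2) r with hle | hle
      · have k := B.le_quotient_sub (hP q hq) hξ (hΞ q hq r hr') hl (hΞl q hq r hr') hm0 hm1
          (hΞ1 q hq r hr') ht₁ (hτ q hq r hr') (by rwa [hΞ2 q hq r hr'])
        rw [← hM, hz', zero_div, hΞ2 q hq r hr'] at k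
        simp only [hG, hS, hΞ2 q hq r hr'] at hGr
        rw [hGr, sub_zero] at k
        exact le_antisymm hle (sub_nonpos.1 (nonpos_of_mul_nonpos_right k (by linarith)))
      · have k := B.le_quotient_sub (hP q hq) (hΞ q hq r hr') hξ (hΞl q hq r hr') hl hm0
          (hΞ1 q hq r hr') hm1 (hτ q hq r hr') ht₁ (by rwa [hΞ2 q hq r hr'])
        rw [← hM, hz', zero_div, hΞ2 q hq r hr'] at k
        simp only [hG, hS, hΞ2 q hq r hr'] at hGr
        rw [hGr, sub_zero] at k
        exact le_antisymm (sub_nonpos.1 (nonpos_of_mul_nonpos_right k (by linarith))) hle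
    rw [hξ0, hzero _ (hρI q hq) (hGρ q hq)]

end KeplerBox

/-! ### The unperturbed problem -/

/-- The square `(z p_r - r p_z)² + ω² (r² + z²) / r²` of the total angular momentum. -/
noncomputable def momentumSq (ω : ℝ) (x : Phase) : ℝ :=
  (x 3 * x 0 - x 2 * x 1) ^ 2 + ω ^ 2 * (1 + (x 3) ^ 2 / (x 2) ^ 2)

/-- The total angular momentum is a first integral of the Kepler problem. -/
theorem hasDerivAt_momentumSq {fr fz : ℝ → ℝ → ℝ → ℝ} {ω t : ℝ} {ξ : ℝ → Phase}
    (hr : 0 < ξ t 2) (hξ : HasDerivAt ξ (keplerField fr fz ω 0 (ξ t)) t) :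
    HasDerivAt (fun t => momentumSq ω (ξ t)) 0 t := by
  have h0 := hξ.phase_apply 0
  have h1 := hξ.phase_apply 1
  have h2 := hξ.phase_apply 2
  have h3 := hξ.phase_apply 3
  have hD := sq_add_sq_pos hr (ξ t 3)
  have hD' := Real.sqrt_pos.2 hD
  have hL := (((h3.mul h0).sub (h2.mul h1)).pow 2).add ((((h3.pow 2).div (h2.pow 2)
    (by simpa using hr.ne')).const_add (1 : ℝ)).const_mul (ω ^ 2))
  refine HasDerivAt.congr_deriv hL ?_
  simp [keplerField, wellField, keplerVr, keplerVz]
  generalize √((ξ t 2) ^ 2 + (ξ t 3) ^ 2) = D at *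
  generalize ξ t 0 = p at *
  generalize ξ t 1 = q at *
  generalize ξ t 2 = r at *
  generalize ξ t 3 = z at *
  field_simp
  ring

namespace KeplerBox

variable {fh fr fz : ℝ → ℝ → ℝ → ℝ} {r₁ R K ω h ε : ℝ} {ξ : ℝ → Phase}
  (B : KeplerBox fh fr fz r₁ R K)
include B

/-- Unperturbed launches at the radius `-1 / (2h)` belong to circular Kepler orbits. -/
theorem sq_add_sq_eq (P : IsAdmissible r₁ R K ω h 0) (hξ : IsKeplerSolution fh fr fz R ω h 0 ξ)
    (hl : IsLaunch ξ) (hr : 1 + 2 * ξ 0 2 * h = 0) (t : ℝ) :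
    (ξ t 2) ^ 2 + (ξ t 3) ^ 2 = (1 / (2 * h)) ^ 2 := by
  have hpos : ∀ t, 0 < ξ t 2 := fun t => B.r₁_pos_of_mem (B.mem_phaseBox P (hξ.mem t))
  have hd : ∀ t, HasDerivAt (fun t => momentumSq ω (ξ t)) 0 t := fun t =>
    hasDerivAt_momentumSq (hpos t) (hξ.solves t)
  have hconst : momentumSq ω (ξ t) = momentumSq ω (ξ 0) :=
    is_const_of_deriv_eq_zero (fun t => (hd t).differentiableAt) (fun t => (hd t).deriv) t 0
  have hE0 := hξ.launch_energy hl
  have hr0 := hpos 0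
  have hs : √((ξ 0 2) ^ 2 + 0 ^ 2) = ξ 0 2 := by
    rw [zero_pow two_ne_zero, add_zero, Real.sqrt_sq hr0.le]
  rw [keplerV, hs] at hE0
  have h0 : momentumSq ω (ξ 0) = ξ 0 2 := by
    have e : (ξ 0 2) ^ 2 * (ξ 0 1) ^ 2 + ω ^ 2 = 2 * (ξ 0 2) ^ 2 * h + 2 * ξ 0 2 := by
      rw [hE0]
      field_simp
      ring
    rw [momentumSq, hl.zero, hl.three]
    linear_combination e + ξ 0 2 * hr
  have hE := (hξ.mem t).2.2
  rw [h0, momentumSq] at hconst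
  rw [wellEnergy, keplerV] at hE
  have hD := sq_add_sq_pos (hpos t) (ξ t 3)
  have hD' := Real.sqrt_pos.2 hD
  have hD2 := Real.sq_sqrt hD.le
  rw [← hD2]
  have hh := B.h_neg P
  set a := ξ 0 2
  generalize √((ξ t 2) ^ 2 + (ξ t 3) ^ 2) = D at *
  have hrt := hpos t
  generalize ξ t 0 = p at *
  generalize ξ t 1 = q at *
  generalize ξ t 2 = r at *
  generalize ξ t 3 = z at *
  have ha : a = -(1 / (2 * h)) := by
    rw [← neg_div, eq_div_iff (by linarith)]
    linarith
  -- the energy and the angular momentum determine `(r p_r + z p_z)²`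
  have key : (r * p + z * q) ^ 2 * a = -(D - a) ^ 2 := by
    have e1 : D ^ 2 * (p ^ 2 + q ^ 2) = 2 * D ^ 2 * h - ω ^ 2 * (1 + z ^ 2 / r ^ 2) + 2 * D := by
      have e2 : p ^ 2 + q ^ 2 = 2 * h - ω ^ 2 / r ^ 2 + 2 / D := by
        rw [← hE]
        field_simp
        ring
      rw [e2]
      field_simp
      linear_combination -ω ^ 2 * hD2
    have e3 : (r * p + z * q) ^ 2 = D ^ 2 * (p ^ 2 + q ^ 2) - (z * p - r * q) ^ 2 := by
      rw [hD2]
      ring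
    linear_combination a * e3 + a * e1 - a * hconst + D ^ 2 * hr
  have hDa : D = a := by
    have : 0 ≤ (r * p + z * q) ^ 2 * a := by positivity
    nlinarith [sq_nonneg (D - a)]
  rw [hDa, ha, neg_sq]

end KeplerBox

/-! ### Brake orbits of the perturbed problem -/

/-- `ζ` is a `z`-symmetric brake orbit that forms a Hopf link with `ξ`. -/
structure IsLinkedBrake (f : EuclideanSpace ℝ (Fin 3) → ℝ → ℝ) (h ω ε : ℝ) (ζ ξ : ℝ → Phase) :
    Prop where
  periodic : IsPeriodicSolutionIn f h ω ε ζ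
  brake : IsBrake ζ
  symmetric : IsZSymmetric ζ
  link : IsHopfLink (energySurface f h ω ε) (range ζ) (range ξ)

/-- `ξ` is, up to time translation, the only planar periodic solution. -/
structure IsPlanarOrbit (f : EuclideanSpace ℝ (Fin 3) → ℝ → ℝ) (h ω ε : ℝ) (ξ : ℝ → Phase) :
    Prop where
  periodic : IsPeriodicSolutionIn f h ω ε ξ
  planar : IsPlanar ξ
  unique : ∀ η, IsPeriodicSolutionIn f h ω ε η → IsPlanar η → ∃ s : ℝ, ∀ t, η t = ξ (t + s)

theorem IsPlanarOrbit.range_eq {f : EuclideanSpace ℝ (Fin 3) → ℝ → ℝ} {h ω ε : ℝ}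
    {ξ ξ' : ℝ → Phase} (hξ : IsPlanarOrbit f h ω ε ξ) (hξ' : IsPlanarOrbit f h ω ε ξ') :
    range ξ' = range ξ := by
  obtain ⟨s, hs⟩ := hξ.unique ξ' hξ'.periodic hξ'.planar
  have : ξ' = ξ ∘ fun t => t + s := funext hs
  rw [this]
  exact (Equiv.addRight s).surjective.range_comp ξ

/-- The properties of the linked brake orbit `ζ`, started on the ray `p_r = z = 0`, `p_z > 0`. -/
structure IsBrakeOrbit (f : EuclideanSpace ℝ (Fin 3) → ℝ → ℝ) (h ω ε : ℝ) (ζ ξ : ℝ → Phase) :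
    Prop where
  linked : IsLinkedBrake f h ω ε ζ ξ
  launch : IsLaunch ζ
  unique : ∀ η, IsLinkedBrake f h ω ε η ξ → ∃ s : ℝ, ∀ t, η t = ζ (t + s)
  launch_unique : ∀ η, IsLinkedBrake f h ω ε η ξ → IsLaunch η → η 0 = ζ 0
  circular : ε = 0 → ∀ t, (ζ t 2) ^ 2 + (ζ t 3) ^ 2 = (1 / (2 * h)) ^ 2

/-- All the assertions for a single energy surface, with a brake orbit starting at `x`. -/
structure HasBrakeOrbit (f : EuclideanSpace ℝ (Fin 3) → ℝ → ℝ) (h ω ε : ℝ) (x : Phase) : Prop where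
  ne_zero : ω ≠ 0
  sphere : Nonempty (energySurface f h ω ε ≃ₜ ThreeSphere)
  lt : ∀ x ∈ energySurface f h ω ε, ω ^ 2 / 2 < x 2
  orbits : ∃ ξ ζ, IsPlanarOrbit f h ω ε ξ ∧ IsBrakeOrbit f h ω ε ζ ξ ∧ ζ 0 = x

/-- The starting point of the brake orbit is determined by the parameters. -/
theorem HasBrakeOrbit.eq {f : EuclideanSpace ℝ (Fin 3) → ℝ → ℝ} {h ω ε : ℝ} {x x' : Phase}
    (hx : HasBrakeOrbit f h ω ε x) (hx' : HasBrakeOrbit f h ω ε x') : x = x' := by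
  obtain ⟨ξ, ζ, h1, h2, rfl⟩ := hx.orbits
  obtain ⟨ξ', ζ', h1', h2', rfl⟩ := hx'.orbits
  refine h2'.launch_unique ζ ⟨h2.linked.periodic, h2.linked.brake, h2.linked.symmetric, ?_⟩
    h2.launch
  rw [h1.range_eq h1']
  exact h2.linked.link

namespace KeplerBox

variable {f : EuclideanSpace ℝ (Fin 3) → ℝ → ℝ} {fr fz : ℝ → ℝ → ℝ → ℝ} {r₁ R K ω h ε : ℝ}
  {ξ : ℝ → Phase} (B : KeplerBox (fun r z ε => f !₂[r, 0, z] ε) fr fz r₁ R K)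
  (P : IsAdmissible r₁ R K ω h ε)
include B P

/-- The component of the energy level over `(ω², 0)` is the part over the window. -/
theorem energySurface_eq :
    energySurface f h ω ε = keplerLevel (fun r z ε => f !₂[r, 0, z] ε) R ω h ε := by
  obtain ⟨rc, W⟩ := B.exists_hillWell P
  have hlev : energyLevel f h ω ε = {x : Phase | 0 < x 2 ∧
      wellEnergy (keplerV (fun r z ε => f !₂[r, 0, z] ε) ω ε) x = h} := by
    simp only [energyLevel, reducedHamiltonian_eq]
  ext x
  constructor
  · rintro ⟨y, hy, hy2, hy3, hx⟩
    rw [hlev] at hy hx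
    have hyN : y ∈ keplerLevel (fun r z ε => f !₂[r, 0, z] ε) R ω h ε :=
      ⟨hy2 ▸ B.sq_mem_window P, hy3 ▸ B.zero_mem_Icc, hy.2⟩
    rw [W.connectedComponentIn_eq hyN] at hx
    exact hx
  · intro hx
    have hyN := launchPoint_mem (B.sq_mem_window P) B.R_pos.le (B.keplerV_sq_lt P).le
    refine ⟨launchPoint (fun r z ε => f !₂[r, 0, z] ε) ω h ε (ω ^ 2), ?_, ?_, ?_, ?_⟩
    · rw [hlev]
      exact ⟨by simpa [launchPoint] using B.sq_pos P, hyN.2.2⟩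
    · simp [launchPoint]
    · simp [launchPoint]
    · rw [hlev, W.connectedComponentIn_eq hyN]
      exact hx

/-- The reduced Hamiltonian is differentiable along the energy surface, so its gradient is not a
junk value there and Hamilton's equations are those of the potential well. -/
theorem isPeriodicSolutionIn_iff : IsPeriodicSolutionIn f h ω ε ξ ↔
    IsKeplerSolution (fun r z ε => f !₂[r, 0, z] ε) fr fz R ω h ε ξ ∧
      ∃ T > 0, Function.Periodic ξ T := by
  have hfield : ∀ x ∈ keplerLevel (fun r z ε => f !₂[r, 0, z] ε) R ω h ε,
      hamiltonianField f ω ε x = wellField (keplerVr fr ω ε) (keplerVz fz ε) x := fun x hx =>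
    hamiltonianField_eq (B.hasFDerivAt_keplerV (B.pos_of_mem_window P hx.1)
      (Icc_half_subset_Ico_one P.ε_mem))
  constructor
  · rintro ⟨h1, h2, h3⟩
    rw [B.energySurface_eq P] at h1
    exact ⟨⟨h1, fun t => by rw [← hfield _ (h1 t)]; exact h2 t⟩, h3⟩
  · rintro ⟨⟨h1, h2⟩, h3⟩
    refine ⟨?_, fun t => by rw [hfield _ (h1 t)]; exact h2 t, h3⟩
    rw [B.energySurface_eq P]
    exact h1

/-- The launch satisfying the quarter-period condition yields the unique linked brake orbit. -/
theorem hasBrakeOrbit {x : Phase}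
    (hex : ∃ ζ, IsKeplerSolution (fun r z ε => f !₂[r, 0, z] ε) fr fz R ω h ε ζ ∧ ζ 0 = x ∧
      IsLaunch ζ ∧ IsQuarterBrake (keplerRate r₁ R) ζ)
    (huniq : ∀ ζ, IsKeplerSolution (fun r z ε => f !₂[r, 0, z] ε) fr fz R ω h ε ζ → IsLaunch ζ →
      IsQuarterBrake (keplerRate r₁ R) ζ → ζ 0 = x) : HasBrakeOrbit f h ω ε x := by
  obtain ⟨rc, W⟩ := B.exists_hillFlow P
  have hN := B.energySurface_eq P
  obtain ⟨Φ, -⟩ := W.exists_homeomorph_sphere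
  obtain ⟨ξ, hξ, hξp, hξT, hξu, hξr⟩ := W.exists_planar
  obtain ⟨ζ, hζ, rfl, hl, hq⟩ := hex
  have hsub : range ξ ⊆ wellLevel (keplerV (fun r z ε => f !₂[r, 0, z] ε) ω ε) h (ω ^ 2 / 2) R R :=
    range_subset_iff.2 hξ.mem
  obtain ⟨hT, hbr, hsym, hlink⟩ :=
    W.isBrake_of_isQuarterBrake hζ hl.zero hl.three hl.one.ne' hq hsub hξr
  -- every linked brake orbit passes through the launch point, and only there
  have key : ∀ η, IsLinkedBrake f h ω ε η ξ →
      IsKeplerSolution (fun r z ε => f !₂[r, 0, z] ε) fr fz R ω h ε η ∧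
      (IsLaunch η → η 0 = ζ 0) ∧ ∃ s, η s = ζ 0 := by
    intro η hη
    obtain ⟨hη1, hη2⟩ := (B.isPeriodicSolutionIn_iff P).1 hη.periodic
    have hlink' := hη.link
    rw [hN] at hlink'
    obtain ⟨t₀, h00, h03, -⟩ := hη.symmetric
    refine ⟨hη1, fun hlη => ?_, ?_⟩
    · have hqb := (W.isQuarterBrake_of_isHopfLink hη1 hη2 hη.brake hξr hlink' hlη.zero
        hlη.three).1 hlη.one
      simp only [add_zero] at hqb
      exact huniq η hη1 hlη hqb
    · obtain ⟨s, hs0, hs3, hs1, hqb⟩ :=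
        (W.isQuarterBrake_of_isHopfLink hη1 hη2 hη.brake hξr hlink' h00 h03).2
      have := huniq _ (hη1.comp_add s) ⟨by simpa using hs0, by simpa using hs1, by simpa using hs3⟩
        hqb
      exact ⟨s, by simpa using this⟩
  refine ⟨fun h0 => (B.sq_pos P).ne' (by rw [h0]; norm_num), ⟨?_⟩, ?_, ξ, ζ,
    ⟨(B.isPeriodicSolutionIn_iff P).2 ⟨hξ, hξT⟩, hξp, fun η hη hηp =>
      hξu η ((B.isPeriodicSolutionIn_iff P).1 hη).1 hηp⟩,
    ⟨⟨(B.isPeriodicSolutionIn_iff P).2 ⟨hζ, hT⟩, hbr, hsym, hN ▸ hlink⟩, hl, ?_, ?_, ?_⟩, rfl⟩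
  · exact (Homeomorph.setCongr hN).trans Φ
  · intro x hx
    rw [hN] at hx
    exact (W.window_of_mem hx).1.1
  · intro η hη
    obtain ⟨hη1, -, s, hs⟩ := key η hη
    refine ⟨-s, fun t => ?_⟩
    have := W.eq_of_apply_eq hη1 hζ hs (t - s)
    simpa [sub_eq_add_neg] using this
  · exact fun η hη => (key η hη).2.1
  · rintro rfl
    obtain ⟨t₁, ht₁, hz⟩ := isQuarterBrake_iff.1 hq
    have k := B.abs_quotient_sub_le P hζ hl ht₁
    rw [(B.integral_quarter_eq_zero_iff P hζ hl ht₁).2 hz, zero_div, zero_sub, abs_neg,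
      zero_mul] at k
    exact B.sq_add_sq_eq P hζ hl (abs_nonpos_iff.1 k)

end KeplerBox

/-- Near every point of the parameter domain of the Kepler problem, for small `ε`, there is a
linked brake orbit depending continuously on the parameters. -/
theorem IsSymmetricPerturbation.exists_hasBrakeOrbit {f : EuclideanSpace ℝ (Fin 3) → ℝ → ℝ}
    (hf : IsSymmetricPerturbation f) {ω₀ h₀ : ℝ} (h1 : -1 < 2 * h₀ * ω₀ ^ 2)
    (h2 : 2 * h₀ * ω₀ ^ 2 < 0) : ∃ δ > 0, ∃ X : ℝ × ℝ × ℝ → Phase,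
      ContinuousOn X (Metric.ball (0, ω₀, h₀) δ ∩ {q | 0 ≤ q.1}) ∧
      ∀ q ∈ Metric.ball (0, ω₀, h₀) δ ∩ {q : ℝ × ℝ × ℝ | 0 ≤ q.1},
        HasBrakeOrbit f q.2.2 q.2.1 q.1 (X q) := by
  obtain ⟨fr, fz, A⟩ := hf.exists_isAxialPerturbation
  have hω : 0 < ω₀ ^ 2 := by
    rcases (sq_nonneg ω₀).eq_or_lt with h3 | h3
    · rw [← h3] at h2
      simp at h2
    · exact h3
  have hh : h₀ < 0 := by
    by_contra! h3
    nlinarith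
  obtain ⟨K, B⟩ := A.exists_keplerBox (r₁ := ω₀ ^ 2 / 4) (R := 4 / -h₀) (by positivity)
    (div_pos four_pos (neg_pos.2 hh))
  obtain ⟨δ, hδ, X, hX, hX'⟩ := B.exists_brake_launch (ω₀ := ω₀) (h₀ := h₀) (by linarith)
    (by rw [lt_div_iff₀ (neg_pos.2 hh)]; linarith) (by
      rw [mul_div_assoc', div_eq_iff (neg_ne_zero.2 hh.ne)]
      ring)
  refine ⟨δ, hδ, X, hX, fun q hq => ?_⟩
  obtain ⟨P, hex, huniq⟩ := hX' q hq
  exact B.hasBrakeOrbit P hex huniq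

/-! ### Exhaustion of the parameter domain -/

/-- A gauge on the `(ω, h)`-plane that is positive exactly where `ω ≠ 0` and `-1 < 2hω² < 0`. Its
superlevel sets at positive levels are compact, and its only local maxima with positive value are
the points `(±1, -1/4)`. -/
noncomputable def paramMargin (x : ℝ × ℝ) : ℝ :=
  min (|x.1| / (1 + x.1 ^ 2)) (min (1 + 2 * x.2 * x.1 ^ 2) (-(2 * x.2 * x.1 ^ 2)))

theorem continuous_paramMargin : Continuous paramMargin := by
  unfold paramMargin
  have : ∀ x : ℝ × ℝ, 1 + x.1 ^ 2 ≠ 0 := fun x => by positivity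
  fun_prop (disch := assumption)

theorem paramMargin_pos_iff {x : ℝ × ℝ} : 0 < paramMargin x ↔
    x.1 ≠ 0 ∧ -1 < 2 * x.2 * x.1 ^ 2 ∧ 2 * x.2 * x.1 ^ 2 < 0 := by
  have h1 : 0 < |x.1| / (1 + x.1 ^ 2) ↔ x.1 ≠ 0 := by
    rw [div_pos_iff_of_pos_right (by positivity), abs_pos]
  rw [paramMargin, lt_min_iff, lt_min_iff, h1]
  refine and_congr_right fun _ => and_congr ⟨fun h => by linarith, fun h => by linarith⟩
    ⟨fun h => by linarith, fun h => by linarith⟩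

theorem paramMargin_le_half (x : ℝ × ℝ) : paramMargin x ≤ 1 / 2 := by
  have h1 : paramMargin x ≤ min _ _ := min_le_right _ _
  linarith [le_min_iff.1 h1]

theorem isCompact_le_paramMargin {c : ℝ} (hc : 0 < c) : IsCompact {x | c ≤ paramMargin x} := by
  refine (isCompact_Icc.prod isCompact_Icc : IsCompact
    (Icc (-(1 / c)) (1 / c) ×ˢ Icc (-(1 / c ^ 2)) (1 / c ^ 2))).of_isClosed_subset
    (isClosed_le continuous_const continuous_paramMargin) fun x hx => ?_
  obtain ⟨h1, h2⟩ := le_min_iff.1 (show c ≤ paramMargin x from hx)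
  obtain ⟨h2, h3⟩ := le_min_iff.1 h2
  rw [le_div_iff₀ (by positivity)] at h1
  have hsq := sq_abs x.1
  have h0 := abs_nonneg x.1
  have h4 : c ≤ |x.1| := by nlinarith [sq_nonneg x.1]
  have h5 : |x.1| * c ≤ 1 := by
    have : 0 < |x.1| := hc.trans_le h4
    by_contra! h
    nlinarith
  have h6 : c ^ 2 ≤ x.1 ^ 2 := by rw [← hsq]; gcongr
  have h7 : x.2 ≤ 0 := by
    by_contra! h
    nlinarith
  refine ⟨abs_le.1 ((le_div_iff₀ hc).2 h5), ?_, h7.trans (by positivity)⟩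
  rw [neg_le, le_div_iff₀ (by positivity)]
  nlinarith

/-- Moving `(ω, 2hω²)` along a segment towards `(±1, -1/2)` increases the gauge. -/
theorem mem_closure_lt_paramMargin {x : ℝ × ℝ} (h0 : 0 < paramMargin x)
    (h1 : paramMargin x < 1 / 2) : x ∈ closure {y | paramMargin x < paramMargin y} := by
  have hω := (paramMargin_pos_iff.1 h0).1
  have ha : 0 < |x.1| := abs_pos.2 hω
  set w : ℝ → ℝ := fun τ => x.1 * ((1 - τ) + τ / |x.1|) with hw
  set p : ℝ → ℝ × ℝ := fun τ =>
    (w τ, ((1 - τ) * (2 * x.2 * x.1 ^ 2) - τ / 2) / (2 * w τ ^ 2)) with hp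
  have hw0 : w 0 = x.1 := by simp [hw]
  have hp0 : p 0 = x := by
    ext
    · exact hw0
    · simp only [hp, hw0]
      field_simp
      ring
  have hwc : Continuous w := by fun_prop
  have hpc : ContinuousAt p 0 := by
    refine hwc.continuousAt.prodMk (ContinuousAt.div (by fun_prop) (by fun_prop) ?_)
    rw [hw0]
    positivity
  have hlim : Tendsto p (𝓝[>] 0) (𝓝 x) := by
    have := hpc.tendsto
    rw [hp0] at this
    exact this.mono_left nhdsWithin_le_nhds
  refine mem_closure_of_tendsto hlim ?_
  filter_upwards [Ioo_mem_nhdsGT one_pos] with τ hτ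
  -- `|ω|` moves towards `1` and `2hω²` towards `-1/2`
  have hwa : |w τ| = (1 - τ) * |x.1| + τ := by
    have : 0 ≤ (1 - τ) + τ / |x.1| :=
      add_nonneg (sub_nonneg.2 hτ.2.le) (div_nonneg hτ.1.le ha.le)
    rw [hw, abs_mul, abs_of_nonneg this]
    field_simp
  have hwpos : 0 < |w τ| := by
    rw [hwa]
    have := mul_pos (sub_pos.2 hτ.2) ha
    linarith [hτ.1]
  have hwne : w τ ≠ 0 := abs_pos.1 hwpos
  have hs : 2 * (p τ).2 * (p τ).1 ^ 2 = (1 - τ) * (2 * x.2 * x.1 ^ 2) - τ / 2 := by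
    simp only [hp]
    field_simp
  obtain ⟨g1, g2⟩ := le_min_iff.1 (le_refl (paramMargin x))
  obtain ⟨g2, g3⟩ := le_min_iff.1 g2
  have hτ1 := sub_pos.2 hτ.2
  refine lt_min ?_ (lt_min ?_ ?_)
  · rcases eq_or_ne |x.1| 1 with h | h
    · have hwone : |w τ| = 1 := by rw [hwa, h]; ring
      change _ < |w τ| / (1 + w τ ^ 2)
      rw [← sq_abs (w τ), hwone]
      linarith
    · refine g1.trans_lt ?_
      change _ < |w τ| / (1 + w τ ^ 2)
      rw [← sq_abs (w τ), ← sq_abs x.1, div_lt_div_iff₀ (by positivity) (by positivity), hwa]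
      have : 0 < τ * (1 - |x.1|) ^ 2 * (1 + |x.1| * (1 - τ)) :=
        mul_pos (mul_pos hτ.1 (by have := sub_ne_zero.2 h.symm; positivity)) (by positivity)
      nlinarith
  · rw [hs]
    nlinarith [hτ.1]
  · rw [hs]
    nlinarith [hτ.1]

/-- Near `q = (ε, ω, h)` the brake orbits exist and depend continuously on the parameters. -/
def HasBrakeOrbitNear (f : EuclideanSpace ℝ (Fin 3) → ℝ → ℝ) (q : ℝ × ℝ × ℝ) : Prop :=
  ∃ U ∈ 𝓝[{q : ℝ × ℝ × ℝ | 0 ≤ q.1}] q, ∃ X : ℝ × ℝ × ℝ → Phase, ContinuousOn X U ∧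
    ∀ q' ∈ U, HasBrakeOrbit f q'.2.2 q'.2.1 q'.1 (X q')

/-- Bounds `e ≤ 1` such that brake orbits exist for all `ε < e` and all parameters with gauge at
least `c`. -/
def brakeThresholds (f : EuclideanSpace ℝ (Fin 3) → ℝ → ℝ) (c : ℝ) : Set ℝ :=
  {e | e ∈ Icc 0 1 ∧ ∀ x, c ≤ paramMargin x → 0 < paramMargin x →
    ∀ ε ∈ Ico 0 e, HasBrakeOrbitNear f (ε, x)}

/-- The optimal threshold; it is monotone in the gauge but possibly discontinuous. -/
noncomputable def brakeThreshold (f : EuclideanSpace ℝ (Fin 3) → ℝ → ℝ) (c : ℝ) : ℝ :=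
  sSup (brakeThresholds f c)

/-- The primitive of the optimal threshold, a smaller threshold which is continuous and strictly
increasing. -/
noncomputable def brakeBound (f : EuclideanSpace ℝ (Fin 3) → ℝ → ℝ) (c : ℝ) : ℝ :=
  ∫ t in (0 : ℝ)..c, brakeThreshold f t

section Threshold

variable {f : EuclideanSpace ℝ (Fin 3) → ℝ → ℝ} {c d ε : ℝ} {x : ℝ × ℝ}

theorem zero_mem_brakeThresholds : 0 ∈ brakeThresholds f c :=
  ⟨by simp, by simp⟩

theorem bddAbove_brakeThresholds : BddAbove (brakeThresholds f c) :=
  ⟨1, fun _ he => he.1.2⟩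

theorem brakeThreshold_nonneg : 0 ≤ brakeThreshold f c :=
  le_csSup bddAbove_brakeThresholds zero_mem_brakeThresholds

theorem monotone_brakeThreshold : Monotone (brakeThreshold f) := fun _ _ hcd =>
  csSup_le_csSup bddAbove_brakeThresholds ⟨0, zero_mem_brakeThresholds⟩
    fun _ he => ⟨he.1, fun x hx => he.2 x (hcd.trans hx)⟩

theorem IsSymmetricPerturbation.brakeThreshold_pos (hf : IsSymmetricPerturbation f) (hc : 0 < c) :
    0 < brakeThreshold f c := by
  have key : ∃ e > 0, ∀ x ∈ {x | c ≤ paramMargin x}, ∀ ε ∈ Ico 0 e,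
      HasBrakeOrbitNear f (ε, x) := by
    refine (isCompact_le_paramMargin hc).induction_on ⟨1, one_pos, by simp⟩
      (fun s t hst ⟨e, he, h⟩ => ⟨e, he, fun x hx => h x (hst hx)⟩)
      (fun s t ⟨e, he, h⟩ ⟨e', he', h'⟩ => ⟨min e e', lt_min he he', ?_⟩) fun x hx => ?_
    · rintro x (hx | hx) ε hε
      · exact h x hx ε ⟨hε.1, hε.2.trans_le (min_le_left _ _)⟩
      · exact h' x hx ε ⟨hε.1, hε.2.trans_le (min_le_right _ _)⟩
    · obtain ⟨-, h1, h2⟩ := paramMargin_pos_iff.1 (hc.trans_le hx)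
      obtain ⟨δ, hδ, X, hX, hX'⟩ := hf.exists_hasBrakeOrbit h1 h2
      refine ⟨Metric.ball x δ, mem_nhdsWithin_of_mem_nhds (Metric.ball_mem_nhds x hδ), δ, hδ,
        fun y hy ε hε => ⟨_, ?_, X, hX, hX'⟩⟩
      refine inter_mem (mem_nhdsWithin_of_mem_nhds ?_) self_mem_nhdsWithin
      refine Metric.isOpen_ball.mem_nhds ?_
      rw [← ball_prod_same]
      refine ⟨?_, hy⟩
      rw [Metric.mem_ball, Real.dist_eq, sub_zero, abs_of_nonneg hε.1]
      exact hε.2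
  obtain ⟨e, he, h⟩ := key
  refine (lt_min he one_pos).trans_le (le_csSup bddAbove_brakeThresholds
    ⟨⟨(lt_min he one_pos).le, min_le_right _ _⟩, fun x hx _ ε hε => h x hx ε
      ⟨hε.1, hε.2.trans_le (min_le_left _ _)⟩⟩)

theorem intervalIntegrable_brakeThreshold (a b : ℝ) :
    IntervalIntegrable (brakeThreshold f) MeasureTheory.volume a b :=
  monotone_brakeThreshold.intervalIntegrable

theorem continuous_brakeBound : Continuous (brakeBound f) :=
  intervalIntegral.continuous_primitive intervalIntegrable_brakeThreshold 0

theorem brakeBound_zero : brakeBound f 0 = 0 :=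
  intervalIntegral.integral_same

theorem brakeBound_sub (c d : ℝ) :
    brakeBound f d - brakeBound f c = ∫ t in c..d, brakeThreshold f t :=
  intervalIntegral.integral_interval_sub_left (intervalIntegrable_brakeThreshold _ _)
    (intervalIntegrable_brakeThreshold _ _)

theorem monotone_brakeBound : Monotone (brakeBound f) := fun c d hcd => by
  rw [← sub_nonneg, brakeBound_sub]
  exact intervalIntegral.integral_nonneg hcd fun _ _ => brakeThreshold_nonneg

theorem IsSymmetricPerturbation.brakeBound_lt (hf : IsSymmetricPerturbation f) (hc : 0 ≤ c)
    (hcd : c < d) : brakeBound f c < brakeBound f d := by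
  rw [← sub_pos, brakeBound_sub]
  exact intervalIntegral.intervalIntegral_pos_of_pos_on (intervalIntegrable_brakeThreshold _ _)
    (fun t ht => hf.brakeThreshold_pos (hc.trans_lt ht.1)) hcd

theorem brakeBound_le_brakeThreshold (h0 : 0 ≤ c) (h1 : c ≤ 1) :
    brakeBound f c ≤ brakeThreshold f c := by
  have h := intervalIntegral.integral_mono_on h0 (intervalIntegrable_brakeThreshold (f := f) 0 c)
    intervalIntegrable_const fun t ht => monotone_brakeThreshold ht.2
  rw [intervalIntegral.integral_const, smul_eq_mul, sub_zero] at h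
  exact h.trans (mul_le_of_le_one_left brakeThreshold_nonneg h1)

theorem paramMargin_pos_of_lt_brakeBound (hε : 0 ≤ ε) (h : ε < brakeBound f (paramMargin x)) :
    0 < paramMargin x := by
  by_contra! h'
  have := monotone_brakeBound (f := f) h'
  rw [brakeBound_zero] at this
  linarith

theorem hasBrakeOrbitNear_of_lt_brakeBound (hε : 0 ≤ ε)
    (h : ε < brakeBound f (paramMargin x)) : HasBrakeOrbitNear f (ε, x) := by
  have hx := paramMargin_pos_of_lt_brakeBound hε h
  have h1 := h.trans_le (brakeBound_le_brakeThreshold hx.le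
    ((paramMargin_le_half x).trans (by norm_num)))
  obtain ⟨e, he, hεe⟩ := exists_lt_of_lt_csSup ⟨0, zero_mem_brakeThresholds⟩ h1
  exact he.2 x le_rfl hx ε ⟨hε, hεe⟩

/-- The superlevel sets of the gauge form a continuous family. At a boundary point of
`ε = brakeBound`, where the family might jump, the absence of local maxima of the gauge puts the
point into the closure; for `ε = 0` the sets only shrink. -/
theorem IsSymmetricPerturbation.isContinuousFamily (hf : IsSymmetricPerturbation f) :
    IsContinuousFamily (Ico 0 (brakeBound f (1 / 2)))
      fun ε => {x | ε < brakeBound f (paramMargin x)} := by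
  have hc : Continuous fun q : ℝ × ℝ × ℝ => brakeBound f (paramMargin q.2) :=
    continuous_brakeBound.comp (continuous_paramMargin.comp continuous_snd)
  refine ⟨fun ε hε x hx => mem_nhdsWithin_of_mem_nhds
    ((isOpen_lt continuous_fst hc).mem_nhds hx), fun ε hε x hx => ?_⟩
  rcases lt_trichotomy (brakeBound f (paramMargin x)) ε with h | h | h
  · refine mem_nhdsWithin_of_mem_nhds (mem_of_superset
      ((isOpen_lt hc continuous_fst).mem_nhds h) fun q hq hq' => ?_)
    exact lt_asymm (mem_ofPred.1 hq) (mem_ofPred.1 hq')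
  · rcases hε.1.eq_or_lt with rfl | hpos
    · have h2 : ∀ᶠ q : ℝ × ℝ × ℝ in 𝓝 (0, x), q.2 ∈
          (closure {x | 0 < brakeBound f (paramMargin x)})ᶜ :=
        continuous_snd.continuousAt.eventually_mem (isClosed_closure.isOpen_compl.mem_nhds hx)
      filter_upwards [mem_nhdsWithin_of_mem_nhds h2, self_mem_nhdsWithin] with q hq1 hq2 hq3
      exact hq1 (subset_closure (hq2.1.1.trans_lt hq3))
    · refine absurd ?_ hx
      have h3 : 0 < paramMargin x := by
        by_contra! h'
        have := monotone_brakeBound (f := f) h'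
        rw [brakeBound_zero] at this
        linarith
      have h4 : paramMargin x < 1 / 2 := by
        by_contra! h'
        have := monotone_brakeBound (f := f) h'
        linarith [hε.2]
      refine closure_mono (fun y hy => ?_) (mem_closure_lt_paramMargin h3 h4)
      rw [← h]
      exact hf.brakeBound_lt h3.le hy
  · exact (hx (subset_closure h)).elim

end Threshold

/-! ### The family of brake orbits -/

open scoped Classical in
/-- The linked brake orbit with parameters `ε` and `x = (ω, h)`, started on the ray `p_r = z = 0`,
`p_z > 0`; a junk value where there is none. -/
noncomputable def brakeOrbit (f : EuclideanSpace ℝ (Fin 3) → ℝ → ℝ) (ε : ℝ) (x : ℝ × ℝ) :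
    ℝ → Phase :=
  if hx : ∃ ζ ξ, IsPlanarOrbit f x.2 x.1 ε ξ ∧ IsBrakeOrbit f x.2 x.1 ε ζ ξ then hx.choose else 0

theorem HasBrakeOrbit.brakeOrbit {f : EuclideanSpace ℝ (Fin 3) → ℝ → ℝ} {ω h ε : ℝ} {y : Phase}
    (hy : HasBrakeOrbit f h ω ε y) : ∃ ξ, IsPlanarOrbit f h ω ε ξ ∧
      IsBrakeOrbit f h ω ε (brakeOrbit f ε (ω, h)) ξ := by
  obtain ⟨ξ, ζ, h1, h2, -⟩ := hy.orbits
  have hx : ∃ ζ ξ, IsPlanarOrbit f (ω, h).2 (ω, h).1 ε ξ ∧ IsBrakeOrbit f (ω, h).2 (ω, h).1 ε ζ ξ :=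
    ⟨ζ, ξ, h1, h2⟩
  rw [_root_.brakeOrbit, dif_pos hx]
  exact hx.choose_spec

theorem HasBrakeOrbit.brakeOrbit_zero {f : EuclideanSpace ℝ (Fin 3) → ℝ → ℝ} {ω h ε : ℝ}
    {y : Phase} (hy : HasBrakeOrbit f h ω ε y) : _root_.brakeOrbit f ε (ω, h) 0 = y := by
  obtain ⟨ξ, h1, h2⟩ := hy.brakeOrbit
  exact HasBrakeOrbit.eq ⟨hy.ne_zero, hy.sphere, hy.lt, ξ, _, h1, h2, rfl⟩ hy

/-- The chosen brake orbit starts at the unique possible point, hence depends continuously on the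
parameters although it is chosen separately for each of them. -/
theorem HasBrakeOrbitNear.continuousWithinAt {f : EuclideanSpace ℝ (Fin 3) → ℝ → ℝ} {q : ℝ × ℝ × ℝ}
    (hq : HasBrakeOrbitNear f q) (h0 : 0 ≤ q.1) :
    ContinuousWithinAt (fun q : ℝ × ℝ × ℝ => brakeOrbit f q.1 q.2 0) {q | 0 ≤ q.1} q := by
  obtain ⟨U, hU, X, hX, hX'⟩ := hq
  have hqU : q ∈ U := mem_of_mem_nhdsWithin h0 hU
  exact ((hX q hqU).congr (fun y hy => (hX' y hy).brakeOrbit_zero)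
    (hX' q hqU).brakeOrbit_zero).mono_of_mem_nhdsWithin hU

theorem mainTheorem4 (f : EuclideanSpace ℝ (Fin 3) → ℝ → ℝ) (hf : IsSymmetricPerturbation f) :
    ∃ ε₀ > (0 : ℝ), ∃ Γ : ℝ → Set (ℝ × ℝ), ∃ ξbz : ℝ → ℝ × ℝ → ℝ → Phase,
      IsContinuousFamily (Ico 0 ε₀) Γ ∧
      Γ 0 = {x : ℝ × ℝ | x.1 ≠ 0 ∧ -1 < 2 * x.2 * x.1 ^ 2 ∧ 2 * x.2 * x.1 ^ 2 < 0} ∧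
      (∀ ε ∈ Ico 0 ε₀, ∀ ω h : ℝ, (ω, h) ∈ Γ ε →
        ω ≠ 0 ∧
        Nonempty (energySurface f h ω ε ≃ₜ ThreeSphere) ∧
        (∀ x ∈ energySurface f h ω ε, ω ^ 2 / 2 < x 2) ∧
        ∃ ξ : ℝ → Phase,
          (IsPeriodicSolutionIn f h ω ε ξ ∧ IsPlanar ξ) ∧
          (∀ η : ℝ → Phase, IsPeriodicSolutionIn f h ω ε η → IsPlanar η →
            ∃ s : ℝ, ∀ t, η t = ξ (t + s)) ∧
          (IsPeriodicSolutionIn f h ω ε (ξbz ε (ω, h)) ∧ IsBrake (ξbz ε (ω, h)) ∧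
            IsZSymmetric (ξbz ε (ω, h)) ∧
            IsHopfLink (energySurface f h ω ε) (range (ξbz ε (ω, h))) (range ξ)) ∧
          (∀ η : ℝ → Phase, IsPeriodicSolutionIn f h ω ε η → IsBrake η → IsZSymmetric η →
            IsHopfLink (energySurface f h ω ε) (range η) (range ξ) →
            ∃ s : ℝ, ∀ t, η t = ξbz ε (ω, h) (t + s))) ∧
      ContinuousOn (fun q : ℝ × (ℝ × ℝ) => ξbz q.1 q.2 0)
        {q : ℝ × (ℝ × ℝ) | q.1 ∈ Ico 0 ε₀ ∧ q.2 ∈ Γ q.1} ∧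
      (∀ ω h : ℝ, (ω, h) ∈ Γ 0 → ∀ t,
        (ξbz 0 (ω, h) t 2) ^ 2 + (ξbz 0 (ω, h) t 3) ^ 2 = (1 / (2 * h)) ^ 2) := by
  have hpos : 0 < brakeBound f (1 / 2) := by
    rw [← brakeBound_zero (f := f)]
    exact hf.brakeBound_lt le_rfl (by norm_num)
  have horb : ∀ ε ω h : ℝ, 0 ≤ ε → ε < brakeBound f (paramMargin (ω, h)) →
      ∃ y, HasBrakeOrbit f h ω ε y := by
    intro ε ω h hε hlt
    obtain ⟨U, hU, X, -, hX⟩ := hasBrakeOrbitNear_of_lt_brakeBound hε hlt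
    exact ⟨_, hX _ (mem_of_mem_nhdsWithin hε hU)⟩
  refine ⟨_, hpos, fun ε => {x | ε < brakeBound f (paramMargin x)}, brakeOrbit f,
    hf.isContinuousFamily, ?_, ?_, ?_, ?_⟩
  · ext x
    refine Iff.trans ⟨paramMargin_pos_of_lt_brakeBound le_rfl, fun h => ?_⟩ paramMargin_pos_iff
    have := hf.brakeBound_lt le_rfl h
    rwa [brakeBound_zero] at this
  · intro ε hε ω h hlt
    obtain ⟨y, hy⟩ := horb ε ω h hε.1 hlt
    obtain ⟨ξ, h1, h2⟩ := hy.brakeOrbit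
    exact ⟨hy.ne_zero, hy.sphere, hy.lt, ξ, ⟨h1.periodic, h1.planar⟩, h1.unique,
      ⟨h2.linked.periodic, h2.linked.brake, h2.linked.symmetric, h2.linked.link⟩,
      fun η h3 h4 h5 h6 => h2.unique η ⟨h3, h4, h5, h6⟩⟩
  · rintro ⟨ε, x⟩ ⟨hε, hx⟩
    exact ((hasBrakeOrbitNear_of_lt_brakeBound hε.1 hx).continuousWithinAt hε.1).mono
      fun q hq => hq.1.1
  · intro ω h hlt
    obtain ⟨y, hy⟩ := horb 0 ω h le_rfl hlt
    obtain ⟨ξ, h1, h2⟩ := hy.brakeOrbit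
    exact h2.circular rfl
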